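/- **Setting.** Let $\mathcal X=\mathbb R^n$, $\mathcal V=\mathbb R^d$ with Euclidean norms, $A\in\mathbb R^{n\times n}$, $S(t)=e^{tA}$, $\alpha\in(1/3,1/2]$. *Linear part.* All eigenvalues of $A$ lie on $i\mathbb R$ or in $\{\operatorname{Re}z<0\}$; $\mathcal X=\mathcal X^c\oplus\mathcal X^s$ is the corresponding splitting into (real) generalized eigenspaces, $P^c,P^s$ are the associated projections (they commute with $S(t)$), $S^{c},S^{s}$ the restrictions of $S$ to $\mathcal X^c,\mathcal X^s$. There are $-\beta<0\le\gamma<\beta$ and $M_c,M_s\ge1$ with $|S^c(t)x|\le M_ce^{\gamma t}|x|$ for $t\le0$, $x\in\mathcal X^c$, and $|S^s(t)x|\le M_se^{-\beta t}|x|$ for $t\ge0$, $x\in\mathcal X^s$. *Coefficients.* (F) $F:\mathcal X\to\mathcal X$ is $C^1$ with bounded derivative (hence Lipschitz), $F(0)=0$, $DF(0)=0$. (G) $G:\mathcal X\to\mathcal L(\mathcal V,\mathcal X)$ is $C^3$ with bounded derivatives of orders $1,2,3$, $G(0)=0$, $DG(0)=0$, $D^2G(0)=0$. *Rough paths.* $\mathbf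 W=(W,\mathbb W)$ is a rough path on $\mathbb R$: on every compact interval $W$ is $\alpha$-Hölder with values in $\mathcal V$ and $\mathbb W_{s,t}\in\mathcal V\otimes\mathcal V$ ($s\le t$) is $2\alpha$-Hölder, and $\mathbb W_{s,t}-\mathbb W_{s,u}-\mathbb W_{u,t}=(W_u-W_s)\otimes(W_t-W_u)$ for $s\le u\le t$. Put $\Theta_\tau\mathbf W=(W_{\cdot+\tau}-W_\tau,\mathbb W_{\cdot+\tau,\cdot+\tau})$; $\|W\|_\alpha,\|\mathbb W\|_{2\alpha}$ are Hölder semi-norms on $[0,1]$. $D^{2\alpha}_W$ is the space of pairs $(Y,Y')$ on $[0,1]$, $Y$ with values in $\mathcal X$, $Y'$ in $\mathcal L(\mathcal V,\mathcal X)$, both $\alpha$-Hölder, such that $R^Y_{s,t}=Y_t-Y_s-Y'_s(W_t-W_s)$ ($s\le t$) is $2\alpha$-Hölder, with norm $\|Y,Y'\|_W=\|Y\|_\infty+\|Y'\|_\infty+\|Y'\|_\alpha+\|R^Y\|_{2\alpha}$. The rough integral is $\int_a^bZ\,d\mathbf W=\lim_{|\mathcal P|\to0}\sum_{[u,v]\in\mathcal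 P}(Z_u(W_v-W_u)+Z'_u\mathbb W_{u,v})$. *Cut-off.* Let $f:[0,\infty)\to[0,1]$ be $C^3$, $f=1$ on $[0,1/2]$, $f=0$ on $[1,\infty)$. For $K,C_1,C_2>0$ let $\widetilde R(W)$ solve $C_1\widetilde R+C_2\widetilde R(1+\|W\|_\alpha)(\|W\|_\alpha+\|\mathbb W\|_{2\alpha})=K$ and $R(W)=\min\{\widetilde R(W),1\}$. For $(Y,Y')\in D^{2\alpha}_W$ and $R=R(W)$ let $\chi_R(Y)=f(\|Y,Y'\|_W/R)\,Y$, $\chi_R(Y)'=f(\|Y,Y'\|_W/R)\,Y'$, $F_R(Y)(t)=F(\chi_R(Y)_t)$, $G_R(Y)(t)=G(\chi_R(Y)_t)$ with Gubinelli derivative $DG(\chi_R(Y)_t)\chi_R(Y)'_t$. *Sequences.* For $-\beta<\eta<0$, $BC^\eta(D^{2\alpha}_W)$ is the set of sequences $\mathbb U=((U^{i-1},(U^{i-1})'))_{i=0,-1,-2,\dots}$ with $(U^{i-1},(U^{i-1})')\in D^{2\alpha}_{\Theta_{i-1}W}$, $U^{i-1}_0=U^{i-2}_1$, and $\|\mathbb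 U\|_{BC^\eta}=\sup_{i\le0}e^{-\eta(i-1)}\|U^{i-1},(U^{i-1})'\|_{\Theta_{i-1}W}<\infty$. *The map.* For $\xi\in\mathcal X$, $\xi^c=P^c\xi$, let $J_{R,d}(W,\mathbb U,\xi)$ have at position $i-1$ the path $$\begin{aligned}&S^c(t+i-1)\xi^c-\sum_{k=i+1}^{0}S^c(t+i-1-k)\,I^c_{k}-\int_t^1S^c(t-r)P^cF_R(U^{i-1})(r)\,dr-\int_t^1S^c(t-r)P^cG_R(U^{i-1})(r)\,d\Theta_{i-1}\mathbf W_r\\&+\sum_{k=-\infty}^{i-1}S^s(t+i-1-k)\,I^s_{k}+\int_0^tS^s(t-r)P^sF_R(U^{i-1})(r)\,dr+\int_0^tS^s(t-r)P^sG_R(U^{i-1})(r)\,d\Theta_{i-1}\mathbf W_r,\end{aligned}$$ $t\in[0,1]$, where $I^{c/s}_k=\int_0^1S^{c/s}(1-r)P^{c/s}F_R(U^{k-1})(r)\,dr+\int_0^1S^{c/s}(1-r)P^{c/s}G_R(U^{k-1})(r)\,d\Theta_{k-1}\mathbf W_r$, and the Gubinelli derivative $G_R(U^{i-1})$; here $F_R(U^{k-1})$,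 $G_R(U^{k-1})$ are formed with the rough path $\Theta_{k-1}\mathbf W$ and $R=R(\Theta_{k-1}W)$. **Theorem.** There is a constant $C_S>0$ depending only on $S$, and for each $K>0$ a constant $C_0=C_0(K)>0$ depending only on $A,F,G,f,\alpha,d$ and $K$ (and independent of $K$ if $DF$ is Lipschitz), such that the following holds whenever the dichotomy bounds hold with $\beta,\gamma,M_c,M_s$, $-\beta<\eta<0$, $C_1,C_2\ge C_0(K)$ and $K>0$ satisfies the gap condition $$K\left(\frac{e^{\beta+\eta}(C_SM_se^{-\eta}+1)}{1-e^{-(\beta+\eta)}}+\frac{e^{\gamma-\eta}(C_SM_ce^{-\eta}+1)}{1-e^{-(\gamma-\eta)}}\right)<\frac14 .$$ For every rough path $\mathbf W$ on $\mathbb R$ and every $\xi\in\mathcal X$, the rough integrals and the series defining $J_{R,d}(W,\mathbb U,\xi)$ converge for all $\mathbb U\in BC^\eta(D^{2\alpha}_W)$, the map $J_{R,d}(W,\cdot,\xi)$ sends $BC^\eta(D^{2\alpha}_W)$ into itself, it satisfies $$\|J_{R,d}(W,\mathbb U,\xi)-J_{R,d}(W,\widetilde{\mathbb U},\xi)\|_{BC^\eta}\le\tfrac14\|\mathbb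 U-\widetilde{\mathbb U}\|_{BC^\eta},$$ and it has a unique fixed point $\Gamma(\xi^c,W)\in BC^\eta(D^{2\alpha}_W)$. -/

import Mathlib

open Set Filter Topology unitInterval
open scoped TensorProduct

namespace RoughCenter

noncomputable section

/-! ### Hölder semi-norms on the unit interval and rough paths on the real line -/

section Holder

variable {E : Type*} [NormedAddCommGroup E]

/-- `R : {0 ≤ s ≤ t ≤ 1} → E` is `β`-Hölder. -/
def IsHolderTwo (β : ℝ) (R : I → I → E) : Prop :=
  ∃ C : ℝ, ∀ s t : I, s ≤ t → ‖R s t‖ ≤ C * ((t : ℝ) - s) ^ β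

/-- The `β`-Hölder semi-norm `sup_{s < t} |R_{s,t}| / |t - s|^β`, as the least Hölder constant. -/
def holderSeminormTwo (β : ℝ) (R : I → I → E) : ℝ :=
  sInf {C : ℝ | 0 ≤ C ∧ ∀ s t : I, s ≤ t → ‖R s t‖ ≤ C * ((t : ℝ) - s) ^ β}

/-- The increments `Y_{s,t} = Y_t - Y_s`. -/
def incr (Y : I → E) (s t : I) : E := Y t - Y s

/-- The supremum norm of a (bounded) path on `[0,1]`. -/
def supNorm (Y : I → E) : ℝ := ⨆ t : I, ‖Y t‖

end Holder

/-- An `α`-Hölder rough path `(W, 𝕎)` on `ℝ`: `W` is `α`-Hölder and `𝕎` is `2α`-Hölder on every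
compact interval, and Chen's relation holds. -/
structure RoughPath (V : Type*) [NormedAddCommGroup V] [InnerProductSpace ℝ V] (α : ℝ) where
  path : ℝ → V
  area : ℝ → ℝ → V ⊗[ℝ] V
  path_holder : ∀ L : ℝ, ∃ C : ℝ, ∀ s t : ℝ, -L ≤ s → s ≤ t → t ≤ L →
    ‖path t - path s‖ ≤ C * (t - s) ^ α
  area_holder : ∀ L : ℝ, ∃ C : ℝ, ∀ s t : ℝ, -L ≤ s → s ≤ t → t ≤ L →
    ‖area s t‖ ≤ C * (t - s) ^ (2 * α)
  chen : ∀ s u t : ℝ, s ≤ u → u ≤ t →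
    area s t - area s u - area u t = (path u - path s) ⊗ₜ[ℝ] (path t - path u)

section Rough

variable {V : Type*} [NormedAddCommGroup V] [InnerProductSpace ℝ V] {α : ℝ}

/-- The time shift `Θ_τ 𝓦`. -/
def RoughPath.shift (𝓦 : RoughPath V α) (τ : ℝ) : RoughPath V α where
  path t := 𝓦.path (t + τ) - 𝓦.path τ
  area s t := 𝓦.area (s + τ) (t + τ)
  path_holder L := by
    obtain ⟨C, hC⟩ := 𝓦.path_holder (L + |τ|)
    refine ⟨C, fun s t h1 h2 h3 => ?_⟩
    have := hC (s + τ) (t + τ) (by linarith [neg_abs_le τ]) (by linarith)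
      (by linarith [le_abs_self τ])
    simpa using this
  area_holder L := by
    obtain ⟨C, hC⟩ := 𝓦.area_holder (L + |τ|)
    refine ⟨C, fun s t h1 h2 h3 => ?_⟩
    have := hC (s + τ) (t + τ) (by linarith [neg_abs_le τ]) (by linarith)
      (by linarith [le_abs_self τ])
    simpa using this
  chen s u t h1 h2 := by
    simpa using 𝓦.chen (s + τ) (u + τ) (t + τ) (by linarith) (by linarith)

/-- `‖W‖_α` on `[0,1]`. -/
def RoughPath.pathSeminorm (𝓦 : RoughPath V α) : ℝ :=
  holderSeminormTwo α (incr fun t : I => 𝓦.path t)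

/-- `‖𝕎‖_{2α}` on `[0,1]`. -/
def RoughPath.areaSeminorm (𝓦 : RoughPath V α) : ℝ :=
  holderSeminormTwo (2 * α) (fun s t : I => 𝓦.area s t)

/-! ### Controlled rough paths -/

variable {E : Type*} [NormedAddCommGroup E] [NormedSpace ℝ E]

/-- A pair `(Y, Y')` of paths on `[0,1]`, with values in `E` and in `L(V, E)`. -/
abbrev PathPair (V E : Type*) [NormedAddCommGroup V] [InnerProductSpace ℝ V]
    [NormedAddCommGroup E] [NormedSpace ℝ E] : Type _ :=
  (I → E) × (I → V →L[ℝ] E)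

/-- The remainder `R^Y_{s,t} = Y_{s,t} - Y'_s W_{s,t}`. -/
def remainder (𝓦 : RoughPath V α) (Y : PathPair V E) (s t : I) : E :=
  Y.1 t - Y.1 s - Y.2 s (𝓦.path t - 𝓦.path s)

/-- `(Y, Y')` belongs to the space `D^{2α}_W([0,1]; E)` of controlled rough paths. -/
structure IsControlled (𝓦 : RoughPath V α) (Y : PathPair V E) : Prop where
  holder : IsHolderTwo α (incr Y.1)
  deriv_holder : IsHolderTwo α (incr Y.2)
  remainder_holder : IsHolderTwo (2 * α) (remainder 𝓦 Y)

/-- The norm `‖Y‖_∞ + ‖Y'‖_∞ + ‖Y'‖_α + ‖R^Y‖_{2α}` on `D^{2α}_W([0,1]; E)`. -/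
def controlledNorm (𝓦 : RoughPath V α) (Y : PathPair V E) : ℝ :=
  supNorm Y.1 + supNorm Y.2 + holderSeminormTwo α (incr Y.2)
    + holderSeminormTwo (2 * α) (remainder 𝓦 Y)

/-! ### The controlled rough integral -/

/-- `B` in `L(V, L(V, E))` acting on `V ⊗ V`, so that `v ⊗ w` is sent to `B v w`. -/
def pairing (B : V →L[ℝ] V →L[ℝ] E) : V ⊗[ℝ] V →ₗ[ℝ] E :=
  TensorProduct.lift ((ContinuousLinearMap.coeLM ℝ).comp (B : V →ₗ[ℝ] V →L[ℝ] E))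

/-- `J` is the limit, as the mesh of the partition `a = p 0 ≤ p 1 ≤ ⋯ ≤ p N = b` tends to zero, of
the sums `∑ (Z_u W_{u,v} + Z'_u 𝕎_{u,v})` over the intervals `[u,v]` of the partition. -/
def IsRoughIntegral (𝓦 : RoughPath V α) (Z : PathPair V (V →L[ℝ] E)) (a b : I) (J : E) : Prop :=
  ∀ ε : ℝ, 0 < ε → ∃ δ : ℝ, 0 < δ ∧ ∀ (N : ℕ) (p : ℕ → I), p 0 = a → p N = b →
    (∀ j < N, p j ≤ p (j + 1)) → (∀ j < N, (p (j + 1) : ℝ) - p j < δ) →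
    ‖(∑ j ∈ Finset.range N,
        (Z.1 (p j) (𝓦.path (p (j + 1)) - 𝓦.path (p j))
          + pairing (Z.2 (p j)) (𝓦.area (p j) (p (j + 1))))) - J‖ < ε

/-- The rough integral `∫_a^b Z d𝓦`. -/
def roughIntegral (𝓦 : RoughPath V α) (Z : PathPair V (V →L[ℝ] E)) (a b : I) : E :=
  Classical.epsilon (IsRoughIntegral 𝓦 Z a b)

end Rough

/-! ### The linear part -/

/-- The phase space `ℝⁿ`. -/
abbrev Sp (n : ℕ) : Type := EuclideanSpace ℝ (Fin n)

/-- `exp(tB)` for a bounded operator `B`. -/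
def expGroup {X : Type*} [NormedAddCommGroup X] [NormedSpace ℝ X] (B : X →L[ℝ] X) (t : ℝ) :
    X →L[ℝ] X :=
  NormedSpace.exp (t • B)

/-- The group `S(t) = exp(tA)` on `ℝⁿ`. -/
def grp {n : ℕ} (A : Matrix (Fin n) (Fin n) ℝ) (t : ℝ) : Sp n →L[ℝ] Sp n :=
  expGroup (Matrix.toEuclideanCLM (n := Fin n) (𝕜 := ℝ) A) t

/-- `A` acting on `ℂⁿ`. -/
def complexified {n : ℕ} (A : Matrix (Fin n) (Fin n) ℝ) : Module.End ℂ (Fin n → ℂ) :=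
  Matrix.toLin' (A.map (algebraMap ℝ ℂ))

/-- The inclusion of `ℝⁿ` in `ℂⁿ`. -/
def toComplex (n : ℕ) : Sp n →ₗ[ℝ] (Fin n → ℂ) where
  toFun x i := (x i : ℂ)
  map_add' x y := by ext i; simp
  map_smul' c x := by ext i; simp

/-- The real subspace spanned by the generalized eigenvectors whose eigenvalues lie in `Λ`. -/
def spectralSubspace {n : ℕ} (A : Matrix (Fin n) (Fin n) ℝ) (Λ : Set ℂ) : Submodule ℝ (Sp n) :=
  ((⨆ μ ∈ Λ, (complexified A).maxGenEigenspace μ).restrictScalars ℝ).comap (toComplex n)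

/-- The center subspace `X^c`. -/
def centerSubspace {n : ℕ} (A : Matrix (Fin n) (Fin n) ℝ) : Submodule ℝ (Sp n) :=
  spectralSubspace A {μ | μ.re = 0}

/-- The stable subspace `X^s`. -/
def stableSubspace {n : ℕ} (A : Matrix (Fin n) (Fin n) ℝ) : Submodule ℝ (Sp n) :=
  spectralSubspace A {μ | μ.re < 0}

/-- Center-stable situation: all eigenvalues of `A` lie on the imaginary axis or in the open left
half-plane, and `Pc`, `Ps` are the projections of the splitting `ℝⁿ = X^c ⊕ X^s`. -/
structure CenterStableSplitting {n : ℕ} (A : Matrix (Fin n) (Fin n) ℝ)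
    (Pc Ps : Sp n →L[ℝ] Sp n) : Prop where
  eigenvalue : ∀ μ : ℂ, (complexified A).HasEigenvalue μ → μ.re = 0 ∨ μ.re < 0
  center_idem : Pc ∘L Pc = Pc
  stable_idem : Ps ∘L Ps = Ps
  center_range : LinearMap.range (Pc : Sp n →ₗ[ℝ] Sp n) = centerSubspace A
  stable_range : LinearMap.range (Ps : Sp n →ₗ[ℝ] Sp n) = stableSubspace A
  sum_eq : Ps + Pc = ContinuousLinearMap.id ℝ (Sp n)
  center_comm : ∀ t : ℝ, 0 ≤ t → Pc ∘L grp A t = grp A t ∘L Pc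
  stable_comm : ∀ t : ℝ, 0 ≤ t → Ps ∘L grp A t = grp A t ∘L Ps

/-- The exponential dichotomy; `S^c` and `S^s` are the restrictions of `S` to `X^c` and `X^s`. -/
structure ExponentialDichotomy {n : ℕ} (A : Matrix (Fin n) (Fin n) ℝ) (β γ Mc Ms : ℝ) : Prop where
  beta_pos : -β < 0
  gamma_nonneg : 0 ≤ γ
  gamma_lt : γ < β
  one_le_center : 1 ≤ Mc
  one_le_stable : 1 ≤ Ms
  center_bound : ∀ t : ℝ, t ≤ 0 → ∀ x ∈ centerSubspace A,
    ‖grp A t x‖ ≤ Mc * Real.exp (γ * t) * ‖x‖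
  stable_bound : ∀ t : ℝ, 0 ≤ t → ∀ x ∈ stableSubspace A,
    ‖grp A t x‖ ≤ Ms * Real.exp (-β * t) * ‖x‖

/-! ### The coefficients and the cut-off -/

/-- `H` is `m`-times continuously differentiable with bounded derivatives of the orders `1, …, m`
(so for `1 ≤ m` it is Lipschitz). -/
def HasBoundedDerivs {E E' : Type*} [NormedAddCommGroup E] [NormedSpace ℝ E]
    [NormedAddCommGroup E'] [NormedSpace ℝ E'] (m : ℕ) (H : E → E') : Prop :=
  ContDiff ℝ m H ∧ ∀ k : ℕ, 1 ≤ k → k ≤ m → ∃ C : ℝ, ∀ x : E, ‖iteratedFDeriv ℝ k H x‖ ≤ C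

/-- The drift hypothesis. -/
structure DriftHypothesis {n : ℕ} (F : Sp n → Sp n) : Prop where
  smooth : HasBoundedDerivs 1 F
  zero : F 0 = 0
  fderiv_zero : fderiv ℝ F 0 = 0

/-- The diffusion hypothesis. -/
structure DiffusionHypothesis {n d : ℕ} (G : Sp n → Sp d →L[ℝ] Sp n) : Prop where
  smooth : HasBoundedDerivs 3 G
  zero : G 0 = 0
  fderiv_zero : fderiv ℝ G 0 = 0
  fderiv_fderiv_zero : fderiv ℝ (fderiv ℝ G) 0 = 0

/-- A `C³` cut-off function `f : [0,∞) → [0,1]`, equal to `1` on `[0,1/2]` and to `0` on `[1,∞)`. -/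
structure IsCutoff (f : ℝ → ℝ) : Prop where
  smooth : ContDiffOn ℝ 3 f (Ici 0)
  mem_Icc : ∀ x : ℝ, 0 ≤ x → f x ∈ Icc (0 : ℝ) 1
  eq_one : ∀ x : ℝ, 0 ≤ x → x ≤ 1 / 2 → f x = 1
  eq_zero : ∀ x : ℝ, 1 ≤ x → f x = 0

section Map

variable {V X : Type*} [NormedAddCommGroup V] [InnerProductSpace ℝ V]
  [NormedAddCommGroup X] [NormedSpace ℝ X] {α : ℝ}

/-- The random cut-off radius `R(W) = min {R̃(W), 1}`, where `R̃(W)` is the solution of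
`C₁ R̃ + C₂ R̃ (1 + ‖W‖_α) (‖W‖_α + ‖𝕎‖_{2α}) = K`. -/
def cutoffRadius (C₁ C₂ K : ℝ) (𝓦 : RoughPath V α) : ℝ :=
  min (K / (C₁ + C₂ * ((1 + 𝓦.pathSeminorm) * (𝓦.pathSeminorm + 𝓦.areaSeminorm)))) 1

/-- The truncation `χ_R(Y, Y') = f(‖Y, Y'‖ / R) (Y, Y')` of a controlled rough path. -/
def truncate (f : ℝ → ℝ) (R : ℝ) (𝓦 : RoughPath V α) (Y : PathPair V X) :
    PathPair V X :=
  (fun t => f (controlledNorm 𝓦 Y / R) • Y.1 t, fun t => f (controlledNorm 𝓦 Y / R) • Y.2 t)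

/-- `F_R(Y)(t) = F(χ_R(Y)_t)`. -/
def truncDrift (F : X → X) (f : ℝ → ℝ) (R : ℝ) (𝓦 : RoughPath V α)
    (Y : PathPair V X) (t : I) : X :=
  F ((truncate f R 𝓦 Y).1 t)

/-- `G_R(Y)(t) = G(χ_R(Y)_t)` together with its Gubinelli derivative
`DG(χ_R(Y)_t) (χ_R(Y)_t)'`. -/
def truncDiffusion (G : X → V →L[ℝ] X) (f : ℝ → ℝ) (R : ℝ) (𝓦 : RoughPath V α)
    (Y : PathPair V X) : PathPair V (V →L[ℝ] X) :=
  (fun t => G ((truncate f R 𝓦 Y).1 t),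
   fun t => (fderiv ℝ G ((truncate f R 𝓦 Y).1 t)).comp ((truncate f R 𝓦 Y).2 t))

/-- The pair `(S(c - ·) P Z, S(c - ·) P Z')`. -/
def convolved (S : ℝ → X →L[ℝ] X) (P : X →L[ℝ] X) (c : ℝ)
    (Z : PathPair V (V →L[ℝ] X)) : PathPair V (V →L[ℝ] X) :=
  (fun r => (S (c - r) ∘L P) ∘L Z.1 r,
   fun r => (ContinuousLinearMap.compL ℝ V X X (S (c - r) ∘L P)).comp (Z.2 r))

/-- `∫_a^b S(c - r) P F_R(Y)(r) dr + ∫_a^b S(c - r) P G_R(Y)(r) d𝓦_r`. -/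
def convolution (S : ℝ → X →L[ℝ] X) (F : X → X) (G : X → V →L[ℝ] X)
    (f : ℝ → ℝ) (R : ℝ) (P : X →L[ℝ] X) (𝓦 : RoughPath V α)
    (Y : PathPair V X) (a b : I) (c : ℝ) : X :=
  (∫ r in (a : ℝ)..b, S (c - r) (P (IccExtend zero_le_one (truncDrift F f R 𝓦 Y) r)))
    + roughIntegral 𝓦 (convolved S P c (truncDiffusion G f R 𝓦 Y)) a b

/-- Sequences `((U^{i-1}, (U^{i-1})'))`, `i = 0, -1, -2, …`; the entry at `m : ℕ` belongs to
`i = -m`. -/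
abbrev Seq (V X : Type*) [NormedAddCommGroup V] [InnerProductSpace ℝ V]
    [NormedAddCommGroup X] [NormedSpace ℝ X] : Type _ := ℕ → PathPair V X

/-- The shifted rough path `Θ_{i-1} 𝓦` for `i = -m`. -/
def fibre (𝓦 : RoughPath V α) (m : ℕ) : RoughPath V α := 𝓦.shift (-(m : ℝ) - 1)

/-- The norm `sup_i e^{-η(i-1)} ‖U^{i-1}, (U^{i-1})'‖`. -/
def bcNorm (η : ℝ) (𝓦 : RoughPath V α) (U : Seq V X) : ℝ :=
  ⨆ m : ℕ, Real.exp (-η * (-(m : ℝ) - 1)) * controlledNorm (fibre 𝓦 m) (U m)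

/-- The space `BC^η(D^{2α}_W)`. -/
def bcSpace (η : ℝ) (𝓦 : RoughPath V α) : Set (Seq V X) :=
  {U | (∀ m, IsControlled (fibre 𝓦 m) (U m)) ∧ (∀ m, (U m).1 0 = (U (m + 1)).1 1) ∧
    BddAbove (range fun m : ℕ =>
      Real.exp (-η * (-(m : ℝ) - 1)) * controlledNorm (fibre 𝓦 m) (U m))}

/-- The discrete Lyapunov-Perron map `J_{R,d}(W, U, ξ)` for the group `S`, where `R` is the
cut-off radius as a function of the rough path. At position `m` (that is, `i = -m`) the first component is
`S^c(t+i-1) ξ^c` plus four groups of terms: the sum over `k = 0, -1, …, i+1` (where `k = -j`), the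
center integrals over `[t,1]`, the sum over `k = i-1, i-2, …` (where `k = i-1-l`) and the stable
integrals over `[0,t]`. The second component is its Gubinelli derivative `G_R(U^{i-1})`. -/
def lyapunovPerron (S : ℝ → X →L[ℝ] X) (Pc Ps : X →L[ℝ] X)
    (F : X → X) (G : X → V →L[ℝ] X) (f : ℝ → ℝ) (R : RoughPath V α → ℝ)
    (𝓦 : RoughPath V α) (ξ : X) (U : Seq V X) : Seq V X := fun m =>
  let conv (P : X →L[ℝ] X) (j : ℕ) (a b : I) (c : ℝ) : X :=
    convolution S F G f (R (fibre 𝓦 j)) P (fibre 𝓦 j) (U j) a b c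
  (fun t : I =>
    S ((t : ℝ) - m - 1) (Pc ξ)
      - (∑ j ∈ Finset.range m, S ((t : ℝ) - m - 1 + j) (conv Pc j 0 1 1))
      - conv Pc m t 1 t
      + (∑' l : ℕ, S ((t : ℝ) + l) (conv Ps (m + 1 + l) 0 1 1))
      + conv Ps m 0 t t,
   (truncDiffusion G f (R (fibre 𝓦 m)) (fibre 𝓦 m) (U m)).1)

/-- All limits in the definition of `J_{R,d}(W, U, ·)` exist: the rough integrals converge, and so
do the infinite series on the stable part. -/
def IsWellDefined (S : ℝ → X →L[ℝ] X) (Pc Ps : X →L[ℝ] X)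
    (F : X → X) (G : X → V →L[ℝ] X) (f : ℝ → ℝ) (R : RoughPath V α → ℝ)
    (𝓦 : RoughPath V α) (U : Seq V X) : Prop :=
  (∀ P : X →L[ℝ] X, P = Pc ∨ P = Ps → ∀ (m : ℕ) (a b : I) (c : ℝ), a ≤ b →
    ∃ J : X, IsRoughIntegral (fibre 𝓦 m)
      (convolved S P c (truncDiffusion G f (R (fibre 𝓦 m)) (fibre 𝓦 m) (U m))) a b J) ∧
  (∀ (m : ℕ) (t : I), Summable fun l : ℕ => S ((t : ℝ) + l)
    (convolution S F G f (R (fibre 𝓦 (m + 1 + l))) Ps (fibre 𝓦 (m + 1 + l)) (U (m + 1 + l)) 0 1 1))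

/-- The gap condition. -/
def GapCondition (CS β γ Mc Ms η K : ℝ) : Prop :=
  K * (Real.exp (β + η) * (CS * Ms * Real.exp (-η) + 1) / (1 - Real.exp (-(β + η)))
    + Real.exp (γ - η) * (CS * Mc * Real.exp (-η) + 1) / (1 - Real.exp (-(γ - η)))) < 1 / 4

end Map

end

end RoughCenter

open RoughCenter

/-!
The sewing lemma bounds the rough integral of a controlled path on `[0, 1]`, with a constant that
depends only on `α` and the dimension of the noise. Composing a controlled path with a map which
vanishes to third order at the origin gains a power of the size of the path, and the cut-off keeps
that size below the radius `R(W)`, which is chosen small enough to compensate the size of the rough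
path. So the truncated coefficients are Lipschitz in the controlled norm with a constant that
becomes as small as desired, uniformly in the rough path, when `C₁` and `C₂` are large.

Since `S(t - r) = S(t) S(-r)`, every integral in `J_{R,d}` is `S(t)` applied to an integral against
the fixed weight `S(-r)`. Hence each entry of `J_{R,d}(W, U, ξ)` is a local controlled path plus
`S(t)` applied to a vector, and that vector is a sum over the other unit intervals which the
dichotomy turns into a geometric series. The gap condition makes the resulting Lipschitz constant at
most `1/4`, and Banach's fixed point theorem applies in the complete space `BC^η`.
-/

namespace RoughCenter

noncomputable section

section Seminorms

variable {E : Type*} [NormedAddCommGroup E] {β : ℝ}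

lemma sub_rpow_nonneg {s t : I} (h : s ≤ t) (β : ℝ) : 0 ≤ ((t : ℝ) - s) ^ β :=
  Real.rpow_nonneg (sub_nonneg.2 h) _

lemma sub_rpow_le_rpow {s t : I} (h : s ≤ t) {p q : ℝ} (hq : 0 < q) (hqp : q ≤ p) :
    ((t : ℝ) - s) ^ p ≤ ((t : ℝ) - s) ^ q := by
  rcases h.eq_or_lt with rfl | hlt
  · simp [Real.zero_rpow hq.ne', Real.zero_rpow (hq.trans_le hqp).ne']
  · exact Real.rpow_le_rpow_of_exponent_ge (sub_pos.2 hlt)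
      (by linarith [t.2.2, s.2.1]) hqp

lemma sub_le_sub_rpow {s t : I} (h : s ≤ t) {q : ℝ} (hq : 0 < q) (hq1 : q ≤ 1) :
    (t : ℝ) - s ≤ ((t : ℝ) - s) ^ q := by
  simpa using sub_rpow_le_rpow h hq hq1

lemma holderSeminormTwo_nonneg (β : ℝ) (R : I → I → E) : 0 ≤ holderSeminormTwo β R :=
  Real.sInf_nonneg fun _ hC => hC.1

lemma holderSeminormTwo_le {R : I → I → E} {C : ℝ} (hC : 0 ≤ C)
    (h : ∀ s t : I, s ≤ t → ‖R s t‖ ≤ C * ((t : ℝ) - s) ^ β) : holderSeminormTwo β R ≤ C :=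
  csInf_le ⟨0, fun _ hx => hx.1⟩ ⟨hC, h⟩

lemma IsHolderTwo.norm_le {R : I → I → E} (h : IsHolderTwo β R) {s t : I} (hst : s ≤ t) :
    ‖R s t‖ ≤ holderSeminormTwo β R * ((t : ℝ) - s) ^ β := by
  obtain ⟨C, hC⟩ := h
  have hne : {C : ℝ | 0 ≤ C ∧ ∀ s t : I, s ≤ t → ‖R s t‖ ≤ C * ((t : ℝ) - s) ^ β}.Nonempty :=
    ⟨max C 0, le_max_right _ _, fun s t hst => (hC s t hst).trans
      (mul_le_mul_of_nonneg_right (le_max_left _ _) (sub_rpow_nonneg hst β))⟩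
  rcases (sub_rpow_nonneg hst β).eq_or_lt with h0 | hpos
  · have := hC s t hst
    rw [← h0] at this ⊢
    simpa using this
  · rw [← div_le_iff₀ hpos]
    exact le_csInf hne fun C hC => (div_le_iff₀ hpos).2 (hC.2 s t hst)

lemma supNorm_nonneg (Y : I → E) : 0 ≤ supNorm Y := Real.iSup_nonneg fun _ => norm_nonneg _

lemma supNorm_le {Y : I → E} {C : ℝ} (h : ∀ t, ‖Y t‖ ≤ C) : supNorm Y ≤ C := ciSup_le h

lemma IsHolderTwo.holderSeminormTwo_add_le {R R' : I → I → E} (h : IsHolderTwo β R)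
    (h' : IsHolderTwo β R') :
    holderSeminormTwo β (R + R') ≤ holderSeminormTwo β R + holderSeminormTwo β R' :=
  holderSeminormTwo_le (add_nonneg (holderSeminormTwo_nonneg β R) (holderSeminormTwo_nonneg β R'))
    fun s t hst => by
      rw [add_mul]
      exact norm_add_le_of_le (h.norm_le hst) (h'.norm_le hst)

lemma IsHolderTwo.continuous (hβ : 0 < β) {Y : I → E} (h : IsHolderTwo β (incr Y)) :
    Continuous Y := by
  have hsym (s t : I) :
      ‖Y t - Y s‖ ≤ holderSeminormTwo β (incr Y) * |(t : ℝ) - (s : ℝ)| ^ β := by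
    rcases le_total s t with hst | hst
    · rw [abs_of_nonneg (sub_nonneg.2 (show (s : ℝ) ≤ t from hst))]
      exact h.norm_le hst
    · rw [norm_sub_rev, abs_sub_comm, abs_of_nonneg (sub_nonneg.2 (show (t : ℝ) ≤ s from hst))]
      exact h.norm_le hst
  refine continuous_iff_continuousAt.2 fun s => tendsto_iff_norm_sub_tendsto_zero.2 ?_
  refine squeeze_zero (fun _ => norm_nonneg _) (fun t => hsym s t) ?_
  have : Continuous fun t : I => holderSeminormTwo β (incr Y) * |(t : ℝ) - (s : ℝ)| ^ β :=
    continuous_const.mul ((by fun_prop : Continuous fun t : I => |(t : ℝ) - (s : ℝ)|).rpow_const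
      fun _ => Or.inr hβ.le)
  simpa [Real.zero_rpow hβ.ne'] using this.tendsto s

lemma norm_le_supNorm {Y : I → E} (h : Continuous Y) (t : I) : ‖Y t‖ ≤ supNorm Y :=
  le_ciSup (isCompact_range h.norm).bddAbove t

lemma supNorm_add_le {Y Z : I → E} (hY : Continuous Y) (hZ : Continuous Z) :
    supNorm (Y + Z) ≤ supNorm Y + supNorm Z :=
  supNorm_le fun t => norm_add_le_of_le (norm_le_supNorm hY t) (norm_le_supNorm hZ t)

end Seminorms

section Controlled

variable {V : Type*} [NormedAddCommGroup V] [InnerProductSpace ℝ V] {α : ℝ}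
variable {E : Type*} [NormedAddCommGroup E] [NormedSpace ℝ E]
variable {E' : Type*} [NormedAddCommGroup E'] [NormedSpace ℝ E']

lemma RoughPath.pathSeminorm_nonneg (𝓦 : RoughPath V α) : 0 ≤ 𝓦.pathSeminorm :=
  holderSeminormTwo_nonneg _ _

lemma RoughPath.areaSeminorm_nonneg (𝓦 : RoughPath V α) : 0 ≤ 𝓦.areaSeminorm :=
  holderSeminormTwo_nonneg _ _

lemma RoughPath.norm_path_sub_le (𝓦 : RoughPath V α) {s t : I} (h : s ≤ t) :
    ‖𝓦.path t - 𝓦.path s‖ ≤ 𝓦.pathSeminorm * ((t : ℝ) - s) ^ α := by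
  obtain ⟨C, hC⟩ := 𝓦.path_holder 1
  exact IsHolderTwo.norm_le (R := incr fun t : I => 𝓦.path t)
    ⟨C, fun s t h => hC s t (by linarith [s.2.1]) h t.2.2⟩ h

lemma RoughPath.norm_area_le (𝓦 : RoughPath V α) {s t : I} (h : s ≤ t) :
    ‖𝓦.area s t‖ ≤ 𝓦.areaSeminorm * ((t : ℝ) - s) ^ (2 * α) := by
  obtain ⟨C, hC⟩ := 𝓦.area_holder 1
  exact IsHolderTwo.norm_le (R := fun s t : I => 𝓦.area s t)
    ⟨C, fun s t h => hC s t (by linarith [s.2.1]) h t.2.2⟩ h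

/-- Each of the four parts of the norm `controlledNorm 𝓦 Y` is at most `c`. Unlike a bound on the
norm itself this makes `Y` a controlled rough path, and it passes to sums and pointwise limits. -/
structure ControlledBy (𝓦 : RoughPath V α) (Y : PathPair V E) (c : ℝ) : Prop where
  sup : ∀ t, ‖Y.1 t‖ ≤ c
  deriv_sup : ∀ t, ‖Y.2 t‖ ≤ c
  deriv_incr : ∀ s t : I, s ≤ t → ‖Y.2 t - Y.2 s‖ ≤ c * ((t : ℝ) - s) ^ α
  remainder : ∀ s t : I, s ≤ t → ‖remainder 𝓦 Y s t‖ ≤ c * ((t : ℝ) - s) ^ (2 * α)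

variable {𝓦 : RoughPath V α} {Y Z : PathPair V E} {c c' : ℝ}

lemma remainder_add (𝓦 : RoughPath V α) (Y Z : PathPair V E) (s t : I) :
    remainder 𝓦 (Y + Z) s t = remainder 𝓦 Y s t + remainder 𝓦 Z s t := by
  simp [remainder]; abel

lemma remainder_sub (𝓦 : RoughPath V α) (Y Z : PathPair V E) (s t : I) :
    remainder 𝓦 (Y - Z) s t = remainder 𝓦 Y s t - remainder 𝓦 Z s t := by
  simp [remainder]; abel

lemma remainder_smul (𝓦 : RoughPath V α) (r : ℝ) (Y : PathPair V E) (s t : I) :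
    remainder 𝓦 (r • Y) s t = r • remainder 𝓦 Y s t := by
  simp [remainder, smul_sub]

lemma ControlledBy.nonneg (h : ControlledBy 𝓦 Y c) : 0 ≤ c := (norm_nonneg _).trans (h.sup 0)

lemma ControlledBy.mono (h : ControlledBy 𝓦 Y c) (hc : c ≤ c') : ControlledBy 𝓦 Y c' where
  sup t := (h.sup t).trans hc
  deriv_sup t := (h.deriv_sup t).trans hc
  deriv_incr s t hst := (h.deriv_incr s t hst).trans
    (mul_le_mul_of_nonneg_right hc (sub_rpow_nonneg hst _))
  remainder s t hst := (h.remainder s t hst).trans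
    (mul_le_mul_of_nonneg_right hc (sub_rpow_nonneg hst _))

lemma ControlledBy.add (h : ControlledBy 𝓦 Y c) (h' : ControlledBy 𝓦 Z c') :
    ControlledBy 𝓦 (Y + Z) (c + c') where
  sup t := (norm_add_le _ _).trans (add_le_add (h.sup t) (h'.sup t))
  deriv_sup t := (norm_add_le _ _).trans (add_le_add (h.deriv_sup t) (h'.deriv_sup t))
  deriv_incr s t hst := by
    have : (Y + Z).2 t - (Y + Z).2 s = (Y.2 t - Y.2 s) + (Z.2 t - Z.2 s) := by
      simp; abel
    rw [this, add_mul]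
    exact (norm_add_le _ _).trans (add_le_add (h.deriv_incr s t hst) (h'.deriv_incr s t hst))
  remainder s t hst := by
    rw [remainder_add, add_mul]
    exact (norm_add_le _ _).trans (add_le_add (h.remainder s t hst) (h'.remainder s t hst))

lemma ControlledBy.smul (r : ℝ) (h : ControlledBy 𝓦 Y c) :
    ControlledBy 𝓦 (r • Y) (|r| * c) where
  sup t := by
    simpa [norm_smul] using mul_le_mul_of_nonneg_left (h.sup t) (abs_nonneg r)
  deriv_sup t := by
    simpa [norm_smul] using mul_le_mul_of_nonneg_left (h.deriv_sup t) (abs_nonneg r)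
  deriv_incr s t hst := by
    have := mul_le_mul_of_nonneg_left (h.deriv_incr s t hst) (abs_nonneg r)
    simpa [← smul_sub, norm_smul, mul_assoc] using this
  remainder s t hst := by
    have := mul_le_mul_of_nonneg_left (h.remainder s t hst) (abs_nonneg r)
    simpa [remainder_smul, norm_smul, mul_assoc] using this

lemma ControlledBy.sub (h : ControlledBy 𝓦 Y c) (h' : ControlledBy 𝓦 Z c') :
    ControlledBy 𝓦 (Y - Z) (c + c') := by
  have := h.add (h'.smul (-1))
  simpa [← sub_eq_add_neg] using this

lemma ControlledBy.norm_incr_le (h : ControlledBy 𝓦 Y c) (hα : 0 < α) {s t : I} (hst : s ≤ t) :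
    ‖Y.1 t - Y.1 s‖ ≤ c * (1 + 𝓦.pathSeminorm) * ((t : ℝ) - s) ^ α := by
  have h1 : Y.1 t - Y.1 s = RoughCenter.remainder 𝓦 Y s t + Y.2 s (𝓦.path t - 𝓦.path s) := by
    simp [RoughCenter.remainder]
  have h2 := (Y.2 s).le_of_opNorm_le_of_le (h.deriv_sup s) (𝓦.norm_path_sub_le hst)
  have h3 := (h.remainder s t hst).trans (mul_le_mul_of_nonneg_left
    (sub_rpow_le_rpow hst hα (by linarith : α ≤ 2 * α)) h.nonneg)
  rw [h1]
  refine (norm_add_le _ _).trans ((add_le_add h3 h2).trans (le_of_eq (by ring)))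

lemma ControlledBy.isControlled (h : ControlledBy 𝓦 Y c) (hα : 0 < α) : IsControlled 𝓦 Y where
  holder := ⟨_, fun _ _ hst => h.norm_incr_le hα hst⟩
  deriv_holder := ⟨c, h.deriv_incr⟩
  remainder_holder := ⟨c, h.remainder⟩

lemma ControlledBy.controlledNorm_le (h : ControlledBy 𝓦 Y c) : controlledNorm 𝓦 Y ≤ 4 * c := by
  have h1 := supNorm_le h.sup
  have h2 := supNorm_le h.deriv_sup
  have h3 := holderSeminormTwo_le h.nonneg h.deriv_incr
  have h4 := holderSeminormTwo_le h.nonneg h.remainder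
  change supNorm Y.1 + supNorm Y.2 + holderSeminormTwo α (fun s t => Y.2 t - Y.2 s) + _ ≤ _
  linarith

lemma controlledNorm_nonneg (𝓦 : RoughPath V α) (Y : PathPair V E) : 0 ≤ controlledNorm 𝓦 Y :=
  add_nonneg (add_nonneg (add_nonneg (supNorm_nonneg _) (supNorm_nonneg _))
    (holderSeminormTwo_nonneg _ _)) (holderSeminormTwo_nonneg _ _)

lemma IsControlled.controlledBy (h : IsControlled 𝓦 Y) (hα : 0 < α) :
    ControlledBy 𝓦 Y (controlledNorm 𝓦 Y) := by
  have h1 := supNorm_nonneg Y.1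
  have h2 := supNorm_nonneg Y.2
  have h3 := holderSeminormTwo_nonneg α (incr Y.2)
  have h4 := holderSeminormTwo_nonneg (2 * α) (remainder 𝓦 Y)
  refine ⟨fun t => (norm_le_supNorm (h.holder.continuous hα) t).trans ?_,
    fun t => (norm_le_supNorm (h.deriv_holder.continuous hα) t).trans ?_,
    fun s t hst => (h.deriv_holder.norm_le hst).trans
      (mul_le_mul_of_nonneg_right ?_ (sub_rpow_nonneg hst _)),
    fun s t hst => (h.remainder_holder.norm_le hst).trans
      (mul_le_mul_of_nonneg_right ?_ (sub_rpow_nonneg hst _))⟩ <;>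
  · unfold controlledNorm
    linarith

lemma IsControlled.sub (h : IsControlled 𝓦 Y) (h' : IsControlled 𝓦 Z) (hα : 0 < α) :
    IsControlled 𝓦 (Y - Z) :=
  ((h.controlledBy hα).sub (h'.controlledBy hα)).isControlled hα

lemma IsControlled.controlledNorm_add_le (h : IsControlled 𝓦 Y) (h' : IsControlled 𝓦 Z)
    (hα : 0 < α) :
    controlledNorm 𝓦 (Y + Z) ≤ controlledNorm 𝓦 Y + controlledNorm 𝓦 Z := by
  have hincr : incr (Y.2 + Z.2) = incr Y.2 + incr Z.2 := by
    ext1 s; ext1 t; simp only [incr, Pi.add_apply]; abel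
  have hrem : remainder 𝓦 (Y + Z) = remainder 𝓦 Y + remainder 𝓦 Z := by
    ext1 s; ext1 t; exact remainder_add 𝓦 Y Z s t
  have hsup := supNorm_add_le (h.holder.continuous hα) (h'.holder.continuous hα)
  have hsup' := supNorm_add_le (h.deriv_holder.continuous hα) (h'.deriv_holder.continuous hα)
  have hhol := h.deriv_holder.holderSeminormTwo_add_le h'.deriv_holder
  have hhol' := h.remainder_holder.holderSeminormTwo_add_le h'.remainder_holder
  simp only [controlledNorm, hrem, Prod.fst_add, Prod.snd_add, hincr]
  linarith

lemma controlledNorm_sub_comm (𝓦 : RoughPath V α) (Y Z : PathPair V E) :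
    controlledNorm 𝓦 (Y - Z) = controlledNorm 𝓦 (Z - Y) := by
  have hrem (s t : I) : ‖remainder 𝓦 (Y - Z) s t‖ = ‖remainder 𝓦 (Z - Y) s t‖ := by
    rw [remainder_sub, remainder_sub, norm_sub_rev]
  have hincr (s t : I) : ‖incr (Y - Z).2 s t‖ = ‖incr (Z - Y).2 s t‖ := by
    rw [← norm_neg]; congr 1; simp only [incr, Prod.snd_sub, Pi.sub_apply]; abel
  have hfst (t : I) : ‖(Y - Z).1 t‖ = ‖(Z - Y).1 t‖ := norm_sub_rev _ _
  have hsnd (t : I) : ‖(Y - Z).2 t‖ = ‖(Z - Y).2 t‖ := norm_sub_rev _ _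
  simp only [controlledNorm, supNorm, holderSeminormTwo, hrem, hincr, hfst, hsnd]

lemma IsControlled.abs_controlledNorm_sub_le (h : IsControlled 𝓦 Y) (h' : IsControlled 𝓦 Z)
    (hα : 0 < α) :
    |controlledNorm 𝓦 Y - controlledNorm 𝓦 Z| ≤ controlledNorm 𝓦 (Y - Z) := by
  rw [abs_le]
  have h1 := h'.controlledNorm_add_le (h.sub h' hα) hα
  have h2 := h.controlledNorm_add_le (h'.sub h hα) hα
  rw [add_sub_cancel] at h1 h2
  rw [controlledNorm_sub_comm 𝓦 Z Y] at h2
  constructor <;> linarith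

/-- The product `(M Y, M Y')` of a path `M` of bounded operators with the pair `(Y, Y')`; its
Gubinelli derivative has no further term as only Lipschitz paths `M` are used. -/
def opMul (M : I → E →L[ℝ] E') (Y : PathPair V E) : PathPair V E' :=
  (fun t => M t (Y.1 t), fun t => (M t).comp (Y.2 t))

lemma opMul_sub (M : I → E →L[ℝ] E') (Y Z : PathPair V E) :
    opMul M (Y - Z) = opMul M Y - opMul M Z := by
  ext <;> simp [opMul]

lemma ControlledBy.opMul (h : ControlledBy 𝓦 Y c) (hα : 0 < α) (hα2 : α ≤ 1 / 2)
    {M : I → E →L[ℝ] E'} {m : ℝ} (hM : ∀ t, ‖M t‖ ≤ m)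
    (hM' : ∀ s t : I, s ≤ t → ‖M t - M s‖ ≤ m * ((t : ℝ) - s)) :
    ControlledBy 𝓦 (opMul M Y) (2 * m * c) := by
  have hm : 0 ≤ m := (norm_nonneg _).trans (hM 0)
  have hc := h.nonneg
  have hmc : 0 ≤ m * c := mul_nonneg hm hc
  refine ⟨fun t => ?_, fun t => ?_, fun s t hst => ?_, fun s t hst => ?_⟩
  · have := (M t).le_of_opNorm_le_of_le (hM t) (h.sup t)
    simp only [RoughCenter.opMul]
    linarith
  · have := (ContinuousLinearMap.opNorm_comp_le (M t) (Y.2 t)).trans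
      (mul_le_mul (hM t) (h.deriv_sup t) (norm_nonneg _) hm)
    simp only [RoughCenter.opMul]
    linarith
  · have e : (RoughCenter.opMul M Y).2 t - (RoughCenter.opMul M Y).2 s
        = (M t - M s).comp (Y.2 t) + (M s).comp (Y.2 t - Y.2 s) := by
      ext x; simp [RoughCenter.opMul]
    have h1 := (ContinuousLinearMap.opNorm_comp_le (M t - M s) (Y.2 t)).trans
      (mul_le_mul (hM' s t hst) (h.deriv_sup t) (norm_nonneg _)
        (mul_nonneg hm (sub_nonneg.2 hst)))
    have h2 := (ContinuousLinearMap.opNorm_comp_le (M s) (Y.2 t - Y.2 s)).trans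
      (mul_le_mul (hM s) (h.deriv_incr s t hst) (norm_nonneg _) hm)
    have h3 := mul_le_mul_of_nonneg_left
      (sub_le_sub_rpow hst hα (by linarith)) hmc
    rw [e]
    refine (norm_add_le _ _).trans ?_
    linarith
  · have e : RoughCenter.remainder 𝓦 (RoughCenter.opMul M Y) s t
        = (M t - M s) (Y.1 t) + (M s) (RoughCenter.remainder 𝓦 Y s t) := by
      simp [RoughCenter.opMul, RoughCenter.remainder]; abel
    have h1 := (M t - M s).le_of_opNorm_le_of_le (hM' s t hst) (h.sup t)
    have h2 := (M s).le_of_opNorm_le_of_le (hM s) (h.remainder s t hst)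
    have h3 := mul_le_mul_of_nonneg_left
      (sub_le_sub_rpow hst (by linarith : 0 < 2 * α) (by linarith)) hmc
    rw [e]
    refine (norm_add_le _ _).trans ?_
    linarith

lemma controlledBy_of_lipschitz (hα : 0 < α) (hα2 : α ≤ 1 / 2) {y : I → E} (hy : ∀ t, ‖y t‖ ≤ c)
    (hy' : ∀ s t : I, s ≤ t → ‖y t - y s‖ ≤ c * ((t : ℝ) - s)) :
    ControlledBy 𝓦 ((y, 0) : PathPair V E) c := by
  have hc : 0 ≤ c := (norm_nonneg _).trans (hy 0)
  refine ⟨hy, fun t => by simpa using hc, fun s t hst => ?_, fun s t hst => ?_⟩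
  · simpa using mul_nonneg hc (sub_rpow_nonneg hst α)
  · have h3 := mul_le_mul_of_nonneg_left
      (sub_le_sub_rpow hst (by linarith : 0 < 2 * α) (by linarith)) hc
    simpa [RoughCenter.remainder] using (hy' s t hst).trans h3

lemma ControlledBy.of_tendsto {ι : Type*} {l : Filter ι} [l.NeBot] {y : ι → PathPair V E}
    (h : ∀ᶠ k in l, ControlledBy 𝓦 (y k) c)
    (h1 : ∀ t, Tendsto (fun k => (y k).1 t) l (𝓝 (Y.1 t)))
    (h2 : ∀ t, Tendsto (fun k => (y k).2 t) l (𝓝 (Y.2 t))) : ControlledBy 𝓦 Y c where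
  sup t := le_of_tendsto (h1 t).norm (h.mono fun _ hk => hk.sup t)
  deriv_sup t := le_of_tendsto (h2 t).norm (h.mono fun _ hk => hk.deriv_sup t)
  deriv_incr s t hst := le_of_tendsto ((h2 t).sub (h2 s)).norm
    (h.mono fun _ hk => hk.deriv_incr s t hst)
  remainder s t hst := by
    have : Tendsto (fun k => RoughCenter.remainder 𝓦 (y k) s t) l
        (𝓝 (RoughCenter.remainder 𝓦 Y s t)) :=
      ((h1 t).sub (h1 s)).sub
        (((ContinuousLinearMap.apply ℝ E (𝓦.path t - 𝓦.path s)).continuous.tendsto _).comp (h2 s))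
    exact le_of_tendsto this.norm (h.mono fun _ hk => hk.remainder s t hst)

end Controlled

/-! ### Sewing -/

section Sewing

variable {E : Type*} [NormedAddCommGroup E] {A Φ : I → I → E} {K θ : ℝ}

/-- The functional `A` of subintervals of `[0,1]` is additive up to an error of order `θ`, the
hypothesis of the sewing lemma. -/
def IsAlmostAdditive (A : I → I → E) (K θ : ℝ) : Prop :=
  ∀ s u t, s ≤ u → u ≤ t → ‖A s t - A s u - A u t‖ ≤ K * ((t : ℝ) - s) ^ θ

/-- The functional `Φ` of subintervals of `[0,1]` is additive; only its values `Φ s t` with `s ≤ t`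
matter. -/
def IsIntervalAdditive (Φ : I → I → E) : Prop :=
  ∀ s u t, s ≤ u → u ≤ t → Φ s t = Φ s u + Φ u t

/-- The constant in the sewing lemma with exponent `θ`, the solution `c` of
`c = 2 ^ (1 - θ) * c + 2`: halving an interval scales the error by `2 ^ (1 - θ)` and costs two
defects. -/
def sewingConst (θ : ℝ) : ℝ := 2 / (1 - 2 ^ (1 - θ))

lemma IsAlmostAdditive.nonneg (hA : IsAlmostAdditive A K θ) : 0 ≤ K := by
  simpa using (norm_nonneg _).trans (hA 0 0 1 le_rfl zero_le_one)

lemma IsAlmostAdditive.apply_self (hA : IsAlmostAdditive A K θ) (hθ : θ ≠ 0) (s : I) :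
    A s s = 0 := by
  simpa [Real.zero_rpow hθ] using hA s s s le_rfl le_rfl

lemma two_rpow_lt_one (hθ : 1 < θ) : (2 : ℝ) ^ (1 - θ) < 1 :=
  Real.rpow_lt_one_of_one_lt_of_neg one_lt_two (by linarith)

lemma sewingConst_pos (hθ : 1 < θ) : 0 < sewingConst θ :=
  div_pos two_pos (sub_pos.2 (two_rpow_lt_one hθ))

lemma two_mul_sewingConst_mul_half_rpow_add (hθ : 1 < θ) {h : ℝ} (hh : 0 ≤ h) :
    2 * (sewingConst θ * (h / 2) ^ θ) + 2 * h ^ θ = sewingConst θ * h ^ θ := by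
  have hhalf : 2 * (h / 2) ^ θ = 2 ^ (1 - θ) * h ^ θ := by
    rw [Real.div_rpow hh two_pos.le, Real.rpow_sub two_pos, Real.rpow_one]
    ring
  have hne : 1 - (2 : ℝ) ^ (1 - θ) ≠ 0 := (sub_pos.2 (two_rpow_lt_one hθ)).ne'
  rw [mul_left_comm, hhalf, sewingConst]
  field_simp
  ring

lemma exists_halving_index {N : ℕ} {p : ℕ → I} (h : p 0 < p N) :
    ∃ j r, N = j + 1 + r ∧ (p j : ℝ) - p 0 ≤ ((p N : ℝ) - p 0) / 2 ∧
      (p N : ℝ) - p (j + 1) ≤ ((p N : ℝ) - p 0) / 2 := by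
  classical
  have hlt : (p 0 : ℝ) < p N := h
  have hex : ∃ k, (p 0 : ℝ) + ((p N : ℝ) - p 0) / 2 < p k := ⟨N, by linarith⟩
  obtain ⟨j, hj⟩ : ∃ j, Nat.find hex = j + 1 := by
    refine Nat.exists_eq_succ_of_ne_zero fun h0 => ?_
    have := Nat.find_spec hex
    rw [h0] at this
    linarith
  obtain ⟨r, hr⟩ := Nat.exists_eq_add_of_le (Nat.find_min' hex (by linarith : _ < (p N : ℝ)))
  have hbefore := not_lt.1 (Nat.find_min hex (by omega : j < Nat.find hex))
  have hafter := Nat.find_spec hex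
  rw [hj] at hr hafter
  exact ⟨j, r, hr, by linarith, by linarith⟩

lemma sum_sub_eq_split (A : I → I → E) (p : ℕ → I) (j r : ℕ) :
    ∑ i ∈ Finset.range (j + 1 + r), A (p i) (p (i + 1)) - A (p 0) (p (j + 1 + r))
      = (∑ i ∈ Finset.range j, A (p i) (p (i + 1)) - A (p 0) (p j))
        + (∑ i ∈ Finset.range r, A (p (j + 1 + i)) (p (j + 1 + (i + 1)))
            - A (p (j + 1 + 0)) (p (j + 1 + r)))
        - (A (p 0) (p (j + 1 + r)) - A (p 0) (p j) - A (p j) (p (j + 1 + r)))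
        - (A (p j) (p (j + 1 + r)) - A (p j) (p (j + 1)) - A (p (j + 1)) (p (j + 1 + r))) := by
  rw [Finset.sum_range_add, Finset.sum_range_succ]
  simp only [add_zero, add_assoc]
  abel

lemma norm_sum_sub_le_of_eq (hA : IsAlmostAdditive A K θ) (hθ : θ ≠ 0) {N : ℕ} {p : ℕ → I}
    (hp : Monotone p) (h : p 0 = p N) :
    ‖∑ j ∈ Finset.range N, A (p j) (p (j + 1)) - A (p 0) (p N)‖ = 0 := by
  have hconst {j : ℕ} (hj : j ≤ N) : p j = p 0 :=
    le_antisymm ((hp hj).trans h.ge) (hp (Nat.zero_le _))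
  have hsum : ∑ j ∈ Finset.range N, A (p j) (p (j + 1)) = 0 := by
    refine Finset.sum_eq_zero fun j hj => ?_
    have hj := Finset.mem_range.1 hj
    rw [hconst hj.le, hconst hj, hA.apply_self hθ]
  rw [hsum, ← h, hA.apply_self hθ, sub_zero, norm_zero]

/-- Induction on the number of points: removing the interval which contains the midpoint leaves two
partitions of intervals of at most half the length. -/
lemma IsAlmostAdditive.norm_sum_sub_le (hA : IsAlmostAdditive A K θ) (hθ : 1 < θ)
    (N : ℕ) (p : ℕ → I) (hp : Monotone p) :
    ‖∑ j ∈ Finset.range N, A (p j) (p (j + 1)) - A (p 0) (p N)‖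
      ≤ sewingConst θ * K * ((p N : ℝ) - p 0) ^ θ := by
  induction N using Nat.strong_induction_on generalizing p with
  | _ N ih =>
  have hC : 0 ≤ sewingConst θ * K := mul_nonneg (sewingConst_pos hθ).le hA.nonneg
  rcases (hp (Nat.zero_le N)).eq_or_lt with heq | hlt
  · rw [norm_sum_sub_le_of_eq hA (by linarith) hp heq]
    exact mul_nonneg hC (sub_rpow_nonneg heq.le θ)
  obtain ⟨j, r, rfl, hj, hr⟩ := exists_halving_index hlt
  set h : ℝ := (p (j + 1 + r) : ℝ) - p 0
  have hpow {q q' : I} {x : ℝ} (hq : q ≤ q') (hx : (q' : ℝ) - q ≤ x) :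
      ((q' : ℝ) - q) ^ θ ≤ x ^ θ :=
    Real.rpow_le_rpow (sub_nonneg.2 hq) hx (by linarith)
  have hleft := (ih j (by omega) p hp).trans
    (mul_le_mul_of_nonneg_left (hpow (hp (Nat.zero_le j)) hj) hC)
  have hright := (ih r (by omega) (fun i => p (j + 1 + i)) (fun a b hab => hp (by omega))).trans
    (mul_le_mul_of_nonneg_left (hpow (hp (by omega)) hr) hC)
  have hdefect := hA (p 0) (p j) (p (j + 1 + r)) (hp (Nat.zero_le _)) (hp (by omega))
  have hdefect' := (hA (p j) (p (j + 1)) (p (j + 1 + r)) (hp (by omega)) (hp (by omega))).trans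
    (mul_le_mul_of_nonneg_left (hpow (hp (by omega)) (x := h)
      (sub_le_sub_left (show (p 0 : ℝ) ≤ p j from hp (Nat.zero_le j)) _)) hA.nonneg)
  calc _ ≤ sewingConst θ * K * (h / 2) ^ θ + sewingConst θ * K * (h / 2) ^ θ + K * h ^ θ
          + K * h ^ θ := by
        rw [sum_sub_eq_split]
        exact norm_sub_le_of_le
          (norm_sub_le_of_le (norm_add_le_of_le hleft hright) hdefect) hdefect'
    _ = K * (2 * (sewingConst θ * (h / 2) ^ θ) + 2 * h ^ θ) := by ring
    _ = sewingConst θ * K * h ^ θ := by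
        rw [two_mul_sewingConst_mul_half_rpow_add hθ (sub_nonneg.2 hlt.le)]
        ring

/-- The point `k / 2 ^ n` of the dyadic grid of level `n`, projected to `[0,1]`. -/
def dyadicGrid (n k : ℕ) : I := projIcc 0 1 zero_le_one ((k : ℝ) / 2 ^ n)

lemma dyadicGrid_mono (n : ℕ) : Monotone (dyadicGrid n) := fun a b hab =>
  monotone_projIcc _ (by gcongr)

lemma dyadicGrid_zero (n : ℕ) : dyadicGrid n 0 = 0 := by
  simp [dyadicGrid]

lemma dyadicGrid_last (n : ℕ) : dyadicGrid n (2 ^ n) = 1 := by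
  simp [dyadicGrid]

lemma dyadicGrid_succ_two_mul (n k : ℕ) : dyadicGrid (n + 1) (2 * k) = dyadicGrid n k := by
  unfold dyadicGrid
  congr 1
  push_cast
  field_simp
  ring

lemma dyadicGrid_sub_le (n k : ℕ) :
    (dyadicGrid n (k + 1) : ℝ) - dyadicGrid n k ≤ (1 / 2) ^ n := by
  have h := abs_projIcc_sub_projIcc (a := (0 : ℝ)) (b := 1) zero_le_one
    (c := ((k + 1 : ℕ) : ℝ) / 2 ^ n) (d := (k : ℝ) / 2 ^ n)
  refine (le_abs_self _).trans (h.trans (le_of_eq ?_))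
  rw [← sub_div]
  push_cast
  simp

/-- Projection of a time to the interval `[s, t]`. -/
def clamp (s t x : I) : I := max s (min x t)

lemma clamp_mono (s t : I) : Monotone (clamp s t) := fun _ _ h =>
  max_le_max le_rfl (min_le_min h le_rfl)

lemma clamp_sub_le (s t : I) {x y : I} (h : x ≤ y) :
    (clamp s t y : ℝ) - clamp s t x ≤ (y : ℝ) - x := by
  have h' : (x : ℝ) ≤ y := h
  have e (z : I) : (clamp s t z : ℝ) = max (s : ℝ) (min (z : ℝ) t) := by
    simp [clamp]
  rw [e, e]
  rcases max_cases (s : ℝ) (min (y : ℝ) t) with h1 | h1 <;>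
  rcases max_cases (s : ℝ) (min (x : ℝ) t) with h2 | h2 <;>
  rcases min_cases (y : ℝ) t with h3 | h3 <;>
  rcases min_cases (x : ℝ) t with h4 | h4 <;> linarith

lemma clamp_zero (s t : I) : clamp s t 0 = s := by
  rw [clamp, min_eq_left (show (0 : I) ≤ t from t.2.1)]
  exact max_eq_left s.2.1

lemma clamp_one {s t : I} (hst : s ≤ t) : clamp s t 1 = t := by
  rw [clamp, min_eq_right (show t ≤ (1 : I) from t.2.2), max_eq_right hst]

lemma clamp_dyadicGrid_sub_le (s t : I) (n k : ℕ) :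
    (clamp s t (dyadicGrid n (k + 1)) : ℝ) - clamp s t (dyadicGrid n k) ≤ (1 / 2) ^ n :=
  (clamp_sub_le s t (dyadicGrid_mono n (Nat.le_succ k))).trans (dyadicGrid_sub_le n k)

/-- The sum of `A` over the dyadic partition of level `n`, restricted to `[s, t]`. -/
def dyadicSum (A : I → I → E) (n : ℕ) (s t : I) : E :=
  ∑ k ∈ Finset.range (2 ^ n), A (clamp s t (dyadicGrid n k)) (clamp s t (dyadicGrid n (k + 1)))

lemma sum_range_two_mul (f : ℕ → E) (m : ℕ) :
    ∑ k ∈ Finset.range (2 * m), f k = ∑ k ∈ Finset.range m, (f (2 * k) + f (2 * k + 1)) := by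
  induction m with
  | zero => simp
  | succ m ih =>
    rw [show 2 * (m + 1) = 2 * m + 1 + 1 by ring, Finset.sum_range_succ, Finset.sum_range_succ,
      Finset.sum_range_succ, ih, add_assoc]

lemma two_pow_mul_half_rpow (θ : ℝ) (n : ℕ) (K : ℝ) :
    ((2 ^ n : ℕ) : ℝ) * (K * ((1 / 2 : ℝ) ^ n) ^ θ) = K * ((2 : ℝ) ^ (1 - θ)) ^ n := by
  have h : (2 : ℝ) ^ (1 - θ) = 2 * (1 / 2) ^ θ := by
    rw [Real.rpow_sub two_pos, Real.rpow_one, Real.div_rpow one_pos.le two_pos.le, Real.one_rpow]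
    ring
  have h2 : ((1 / 2 : ℝ) ^ n) ^ θ = ((1 / 2 : ℝ) ^ θ) ^ n := by
    rw [← Real.rpow_natCast, ← Real.rpow_natCast, ← Real.rpow_mul (by norm_num),
      ← Real.rpow_mul (by norm_num), mul_comm]
  rw [h, h2, mul_pow]
  push_cast
  ring

lemma IsAlmostAdditive.norm_dyadicSum_succ_sub_le (hA : IsAlmostAdditive A K θ) (hθ : 0 ≤ θ)
    (s t : I) (n : ℕ) :
    ‖dyadicSum A n s t - dyadicSum A (n + 1) s t‖ ≤ K * ((2 : ℝ) ^ (1 - θ)) ^ n := by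
  unfold dyadicSum
  rw [pow_succ' 2 n, sum_range_two_mul, ← Finset.sum_sub_distrib, ← two_pow_mul_half_rpow]
  refine (norm_sum_le_of_le _ (n := fun _ => K * ((1 / 2 : ℝ) ^ n) ^ θ) fun k _ => ?_).trans
    (le_of_eq (by simp))
  rw [show 2 * k + 1 + 1 = 2 * (k + 1) by ring, dyadicGrid_succ_two_mul, dyadicGrid_succ_two_mul,
    ← sub_sub]
  have m1 : dyadicGrid n k ≤ dyadicGrid (n + 1) (2 * k + 1) := by
    rw [← dyadicGrid_succ_two_mul]
    exact dyadicGrid_mono _ (by omega)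
  have m2 : dyadicGrid (n + 1) (2 * k + 1) ≤ dyadicGrid n (k + 1) := by
    rw [← dyadicGrid_succ_two_mul n (k + 1)]
    exact dyadicGrid_mono _ (by omega)
  refine (hA _ _ _ (clamp_mono s t m1) (clamp_mono s t m2)).trans
    (mul_le_mul_of_nonneg_left (Real.rpow_le_rpow
      (sub_nonneg.2 (clamp_mono s t (m1.trans m2))) (clamp_dyadicGrid_sub_le s t n k)
      hθ) hA.nonneg)

lemma IsAlmostAdditive.norm_dyadicSum_add_sub_le (hA : IsAlmostAdditive A K θ) (hθ : 0 < θ)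
    {s u t : I} (hsu : s ≤ u) (hut : u ≤ t) (n : ℕ) :
    ‖dyadicSum A n s t - dyadicSum A n s u - dyadicSum A n u t‖
      ≤ K * ((2 : ℝ) ^ (1 - θ)) ^ n := by
  unfold dyadicSum
  rw [← Finset.sum_sub_distrib, ← Finset.sum_sub_distrib, ← two_pow_mul_half_rpow]
  refine (norm_sum_le_of_le _ (n := fun _ => K * ((1 / 2 : ℝ) ^ n) ^ θ) fun k _ => ?_).trans
    (le_of_eq (by simp))
  set x := dyadicGrid n k
  set y := dyadicGrid n (k + 1)
  have hxy : x ≤ y := dyadicGrid_mono n (Nat.le_succ k)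
  have hpos : 0 ≤ K * ((1 / 2 : ℝ) ^ n) ^ θ := mul_nonneg hA.nonneg (by positivity)
  have c1 (z : I) (hz : z ≤ u) : clamp s t z = clamp s u z := by
    simp [clamp, min_eq_left hz, min_eq_left (hz.trans hut)]
  have c2 (z : I) (hz : z ≤ u) : clamp u t z = u := by
    simp [clamp, min_eq_left (hz.trans hut), max_eq_left hz]
  have c3 (z : I) (hz : u ≤ z) : clamp s t z = clamp u t z := by
    have : u ≤ min z t := le_min hz hut
    simp [clamp, max_eq_right this, max_eq_right (hsu.trans this)]
  have c4 (z : I) (hz : u ≤ z) : clamp s u z = u := by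
    simp [clamp, min_eq_right hz, max_eq_right hsu]
  rcases le_total y u with hy | hy
  · rw [c1 x (hxy.trans hy), c1 y hy, c2 x (hxy.trans hy), c2 y hy, hA.apply_self hθ.ne']
    simpa using hpos
  rcases le_total u x with hx | hx
  · rw [c3 x hx, c3 y (hx.trans hxy), c4 x hx, c4 y (hx.trans hxy), hA.apply_self hθ.ne']
    simpa using hpos
  · rw [c2 x hx, c4 y hy, ← c1 x hx, ← c3 y hy]
    have m1 : clamp s t x ≤ u := by rw [c1 x hx]; exact max_le hsu (min_le_right _ _)
    have m2 : u ≤ clamp s t y := by rw [c3 y hy]; exact le_max_left _ _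
    exact (hA _ _ _ m1 m2).trans (mul_le_mul_of_nonneg_left (Real.rpow_le_rpow
      (sub_nonneg.2 (m1.trans m2)) (clamp_dyadicGrid_sub_le s t n k) hθ.le) hA.nonneg)

theorem IsAlmostAdditive.exists_sewing [CompleteSpace E] (hA : IsAlmostAdditive A K θ)
    (hθ : 1 < θ) :
    ∃ Φ : I → I → E, IsIntervalAdditive Φ ∧
      ∀ s t, s ≤ t → ‖Φ s t - A s t‖ ≤ sewingConst θ * K * ((t : ℝ) - s) ^ θ := by
  have hθ0 : 0 < θ := by linarith
  have hlim (s t : I) : ∃ x, Tendsto (fun n => dyadicSum A n s t) atTop (𝓝 x) := by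
    refine cauchySeq_tendsto_of_complete
      (cauchySeq_of_le_geometric ((2 : ℝ) ^ (1 - θ)) K (two_rpow_lt_one hθ) fun n => ?_)
    rw [dist_eq_norm]
    exact hA.norm_dyadicSum_succ_sub_le hθ0.le s t n
  choose Φ hΦ using hlim
  refine ⟨Φ, fun s u t hsu hut => ?_, fun s t hst => ?_⟩
  · have hdefect : Tendsto (fun n => dyadicSum A n s t - dyadicSum A n s u - dyadicSum A n u t)
        atTop (𝓝 (Φ s t - Φ s u - Φ u t)) := ((hΦ s t).sub (hΦ s u)).sub (hΦ u t)
    have hgeom : Tendsto (fun n : ℕ => K * ((2 : ℝ) ^ (1 - θ)) ^ n) atTop (𝓝 0) := by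
      simpa using (tendsto_pow_atTop_nhds_zero_of_lt_one
        (Real.rpow_nonneg two_pos.le _) (two_rpow_lt_one hθ)).const_mul K
    have hzero := tendsto_nhds_unique hdefect
      (squeeze_zero_norm (hA.norm_dyadicSum_add_sub_le hθ0 hsu hut) hgeom)
    rwa [sub_sub, sub_eq_zero] at hzero
  · refine le_of_tendsto ((hΦ s t).sub_const (A s t)).norm (Eventually.of_forall fun n => ?_)
    have := hA.norm_sum_sub_le hθ (2 ^ n) (fun k => clamp s t (dyadicGrid n k))
      ((clamp_mono s t).comp (dyadicGrid_mono n))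
    rwa [dyadicGrid_zero, dyadicGrid_last, clamp_zero, clamp_one hst] at this

lemma le_of_forall_le_succ {N : ℕ} {p : ℕ → I} (hp : ∀ j < N, p j ≤ p (j + 1)) :
    ∀ i ≤ N, p 0 ≤ p i := by
  intro i
  induction i with
  | zero => exact fun _ => le_rfl
  | succ i ih => exact fun h => (ih (by omega)).trans (hp i (by omega))

lemma IsIntervalAdditive.apply_self (hΦ : IsIntervalAdditive Φ) (s : I) : Φ s s = 0 := by
  simpa using hΦ s s s le_rfl le_rfl

lemma IsIntervalAdditive.eq_sum (hΦ : IsIntervalAdditive Φ) {N : ℕ} {p : ℕ → I}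
    (hp : ∀ j < N, p j ≤ p (j + 1)) :
    ∀ i ≤ N, Φ (p 0) (p i) = ∑ j ∈ Finset.range i, Φ (p j) (p (j + 1)) := by
  intro i
  induction i with
  | zero => exact fun _ => hΦ.apply_self _
  | succ i ih =>
    intro hi
    rw [Finset.sum_range_succ, ← ih (by omega)]
    exact hΦ _ _ _ (le_of_forall_le_succ hp i (by omega)) (hp i (by omega))

lemma rpow_le_mul_self {x m : ℝ} (hθ : 1 < θ) (hx : 0 ≤ x) (hm : 0 ≤ m)
    (hxm : x ≤ m ^ (1 / (θ - 1))) : x ^ θ ≤ m * x := by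
  have hθ' : 0 < θ - 1 := by linarith
  have hpow : x ^ (θ - 1) ≤ m := by
    refine (Real.rpow_le_rpow hx hxm hθ'.le).trans (le_of_eq ?_)
    rw [← Real.rpow_mul hm, one_div_mul_cancel hθ'.ne', Real.rpow_one]
  calc x ^ θ = x ^ (θ - 1) * x := by
        rw [← Real.rpow_add_one' hx (by linarith), sub_add_cancel]
    _ ≤ m * x := mul_le_mul_of_nonneg_right hpow hx

theorem IsIntervalAdditive.exists_mesh (hΦ : IsIntervalAdditive Φ) {C : ℝ} (hθ : 1 < θ)
    (hC : 0 ≤ C) (hΦA : ∀ s t, s ≤ t → ‖Φ s t - A s t‖ ≤ C * ((t : ℝ) - s) ^ θ) (a b : I)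
    {ε : ℝ} (hε : 0 < ε) : ∃ δ : ℝ, 0 < δ ∧ ∀ (N : ℕ) (p : ℕ → I), p 0 = a → p N = b →
      (∀ j < N, p j ≤ p (j + 1)) → (∀ j < N, (p (j + 1) : ℝ) - p j < δ) →
      ‖(∑ j ∈ Finset.range N, A (p j) (p (j + 1))) - Φ a b‖ < ε := by
  set m := ε / (C + 1)
  have hm : 0 < m := by positivity
  refine ⟨m ^ (1 / (θ - 1)), by positivity, ?_⟩
  rintro N p rfl rfl hmono hmesh
  have hterm : ∀ j ∈ Finset.range N, ‖A (p j) (p (j + 1)) - Φ (p j) (p (j + 1))‖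
      ≤ C * m * ((p (j + 1) : ℝ) - p j) := by
    intro j hj
    have hj := Finset.mem_range.1 hj
    rw [norm_sub_rev, mul_assoc]
    exact (hΦA _ _ (hmono j hj)).trans (mul_le_mul_of_nonneg_left
      (rpow_le_mul_self hθ (sub_nonneg.2 (hmono j hj)) hm.le (hmesh j hj).le) hC)
  rw [hΦ.eq_sum hmono N le_rfl, ← Finset.sum_sub_distrib]
  have hlen : (p N : ℝ) - p 0 ≤ 1 := by linarith [(p N).2.2, (p 0).2.1]
  calc _ ≤ C * m * ((p N : ℝ) - p 0) := by
        refine (norm_sum_le_of_le _ hterm).trans_eq ?_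
        rw [← Finset.mul_sum, Finset.sum_range_sub (fun j => (p j : ℝ)) N]
    _ ≤ C * m := mul_le_of_le_one_right (by positivity) hlen
    _ < (C + 1) * m := by linarith
    _ = ε := mul_div_cancel₀ ε (by positivity)

end Sewing

/-! ### The rough integral -/

section Pairing

variable {V : Type*} [NormedAddCommGroup V] [InnerProductSpace ℝ V]
variable {E : Type*} [NormedAddCommGroup E] [NormedSpace ℝ E]
variable {E' : Type*} [NormedAddCommGroup E'] [NormedSpace ℝ E']

@[simp]
lemma pairing_tmul (B : V →L[ℝ] V →L[ℝ] E) (v w : V) : pairing B (v ⊗ₜ[ℝ] w) = B v w := by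
  simp [pairing]

lemma pairing_sub (B B' : V →L[ℝ] V →L[ℝ] E) (x : V ⊗[ℝ] V) :
    pairing (B - B') x = pairing B x - pairing B' x := by
  induction x using TensorProduct.induction_on with
  | zero => simp
  | tmul v w => simp
  | add x y hx hy => rw [map_add, map_add, map_add, hx, hy]; abel

lemma pairing_compL (L : E →L[ℝ] E') (B : V →L[ℝ] V →L[ℝ] E) (x : V ⊗[ℝ] V) :
    pairing ((ContinuousLinearMap.compL ℝ V E E' L).comp B) x = L (pairing B x) := by
  induction x using TensorProduct.induction_on with
  | zero => simp
  | tmul v w => simp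
  | add x y hx hy => rw [map_add, map_add, map_add, hx, hy]

/-- A bound, independent of `E`, for the pairing of `L(V, L(V, E))` with `V ⊗ V`: the sum over a
basis of `V ⊗ V` of the norms of the basis tensors and of the coordinate functionals. -/
def pairingConst (V : Type*) [NormedAddCommGroup V] [InnerProductSpace ℝ V]
    [FiniteDimensional ℝ V] : ℝ :=
  ∑ p : Fin (Module.finrank ℝ V) × Fin (Module.finrank ℝ V),
    ‖LinearMap.toContinuousLinearMap
      (((Module.finBasis ℝ V).tensorProduct (Module.finBasis ℝ V)).coord p)‖
      * (‖Module.finBasis ℝ V p.1‖ * ‖Module.finBasis ℝ V p.2‖)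

variable [FiniteDimensional ℝ V]

lemma pairingConst_nonneg : 0 ≤ pairingConst V := Finset.sum_nonneg fun _ _ => by positivity

lemma norm_pairing_le (B : V →L[ℝ] V →L[ℝ] E) (x : V ⊗[ℝ] V) :
    ‖pairing B x‖ ≤ pairingConst V * ‖B‖ * ‖x‖ := by
  set b := (Module.finBasis ℝ V).tensorProduct (Module.finBasis ℝ V) with hb
  have hx : pairing B x = ∑ p, b.coord p x • pairing B (b p) := by
    conv_lhs => rw [← b.sum_repr x, map_sum]
    simp only [map_smul, Module.Basis.coord_apply]
  rw [hx, pairingConst, Finset.sum_mul, Finset.sum_mul]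
  refine norm_sum_le_of_le _ fun p _ => ?_
  have h1 : ‖b.coord p x‖ ≤ ‖LinearMap.toContinuousLinearMap (b.coord p)‖ * ‖x‖ :=
    (LinearMap.toContinuousLinearMap (b.coord p)).le_opNorm x
  have h2 : ‖pairing B (b p)‖ ≤ ‖B‖ * ‖Module.finBasis ℝ V p.1‖ * ‖Module.finBasis ℝ V p.2‖ := by
    rw [hb, Module.Basis.tensorProduct_apply, pairing_tmul]
    exact B.le_opNorm₂ _ _
  rw [norm_smul]
  refine (mul_le_mul h1 h2 (norm_nonneg _) (by positivity)).trans (le_of_eq ?_)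
  ring

end Pairing

section Integral

variable {V : Type*} [NormedAddCommGroup V] [InnerProductSpace ℝ V] {α : ℝ}
variable {E : Type*} [NormedAddCommGroup E] [NormedSpace ℝ E]
variable {E' : Type*} [NormedAddCommGroup E'] [NormedSpace ℝ E']
variable {𝓦 : RoughPath V α} {Z Z' : PathPair V (V →L[ℝ] E)} {c : ℝ}

/-- The local approximation `Z_s W_{s,t} + Z'_s 𝕎_{s,t}` of the rough integral. -/
def germ (𝓦 : RoughPath V α) (Z : PathPair V (V →L[ℝ] E)) (s t : I) : E :=
  Z.1 s (𝓦.path t - 𝓦.path s) + pairing (Z.2 s) (𝓦.area s t)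

lemma germ_sub (𝓦 : RoughPath V α) (Z Z' : PathPair V (V →L[ℝ] E)) (s t : I) :
    germ 𝓦 (Z - Z') s t = germ 𝓦 Z s t - germ 𝓦 Z' s t := by
  simp only [germ, Prod.fst_sub, Prod.snd_sub, Pi.sub_apply, sub_apply,
    pairing_sub]
  abel

lemma germ_compL (L : E →L[ℝ] E') (s t : I) :
    germ 𝓦 (opMul (fun _ => ContinuousLinearMap.compL ℝ V E E' L) Z) s t = L (germ 𝓦 Z s t) := by
  simp [germ, opMul, pairing_compL]

lemma germ_defect {s u t : I} (hsu : s ≤ u) (hut : u ≤ t) :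
    germ 𝓦 Z s t - germ 𝓦 Z s u - germ 𝓦 Z u t
      = -(remainder 𝓦 Z s u (𝓦.path t - 𝓦.path u)
          + pairing (Z.2 u - Z.2 s) (𝓦.area u t)) := by
  have h : 𝓦.area s t
      = 𝓦.area s u + 𝓦.area u t + (𝓦.path u - 𝓦.path s) ⊗ₜ[ℝ] (𝓦.path t - 𝓦.path u) := by
    rw [← 𝓦.chen s u t hsu hut]; abel
  simp only [germ, h, pairing_sub, map_add, pairing_tmul, remainder, map_sub,
    sub_apply]
  abel

lemma isRoughIntegral_iff {a b : I} {J : E} :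
    IsRoughIntegral 𝓦 Z a b J ↔ ∀ ε : ℝ, 0 < ε → ∃ δ : ℝ, 0 < δ ∧ ∀ (N : ℕ) (p : ℕ → I),
      p 0 = a → p N = b → (∀ j < N, p j ≤ p (j + 1)) → (∀ j < N, (p (j + 1) : ℝ) - p j < δ) →
      ‖(∑ j ∈ Finset.range N, germ 𝓦 Z (p j) (p (j + 1))) - J‖ < ε :=
  Iff.rfl

lemma IsRoughIntegral.map {a b : I} {J : E} (h : IsRoughIntegral 𝓦 Z a b J) (L : E →L[ℝ] E') :
    IsRoughIntegral 𝓦 (opMul (fun _ => ContinuousLinearMap.compL ℝ V E E' L) Z) a b (L J) := by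
  rw [isRoughIntegral_iff] at h ⊢
  intro ε hε
  have hL : 0 < ‖L‖ + 1 := by positivity
  obtain ⟨δ, hδ, H⟩ := h (ε / (‖L‖ + 1)) (by positivity)
  refine ⟨δ, hδ, fun N p ha hb hp hmesh => ?_⟩
  have hJ := H N p ha hb hp hmesh
  rw [lt_div_iff₀' hL] at hJ
  simp only [germ_compL]
  rw [← map_sum, ← map_sub]
  exact (L.le_of_opNorm_le (le_add_of_nonneg_right zero_le_one) _).trans_lt hJ

lemma IsRoughIntegral.sub {a b : I} {J J' : E} (h : IsRoughIntegral 𝓦 Z a b J)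
    (h' : IsRoughIntegral 𝓦 Z' a b J') : IsRoughIntegral 𝓦 (Z - Z') a b (J - J') := by
  rw [isRoughIntegral_iff] at h h' ⊢
  intro ε hε
  obtain ⟨δ, hδ, H⟩ := h (ε / 2) (half_pos hε)
  obtain ⟨δ', hδ', H'⟩ := h' (ε / 2) (half_pos hε)
  refine ⟨min δ δ', lt_min hδ hδ', fun N p ha hb hp hmesh => ?_⟩
  have hJ := H N p ha hb hp fun j hj => (hmesh j hj).trans_le (min_le_left _ _)
  have hJ' := H' N p ha hb hp fun j hj => (hmesh j hj).trans_le (min_le_right _ _)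
  simp only [germ_sub]
  rw [Finset.sum_sub_distrib, sub_sub_sub_comm, ← add_halves ε]
  exact (norm_sub_le _ _).trans_lt (add_lt_add hJ hJ')

lemma exists_partition (a b : I) (hab : a ≤ b) {δ : ℝ} (hδ : 0 < δ) :
    ∃ (N : ℕ) (p : ℕ → I), p 0 = a ∧ p N = b ∧ (∀ j < N, p j ≤ p (j + 1)) ∧
      ∀ j < N, (p (j + 1) : ℝ) - p j < δ := by
  obtain ⟨n, hn⟩ := exists_pow_lt_of_lt_one hδ (by norm_num : (1 / 2 : ℝ) < 1)
  refine ⟨2 ^ n, fun k => clamp a b (dyadicGrid n k), ?_, ?_,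
    fun j _ => clamp_mono a b (dyadicGrid_mono n (Nat.le_succ j)),
    fun j _ => (clamp_dyadicGrid_sub_le a b n j).trans_lt hn⟩
  · simp only [dyadicGrid_zero, clamp_zero]
  · simp only [dyadicGrid_last, clamp_one hab]

lemma IsRoughIntegral.unique {a b : I} (hab : a ≤ b) {J J' : E} (h : IsRoughIntegral 𝓦 Z a b J)
    (h' : IsRoughIntegral 𝓦 Z a b J') : J = J' := by
  by_contra hne
  have hpos : 0 < ‖J - J'‖ := norm_pos_iff.2 (sub_ne_zero.2 hne)
  obtain ⟨δ, hδ, H⟩ := h (‖J - J'‖ / 2) (by positivity)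
  obtain ⟨δ', hδ', H'⟩ := h' (‖J - J'‖ / 2) (by positivity)
  obtain ⟨N, p, h0, hN, hp, hm⟩ := exists_partition a b hab (lt_min hδ hδ')
  have h1 := H N p h0 hN hp fun j hj => (hm j hj).trans_le (min_le_left _ _)
  have h2 := H' N p h0 hN hp fun j hj => (hm j hj).trans_le (min_le_right _ _)
  rw [norm_sub_rev] at h1
  have h3 := (norm_add_le _ _).trans_lt (add_lt_add h1 h2)
  rw [sub_add_sub_cancel] at h3
  linarith

lemma IsRoughIntegral.roughIntegral_eq {a b : I} (hab : a ≤ b) {J : E}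
    (h : IsRoughIntegral 𝓦 Z a b J) : roughIntegral 𝓦 Z a b = J :=
  (Classical.epsilon_spec (p := IsRoughIntegral 𝓦 Z a b) ⟨J, h⟩).unique hab h

variable [FiniteDimensional ℝ V]

lemma ControlledBy.isAlmostAdditive_germ (hα : 0 < α) (hZ : ControlledBy 𝓦 Z c) :
    IsAlmostAdditive (germ 𝓦 Z) (c * (𝓦.pathSeminorm + pairingConst V * 𝓦.areaSeminorm))
      (3 * α) := by
  intro s u t hsu hut
  have hc := hZ.nonneg
  have hP := pairingConst_nonneg (V := V)
  have hleft (q : ℝ) (hq : 0 ≤ q) : ((u : ℝ) - s) ^ q ≤ ((t : ℝ) - s) ^ q :=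
    Real.rpow_le_rpow (sub_nonneg.2 hsu) (sub_le_sub_right (show (u : ℝ) ≤ t from hut) _) hq
  have hright (q : ℝ) (hq : 0 ≤ q) : ((t : ℝ) - u) ^ q ≤ ((t : ℝ) - s) ^ q :=
    Real.rpow_le_rpow (sub_nonneg.2 hut) (sub_le_sub_left (show (s : ℝ) ≤ u from hsu) _) hq
  have hτ : (0 : ℝ) ≤ (t : ℝ) - s := sub_nonneg.2 (hsu.trans hut)
  set τ := (t : ℝ) - s
  have hfirst : ‖RoughCenter.remainder 𝓦 Z s u (𝓦.path t - 𝓦.path u)‖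
      ≤ c * τ ^ (2 * α) * (𝓦.pathSeminorm * τ ^ α) :=
    (RoughCenter.remainder 𝓦 Z s u).le_of_opNorm_le_of_le
      ((hZ.remainder s u hsu).trans (mul_le_mul_of_nonneg_left (hleft _ (by positivity)) hc))
      ((𝓦.norm_path_sub_le hut).trans
        (mul_le_mul_of_nonneg_left (hright _ hα.le) 𝓦.pathSeminorm_nonneg))
  have hsecond : ‖pairing (Z.2 u - Z.2 s) (𝓦.area u t)‖
      ≤ pairingConst V * (c * τ ^ α) * (𝓦.areaSeminorm * τ ^ (2 * α)) := by
    refine (norm_pairing_le _ _).trans (mul_le_mul (mul_le_mul_of_nonneg_left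
      ((hZ.deriv_incr s u hsu).trans (mul_le_mul_of_nonneg_left (hleft _ hα.le) hc)) hP)
      ((𝓦.norm_area_le hut).trans (mul_le_mul_of_nonneg_left (hright _ (by positivity))
        𝓦.areaSeminorm_nonneg)) (norm_nonneg _) (by positivity))
  have hpow : τ ^ (3 * α) = τ ^ (2 * α) * τ ^ α := by
    rw [← Real.rpow_add_of_nonneg hτ (by positivity) hα.le]
    ring_nf
  rw [germ_defect hsu hut, norm_neg]
  refine (norm_add_le_of_le hfirst hsecond).trans (le_of_eq ?_)
  rw [hpow]
  ring

variable [CompleteSpace E]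

theorem ControlledBy.exists_isRoughIntegral (hα : 1 / 3 < α) (hZ : ControlledBy 𝓦 Z c) :
    ∃ Φ : I → I → E, IsIntervalAdditive Φ ∧
      (∀ s t, s ≤ t → ‖Φ s t - germ 𝓦 Z s t‖
        ≤ sewingConst (3 * α) * (c * (𝓦.pathSeminorm + pairingConst V * 𝓦.areaSeminorm))
          * ((t : ℝ) - s) ^ (3 * α)) ∧
      ∀ a b, IsRoughIntegral 𝓦 Z a b (Φ a b) := by
  have hθ : 1 < 3 * α := by linarith
  have hgerm := hZ.isAlmostAdditive_germ (by linarith)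
  obtain ⟨Φ, hadd, hclose⟩ := hgerm.exists_sewing hθ
  exact ⟨Φ, hadd, hclose, fun a b _ hε =>
    hadd.exists_mesh hθ (mul_nonneg (sewingConst_pos hθ).le hgerm.nonneg) hclose a b hε⟩

lemma IsControlled.isRoughIntegral (hα : 1 / 3 < α) (hZ : IsControlled 𝓦 Z) {a b : I}
    (hab : a ≤ b) : IsRoughIntegral 𝓦 Z a b (roughIntegral 𝓦 Z a b) := by
  obtain ⟨Φ, -, -, hΦ⟩ := (hZ.controlledBy (by linarith)).exists_isRoughIntegral hα
  rw [(hΦ a b).roughIntegral_eq hab]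
  exact hΦ a b

lemma IsControlled.roughIntegral_add_adjacent (hα : 1 / 3 < α) (hZ : IsControlled 𝓦 Z)
    {s u t : I} (hsu : s ≤ u) (hut : u ≤ t) :
    roughIntegral 𝓦 Z s t = roughIntegral 𝓦 Z s u + roughIntegral 𝓦 Z u t := by
  obtain ⟨Φ, hadd, -, hΦ⟩ := (hZ.controlledBy (by linarith)).exists_isRoughIntegral hα
  rw [(hΦ s t).roughIntegral_eq (hsu.trans hut), (hΦ s u).roughIntegral_eq hsu,
    (hΦ u t).roughIntegral_eq hut, hadd s u t hsu hut]

lemma ControlledBy.norm_roughIntegral_sub_germ_le (hα : 1 / 3 < α) (hZ : ControlledBy 𝓦 Z c)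
    {s t : I} (hst : s ≤ t) :
    ‖roughIntegral 𝓦 Z s t - germ 𝓦 Z s t‖
      ≤ sewingConst (3 * α) * (c * (𝓦.pathSeminorm + pairingConst V * 𝓦.areaSeminorm))
        * ((t : ℝ) - s) ^ (3 * α) := by
  obtain ⟨Φ, -, hclose, hΦ⟩ := hZ.exists_isRoughIntegral hα
  rw [(hΦ s t).roughIntegral_eq hst]
  exact hclose s t hst

lemma IsControlled.roughIntegral_sub (hα : 1 / 3 < α) (hZ : IsControlled 𝓦 Z)
    (hZ' : IsControlled 𝓦 Z') {a b : I} (hab : a ≤ b) :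
    roughIntegral 𝓦 (Z - Z') a b = roughIntegral 𝓦 Z a b - roughIntegral 𝓦 Z' a b :=
  ((hZ.isRoughIntegral hα hab).sub (hZ'.isRoughIntegral hα hab)).roughIntegral_eq hab

lemma IsControlled.roughIntegral_compL (hα : 1 / 3 < α) (hZ : IsControlled 𝓦 Z)
    (L : E →L[ℝ] E') {a b : I} (hab : a ≤ b) :
    roughIntegral 𝓦 (opMul (fun _ => ContinuousLinearMap.compL ℝ V E E' L) Z) a b
      = L (roughIntegral 𝓦 Z a b) :=
  ((hZ.isRoughIntegral hα hab).map L).roughIntegral_eq hab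

lemma IsControlled.roughIntegral_self (hα : 1 / 3 < α) (hZ : IsControlled 𝓦 Z) (s : I) :
    roughIntegral 𝓦 Z s s = 0 := by
  have := hZ.roughIntegral_add_adjacent hα (le_refl s) (le_refl s)
  simpa using this

/-- A constant `C` such that `C (1 + ‖W‖_α + ‖𝕎‖_{2α})` bounds the indefinite rough integral as an
operator on controlled rough paths. -/
def integralConst (V : Type*) [NormedAddCommGroup V] [InnerProductSpace ℝ V]
    [FiniteDimensional ℝ V] (α : ℝ) : ℝ := (1 + sewingConst (3 * α)) * (1 + pairingConst V)

lemma one_le_integralConst (hα : 1 / 3 < α) : 1 ≤ integralConst V α :=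
  one_le_mul_of_one_le_of_one_le
    (le_add_of_nonneg_right (sewingConst_pos (by linarith : 1 < 3 * α)).le)
    (le_add_of_nonneg_right pairingConst_nonneg)

lemma add_le_integralConst_mul (hα : 1 / 3 < α) {a b : ℝ} (ha : 0 ≤ a) (hb : 0 ≤ b) :
    sewingConst (3 * α) * (a + pairingConst V * b) + pairingConst V * b + (1 + a)
      ≤ integralConst V α * (1 + a + b) := by
  have hS := (sewingConst_pos (by linarith : 1 < 3 * α)).le
  have hP := pairingConst_nonneg (V := V)
  rw [integralConst]
  set S := sewingConst (3 * α)
  set P := pairingConst V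
  have : 0 ≤ S + P + S * P + P * a + S * P * a + b + S * b := by positivity
  linarith

/-- The indefinite rough integral of `Z`, with Gubinelli derivative `Z`. -/
def indefiniteIntegral (𝓦 : RoughPath V α) (Z : PathPair V (V →L[ℝ] E)) : PathPair V E :=
  (fun t => roughIntegral 𝓦 Z 0 t, Z.1)

lemma ControlledBy.norm_remainder_indefiniteIntegral_le (hα : 1 / 3 < α)
    (hZ : ControlledBy 𝓦 Z c) {s t : I} (hst : s ≤ t) :
    ‖RoughCenter.remainder 𝓦 (indefiniteIntegral 𝓦 Z) s t‖
      ≤ (sewingConst (3 * α) * (𝓦.pathSeminorm + pairingConst V * 𝓦.areaSeminorm)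
        + pairingConst V * 𝓦.areaSeminorm) * c * ((t : ℝ) - s) ^ (2 * α) := by
  have hP := pairingConst_nonneg (V := V)
  have hS := (sewingConst_pos (by linarith : 1 < 3 * α)).le
  have ha := 𝓦.pathSeminorm_nonneg
  have hb := 𝓦.areaSeminorm_nonneg
  have hc := hZ.nonneg
  have hadd := (hZ.isControlled (by linarith)).roughIntegral_add_adjacent hα
    (show (0 : I) ≤ s from s.2.1) hst
  have hsplit : RoughCenter.remainder 𝓦 (indefiniteIntegral 𝓦 Z) s t
      = (roughIntegral 𝓦 Z s t - germ 𝓦 Z s t) + pairing (Z.2 s) (𝓦.area s t) := by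
    simp only [RoughCenter.remainder, germ, indefiniteIntegral, hadd]
    abel
  have hsew := (hZ.norm_roughIntegral_sub_germ_le hα hst).trans (mul_le_mul_of_nonneg_left
    (sub_rpow_le_rpow hst (by linarith : 0 < 2 * α) (by linarith : 2 * α ≤ 3 * α))
    (by positivity))
  have harea := (norm_pairing_le (Z.2 s) (𝓦.area s t)).trans (mul_le_mul
    (mul_le_mul_of_nonneg_left (hZ.deriv_sup s) hP) (𝓦.norm_area_le hst) (norm_nonneg _)
    (by positivity))
  rw [hsplit]
  exact (norm_add_le_of_le hsew harea).trans (le_of_eq (by ring))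

theorem ControlledBy.indefiniteIntegral (hα : 1 / 3 < α) (hZ : ControlledBy 𝓦 Z c) :
    ControlledBy 𝓦 (indefiniteIntegral 𝓦 Z)
      (integralConst V α * (1 + 𝓦.pathSeminorm + 𝓦.areaSeminorm) * c) := by
  have hα0 : 0 < α := by linarith
  have hc := hZ.nonneg
  have ha := 𝓦.pathSeminorm_nonneg
  have hb := 𝓦.areaSeminorm_nonneg
  have hP := pairingConst_nonneg (V := V)
  have hS := (sewingConst_pos (by linarith : 1 < 3 * α)).le
  have hrem {s t : I} (hst : s ≤ t) := hZ.norm_remainder_indefiniteIntegral_le hα hst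
  have hsum := mul_le_mul_of_nonneg_right (add_le_integralConst_mul (V := V) hα ha hb) hc
  set a := 𝓦.pathSeminorm
  set B := integralConst V α * (1 + a + 𝓦.areaSeminorm) * c
  set M := sewingConst (3 * α) * (a + pairingConst V * 𝓦.areaSeminorm)
    + pairingConst V * 𝓦.areaSeminorm
  have hM : 0 ≤ M * c := by positivity
  have hac : 0 ≤ a * c := by positivity
  refine ⟨fun t => ?_, fun t => (hZ.sup t).trans (by linarith), fun s t hst => ?_,
    fun s t hst => (hrem hst).trans
      (mul_le_mul_of_nonneg_right (by linarith) (sub_rpow_nonneg hst _))⟩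
  · have h0t : (0 : I) ≤ t := t.2.1
    have hpow (q : ℝ) (hq : 0 ≤ q) : ((t : ℝ) - (0 : I)) ^ q ≤ 1 :=
      Real.rpow_le_one (by simpa using t.2.1) (by simpa using t.2.2) hq
    have hfirst := (Z.1 0).le_of_opNorm_le_of_le (hZ.sup 0) ((𝓦.norm_path_sub_le h0t).trans
      (mul_le_of_le_one_right ha (hpow _ hα0.le)))
    have hsecond := (hrem h0t).trans (mul_le_of_le_one_right hM (hpow _ (by positivity)))
    have hsplit : roughIntegral 𝓦 Z 0 t = Z.1 0 (𝓦.path t - 𝓦.path (0 : I))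
        + RoughCenter.remainder 𝓦 (RoughCenter.indefiniteIntegral 𝓦 Z) 0 t := by
      simp [RoughCenter.remainder, RoughCenter.indefiniteIntegral,
        (hZ.isControlled hα0).roughIntegral_self hα]
    refine (congrArg norm hsplit).trans_le ((norm_add_le_of_le hfirst hsecond).trans ?_)
    linarith
  · exact (hZ.norm_incr_le hα0 hst).trans
      (mul_le_mul_of_nonneg_right (by linarith) (sub_rpow_nonneg hst _))

end Integral

/-! ### Convolutions with a one-parameter group -/

section Group

variable {X : Type*} [NormedAddCommGroup X] [NormedSpace ℝ X]

/-- A one-parameter group of operators that is bounded and Lipschitz on `[-1, 1]`, with the same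
constant `m` for both. These are the only times at which the group acts on paths on `[0, 1]`. -/
structure IsLipschitzGroup (S : ℝ → X →L[ℝ] X) (m : ℝ) : Prop where
  zero : S 0 = ContinuousLinearMap.id ℝ X
  add : ∀ s t, S (s + t) = S s ∘L S t
  norm_le : ∀ t ∈ Icc (-1 : ℝ) 1, ‖S t‖ ≤ m
  norm_sub_le : ∀ s ∈ Icc (-1 : ℝ) 1, ∀ t ∈ Icc (-1 : ℝ) 1, ‖S t - S s‖ ≤ m * |t - s|

/-- A projection `P` whose range and kernel are invariant under the operators `S t`. -/
structure IsInvariantProjection (S : ℝ → X →L[ℝ] X) (P : X →L[ℝ] X) : Prop where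
  idem : ∀ x, P (P x) = P x
  comm : ∀ t x, P (S t x) = S t (P x)

lemma exists_isLipschitzGroup_expGroup [CompleteSpace X] (B : X →L[ℝ] X) :
    ∃ m, IsLipschitzGroup (expGroup B) m := by
  have hderiv (t : ℝ) : HasDerivAt (expGroup B) (expGroup B t * B) t :=
    hasDerivAt_exp_smul_const B t
  have hcont : Continuous (expGroup B) :=
    continuous_iff_continuousAt.2 fun t => (hderiv t).continuousAt
  obtain ⟨m₁, h₁⟩ := (isCompact_Icc (a := (-1 : ℝ)) (b := 1)).exists_bound_of_continuousOn
    hcont.continuousOn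
  obtain ⟨m₂, h₂⟩ := (isCompact_Icc (a := (-1 : ℝ)) (b := 1)).exists_bound_of_continuousOn
    (hcont.mul continuous_const : Continuous fun t => expGroup B t * B).continuousOn
  refine ⟨max m₁ m₂, ?_, fun s t => ?_, fun t ht => (h₁ t ht).trans (le_max_left _ _),
    fun s hs t ht => ?_⟩
  · rw [expGroup, zero_smul, NormedSpace.exp_zero]
    rfl
  · let _ : NormedAlgebra ℚ (X →L[ℝ] X) := NormedAlgebra.restrictScalars ℚ ℝ _
    rw [expGroup, add_smul]
    exact NormedSpace.exp_add_of_commute (((Commute.refl B).smul_left s).smul_right t)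
  · exact (convex_Icc (-1 : ℝ) 1).norm_image_sub_le_of_norm_hasDerivWithin_le
      (fun x _ => (hderiv x).hasDerivWithinAt)
      (fun x hx => (h₂ x hx).trans (le_max_right m₁ m₂)) hs ht

variable {S : ℝ → X →L[ℝ] X} {m : ℝ}

namespace IsLipschitzGroup

lemma nonneg (hS : IsLipschitzGroup S m) : 0 ≤ m :=
  (norm_nonneg _).trans (hS.norm_le 0 (by simp))

lemma apply_add (hS : IsLipschitzGroup S m) (s t : ℝ) (x : X) : S (s + t) x = S s (S t x) := by
  rw [hS.add, ContinuousLinearMap.comp_apply]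

lemma apply_sub (hS : IsLipschitzGroup S m) (s t : ℝ) (x : X) :
    S (s - t) x = S s (S (0 - t) x) := by
  rw [← hS.apply_add, zero_sub, sub_eq_add_neg]

lemma apply_neg_apply (hS : IsLipschitzGroup S m) (t : ℝ) (x : X) : S t (S (-t) x) = x := by
  rw [← hS.apply_add, add_neg_cancel, hS.zero, ContinuousLinearMap.id_apply]

lemma neg_apply_apply (hS : IsLipschitzGroup S m) (t : ℝ) (x : X) : S (-t) (S t x) = x := by
  rw [← hS.apply_add, neg_add_cancel, hS.zero, ContinuousLinearMap.id_apply]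

lemma continuousOn (hS : IsLipschitzGroup S m) : ContinuousOn S (Icc (-1) 1) := by
  have hLip : LipschitzOnWith m.toNNReal S (Icc (-1) 1) :=
    LipschitzOnWith.of_dist_le_mul fun s hs t ht => by
      rw [dist_eq_norm, Real.dist_eq, Real.coe_toNNReal _ hS.nonneg]
      exact hS.norm_sub_le t ht s hs
  exact hLip.continuousOn

lemma comm_of_nonneg (hS : IsLipschitzGroup S m) {P : X →L[ℝ] X}
    (h : ∀ t, 0 ≤ t → P ∘L S t = S t ∘L P) (t : ℝ) (x : X) : P (S t x) = S t (P x) := by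
  have hpos (t : ℝ) (ht : 0 ≤ t) (x : X) : P (S t x) = S t (P x) := DFunLike.congr_fun (h t ht) x
  rcases le_total 0 t with ht | ht
  · exact hpos t ht x
  · calc P (S t x) = S t (S (-t) (P (S t x))) := (hS.apply_neg_apply t _).symm
      _ = S t (P (S (-t) (S t x))) := by rw [hpos (-t) (neg_nonneg.2 ht)]
      _ = S t (P x) := by rw [hS.neg_apply_apply]

lemma continuousOn_apply (hS : IsLipschitzGroup S m) (P : X →L[ℝ] X) {y : I → X}
    (hy : Continuous y) :
    ContinuousOn (fun r : ℝ => S (0 - r) (P (IccExtend zero_le_one y r))) (Icc 0 1) :=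
  (hS.continuousOn.comp (by fun_prop) fun r hr =>
    (⟨by linarith [hr.2], by linarith [hr.1]⟩ : 0 - r ∈ Icc (-1 : ℝ) 1)).clm_apply
    (P.continuous.comp hy.Icc_extend').continuousOn

lemma intervalIntegrable_apply (hS : IsLipschitzGroup S m) (P : X →L[ℝ] X) {y : I → X}
    (hy : Continuous y) (a b : I) :
    IntervalIntegrable (fun r : ℝ => S (0 - r) (P (IccExtend zero_le_one y r)))
      MeasureTheory.volume a b :=
  ((hS.continuousOn_apply P hy).mono (uIcc_subset_Icc a.2 b.2)).intervalIntegrable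

lemma norm_integral_apply_le (hS : IsLipschitzGroup S m) (P : X →L[ℝ] X) {y : I → X} {c : ℝ}
    (hyc : ∀ t, ‖y t‖ ≤ c) {s t : I} (hst : s ≤ t) :
    ‖∫ r in (s : ℝ)..t, S (0 - r) (P (IccExtend zero_le_one y r))‖
      ≤ m * ‖P‖ * c * ((t : ℝ) - s) := by
  have hst' : (s : ℝ) ≤ t := hst
  have hbound (r : ℝ) (hr : r ∈ uIoc (s : ℝ) t) :
      ‖S (0 - r) (P (IccExtend zero_le_one y r))‖ ≤ m * ‖P‖ * c := by
    rw [uIoc_of_le hst'] at hr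
    have h0 : 0 ≤ r := s.2.1.trans hr.1.le
    have h1 : r ≤ 1 := hr.2.trans t.2.2
    rw [mul_assoc]
    exact (S (0 - r)).le_of_opNorm_le_of_le (hS.norm_le _ ⟨by linarith, by linarith⟩)
      (P.le_opNorm_of_le (hyc (projIcc 0 1 zero_le_one r)))
  have h := intervalIntegral.norm_integral_le_of_norm_le_const hbound
  rwa [abs_of_nonneg (sub_nonneg.2 hst')] at h

end IsLipschitzGroup

end Group

section Convolution

variable {V : Type*} [NormedAddCommGroup V] [InnerProductSpace ℝ V] {α : ℝ}
variable {X : Type*} [NormedAddCommGroup X] [NormedSpace ℝ X]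
variable {S : ℝ → X →L[ℝ] X} {m : ℝ} {P : X →L[ℝ] X} {𝓦 : RoughPath V α}
variable {y y' : I → X} {Z Z' : PathPair V (V →L[ℝ] X)} {c c' : ℝ}

lemma convolved_eq_opMul (S : ℝ → X →L[ℝ] X) (P : X →L[ℝ] X) (c : ℝ)
    (Z : PathPair V (V →L[ℝ] X)) : convolved S P c Z
      = opMul (fun r : I => ContinuousLinearMap.compL ℝ V X X (S (c - r) ∘L P)) Z := rfl

lemma convolved_sub (S : ℝ → X →L[ℝ] X) (P : X →L[ℝ] X) (c : ℝ)
    (Z Z' : PathPair V (V →L[ℝ] X)) :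
    convolved S P c (Z - Z') = convolved S P c Z - convolved S P c Z' := by
  simp only [convolved_eq_opMul, opMul_sub]

lemma IsLipschitzGroup.convolved_eq (hS : IsLipschitzGroup S m) (P : X →L[ℝ] X) (c : ℝ)
    (Z : PathPair V (V →L[ℝ] X)) : convolved S P c Z
      = opMul (fun _ => ContinuousLinearMap.compL ℝ V X X (S c)) (convolved S P 0 Z) := by
  ext <;> simp [convolved, opMul, hS.apply_sub c]

lemma IsInvariantProjection.opMul_convolved (hP : IsInvariantProjection S P) (c : ℝ)
    (Z : PathPair V (V →L[ℝ] X)) :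
    opMul (fun _ => ContinuousLinearMap.compL ℝ V X X P) (convolved S P c Z)
      = convolved S P c Z := by
  ext <;> simp [convolved, opMul, hP.idem, hP.comm]

lemma norm_compL_le (L : X →L[ℝ] X) : ‖ContinuousLinearMap.compL ℝ V X X L‖ ≤ ‖L‖ :=
  ContinuousLinearMap.opNorm_le_bound _ (norm_nonneg _) L.opNorm_comp_le

lemma ControlledBy.convolved (hα : 0 < α) (hα2 : α ≤ 1 / 2) (hS : IsLipschitzGroup S m)
    (P : X →L[ℝ] X) (hZ : ControlledBy 𝓦 Z c) :
    ControlledBy 𝓦 (convolved S P 0 Z) (2 * (m * ‖P‖) * c) := by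
  have hmem (r : I) : (0 - (r : ℝ)) ∈ Icc (-1 : ℝ) 1 :=
    ⟨by linarith [r.2.2], by linarith [r.2.1]⟩
  rw [convolved_eq_opMul]
  refine hZ.opMul hα hα2 (fun t => ?_) (fun s t hst => ?_)
  · exact (norm_compL_le _).trans ((ContinuousLinearMap.opNorm_comp_le _ _).trans
      (mul_le_mul_of_nonneg_right (hS.norm_le _ (hmem t)) (norm_nonneg _)))
  · have hst' : (s : ℝ) ≤ t := hst
    have hdist : |0 - (t : ℝ) - (0 - s)| = (t : ℝ) - s := by
      rw [sub_sub_sub_cancel_left, abs_sub_comm, abs_of_nonneg (sub_nonneg.2 hst')]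
    have hlip := hS.norm_sub_le _ (hmem s) _ (hmem t)
    rw [← map_sub, ← ContinuousLinearMap.sub_comp]
    refine (norm_compL_le _).trans ((ContinuousLinearMap.opNorm_comp_le _ _).trans
      ((mul_le_mul_of_nonneg_right hlip (norm_nonneg _)).trans (le_of_eq ?_)))
    rw [hdist]
    ring

lemma IsControlled.convolved (hα : 0 < α) (hα2 : α ≤ 1 / 2) (hS : IsLipschitzGroup S m)
    (P : X →L[ℝ] X) (hZ : IsControlled 𝓦 Z) : IsControlled 𝓦 (convolved S P 0 Z) :=
  ((hZ.controlledBy hα).convolved hα hα2 hS P).isControlled hα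

/-- The convolution `∫_a^b S(c - r) P y_r dr + ∫_a^b S(c - r) P Z_r d𝓦_r` for arbitrary integrands;
`convolution` is the case of the truncated coefficients. -/
def pathConvolution (S : ℝ → X →L[ℝ] X) (P : X →L[ℝ] X) (𝓦 : RoughPath V α) (y : I → X)
    (Z : PathPair V (V →L[ℝ] X)) (a b : I) (c : ℝ) : X :=
  (∫ r in (a : ℝ)..b, S (c - r) (P (IccExtend zero_le_one y r)))
    + roughIntegral 𝓦 (convolved S P c Z) a b

/-- The path `t ↦ ∫_0^t S(-r) P y_r dr + ∫_0^t S(-r) P Z_r d𝓦_r` with its Gubinelli derivative. All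
convolutions are obtained from it, since `S(c - r) = S(c) S(-r)`. -/
def convolutionPair (S : ℝ → X →L[ℝ] X) (P : X →L[ℝ] X) (𝓦 : RoughPath V α) (y : I → X)
    (Z : PathPair V (V →L[ℝ] X)) : PathPair V X :=
  (fun t => pathConvolution S P 𝓦 y Z 0 t 0, (convolved S P 0 Z).1)

variable [FiniteDimensional ℝ V] [CompleteSpace X]

lemma convolutionPair_apply_zero (hα : 1 / 3 < α) (hα2 : α ≤ 1 / 2) (hS : IsLipschitzGroup S m)
    (P : X →L[ℝ] X) (hZ : IsControlled 𝓦 Z) : (convolutionPair S P 𝓦 y Z).1 0 = 0 := by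
  simp [convolutionPair, pathConvolution,
    (hZ.convolved (by linarith) hα2 hS P).roughIntegral_self hα]

lemma IsControlled.isRoughIntegral_convolved (hα : 1 / 3 < α) (hα2 : α ≤ 1 / 2)
    (hS : IsLipschitzGroup S m) (P : X →L[ℝ] X) (hZ : IsControlled 𝓦 Z) {a b : I} (hab : a ≤ b)
    (c : ℝ) : IsRoughIntegral 𝓦 (RoughCenter.convolved S P c Z) a b
      (S c (roughIntegral 𝓦 (RoughCenter.convolved S P 0 Z) a b)) := by
  rw [hS.convolved_eq P c]
  exact ((hZ.convolved (by linarith) hα2 hS P).isRoughIntegral hα hab).map (S c)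

lemma pathConvolution_eq (hα : 1 / 3 < α) (hα2 : α ≤ 1 / 2) (hS : IsLipschitzGroup S m)
    (P : X →L[ℝ] X) (hy : Continuous y) (hZ : IsControlled 𝓦 Z) {a b : I} (hab : a ≤ b) (c : ℝ) :
    pathConvolution S P 𝓦 y Z a b c
      = S c ((convolutionPair S P 𝓦 y Z).1 b - (convolutionPair S P 𝓦 y Z).1 a) := by
  have hrough := (hZ.convolved (by linarith) hα2 hS P).roughIntegral_add_adjacent hα
    (show (0 : I) ≤ a from a.2.1) hab
  have hdrift := intervalIntegral.integral_add_adjacent_intervals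
    (hS.intervalIntegrable_apply P hy 0 a) (hS.intervalIntegrable_apply P hy a b)
  have hshift : (∫ r in (a : ℝ)..b, S (c - r) (P (IccExtend zero_le_one y r)))
      = S c (∫ r in (a : ℝ)..b, S (0 - r) (P (IccExtend zero_le_one y r))) := by
    rw [← ContinuousLinearMap.intervalIntegral_comp_comm _ (hS.intervalIntegrable_apply P hy a b)]
    exact intervalIntegral.integral_congr fun r _ => hS.apply_sub c r _
  simp only [convolutionPair, pathConvolution]
  rw [(hZ.isRoughIntegral_convolved hα hα2 hS P hab c).roughIntegral_eq hab, hrough, hshift,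
    ← hdrift, ← map_add]
  congr 1
  abel

lemma IsInvariantProjection.convolutionPair_apply (hP : IsInvariantProjection S P)
    (hα : 1 / 3 < α) (hα2 : α ≤ 1 / 2) (hS : IsLipschitzGroup S m) (hy : Continuous y)
    (hZ : IsControlled 𝓦 Z) (t : I) :
    P ((convolutionPair S P 𝓦 y Z).1 t) = (convolutionPair S P 𝓦 y Z).1 t := by
  have hrough := (hZ.convolved (by linarith) hα2 hS P).roughIntegral_compL hα P
    (show (0 : I) ≤ t from t.2.1)
  have hdrift :=
    ContinuousLinearMap.intervalIntegral_comp_comm P (hS.intervalIntegrable_apply P hy 0 t)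
  rw [hP.opMul_convolved] at hrough
  simp only [hP.comm, hP.idem] at hdrift
  simp only [convolutionPair, pathConvolution, map_add, ← hrough, ← hdrift]

lemma convolutionPair_sub (hα : 1 / 3 < α) (hα2 : α ≤ 1 / 2) (hS : IsLipschitzGroup S m)
    (P : X →L[ℝ] X) (hy : Continuous y) (hy' : Continuous y') (hZ : IsControlled 𝓦 Z)
    (hZ' : IsControlled 𝓦 Z') :
    convolutionPair S P 𝓦 (y - y') (Z - Z')
      = convolutionPair S P 𝓦 y Z - convolutionPair S P 𝓦 y' Z' := by
  have hα0 : 0 < α := by linarith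
  refine Prod.ext (funext fun t => ?_) (congrArg Prod.fst (convolved_sub S P 0 Z Z'))
  have hrough := (hZ.convolved hα0 hα2 hS P).roughIntegral_sub hα (hZ'.convolved hα0 hα2 hS P)
    (show (0 : I) ≤ t from t.2.1)
  have hdrift := intervalIntegral.integral_sub
    (hS.intervalIntegrable_apply P hy 0 t) (hS.intervalIntegrable_apply P hy' 0 t)
  have hext (r : ℝ) : IccExtend zero_le_one (y - y') r
      = IccExtend zero_le_one y r - IccExtend zero_le_one y' r := rfl
  simp only [convolutionPair, pathConvolution, convolved_sub, hrough, hext, map_sub, hdrift,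
    Prod.fst_sub, Pi.sub_apply]
  abel

theorem controlledBy_convolutionPair (hα : 1 / 3 < α) (hα2 : α ≤ 1 / 2)
    (hS : IsLipschitzGroup S m) (P : X →L[ℝ] X) (hy : Continuous y) (hyc : ∀ t, ‖y t‖ ≤ c)
    (hZ : ControlledBy 𝓦 Z c') :
    ControlledBy 𝓦 (convolutionPair S P 𝓦 y Z)
      (m * ‖P‖ * (c + 2 * integralConst V α * (1 + 𝓦.pathSeminorm + 𝓦.areaSeminorm) * c')) := by
  have hα0 : 0 < α := by linarith
  have hm := hS.nonneg
  have hc : 0 ≤ c := (norm_nonneg _).trans (hyc 0)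
  have hdrift : ControlledBy 𝓦
      ((fun t : I => ∫ r in ((0 : I) : ℝ)..t, S (0 - r) (P (IccExtend zero_le_one y r)), 0) :
        PathPair V X) (m * ‖P‖ * c) := by
    refine controlledBy_of_lipschitz hα0 hα2 (fun t => ?_) (fun s t hst => ?_)
    · refine (hS.norm_integral_apply_le P hyc t.2.1).trans
        (mul_le_of_le_one_right (by positivity) ?_)
      simpa using t.2.2
    · rw [intervalIntegral.integral_interval_sub_left (hS.intervalIntegrable_apply P hy 0 t)
        (hS.intervalIntegrable_apply P hy 0 s)]
      exact hS.norm_integral_apply_le P hyc hst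
  have hrough := (hZ.convolved hα0 hα2 hS P).indefiniteIntegral hα
  convert hdrift.add hrough using 1
  · exact Prod.ext rfl (zero_add _).symm
  · ring

end Convolution

/-! ### Composition with a map that vanishes to third order at the origin -/

section Composition

variable {X : Type*} [NormedAddCommGroup X] [NormedSpace ℝ X]
variable {E : Type*} [NormedAddCommGroup E] [NormedSpace ℝ E]
variable {G : X → E} {M N R Δ : ℝ} {x y x' y' : X}

lemma norm_segment_le (hx : ‖x‖ ≤ R) (hy : ‖y‖ ≤ R) {θ : ℝ} (hθ : θ ∈ Icc (0 : ℝ) 1) :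
    ‖x + θ • (y - x)‖ ≤ R :=
  mem_closedBall_zero_iff.1 ((convex_closedBall (0 : X) R).add_smul_sub_mem
    (mem_closedBall_zero_iff.2 hx) (mem_closedBall_zero_iff.2 hy) hθ)

lemma hasDerivAt_segment (x y : X) (θ : ℝ) :
    HasDerivAt (fun θ : ℝ => x + θ • (y - x)) (y - x) θ := by
  simpa using ((hasDerivAt_id θ).smul_const (y - x)).const_add x

lemma norm_apply_sub_apply_le {A A' : X →L[ℝ] E} {a b : ℝ} (hA : ‖A - A'‖ ≤ a) (hA' : ‖A'‖ ≤ b)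
    (v v' : X) : ‖A v - A' v'‖ ≤ a * ‖v‖ + b * ‖v - v'‖ := by
  have hsplit : A v - A' v' = (A - A') v + A' (v - v') := by
    simp only [sub_apply, map_sub]
    abel
  rw [hsplit]
  exact norm_add_le_of_le (ContinuousLinearMap.le_of_opNorm_le _ hA _)
    (ContinuousLinearMap.le_of_opNorm_le _ hA' _)

lemma norm_segment_increment_sub_le {H : X → E} {H' : X → X →L[ℝ] E}
    (hH : ∀ z, HasFDerivAt H (H' z) z) (hM : 0 ≤ M) (hlip : ∀ z w, ‖H' z - H' w‖ ≤ M * ‖z - w‖)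
    (hN : ∀ z, ‖z‖ ≤ R → ‖H' z‖ ≤ N) (hx' : ‖x'‖ ≤ R) (hy' : ‖y'‖ ≤ R) (hxx : ‖x - x'‖ ≤ Δ)
    (hyy : ‖y - y'‖ ≤ Δ) {θ : ℝ} (hθ : θ ∈ Icc (0 : ℝ) 1) :
    ‖H (x + θ • (y - x)) - H x - (H (x' + θ • (y' - x')) - H x')‖
      ≤ M * Δ * ‖y - x‖ + N * ‖(y - x) - (y' - x')‖ := by
  have hderiv (τ : ℝ) : HasDerivAt (fun τ : ℝ => H (x + τ • (y - x)) - H (x' + τ • (y' - x')))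
      (H' (x + τ • (y - x)) (y - x) - H' (x' + τ • (y' - x')) (y' - x')) τ :=
    ((hH _).comp_hasDerivAt τ (hasDerivAt_segment x y τ)).sub
      ((hH _).comp_hasDerivAt τ (hasDerivAt_segment x' y' τ))
  have hpoint (τ : ℝ) : (x + τ • (y - x)) - (x' + τ • (y' - x'))
      = (x - x') + τ • ((y - y') - (x - x')) := by
    simp only [smul_sub]
    abel
  have hbound (τ : ℝ) (hτ : τ ∈ Icc (0 : ℝ) 1) :
      ‖H' (x + τ • (y - x)) (y - x) - H' (x' + τ • (y' - x')) (y' - x')‖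
        ≤ M * Δ * ‖y - x‖ + N * ‖(y - x) - (y' - x')‖ := by
    refine norm_apply_sub_apply_le ((hlip _ _).trans (mul_le_mul_of_nonneg_left ?_ hM))
      (hN _ (norm_segment_le hx' hy' hτ)) _ _
    rw [hpoint]
    exact norm_segment_le hxx hyy hτ
  have hmean := (convex_Icc (0 : ℝ) 1).norm_image_sub_le_of_norm_hasDerivWithin_le
    (fun τ _ => (hderiv τ).hasDerivWithinAt) hbound (left_mem_Icc.2 zero_le_one) hθ
  simp only [zero_smul, add_zero] at hmean
  rw [sub_sub_sub_comm]
  refine hmean.trans (mul_le_of_le_one_right ((norm_nonneg _).trans (hbound 0 (by simp))) ?_)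
  rw [sub_zero, Real.norm_of_nonneg hθ.1]
  exact hθ.2

/-- `G` vanishes at the origin together with its first two derivatives, and its second derivative
is `M`-Lipschitz. -/
structure IsCubicFlat (G : X → E) (M : ℝ) : Prop where
  contDiff : ContDiff ℝ 2 G
  nonneg : 0 ≤ M
  lipschitz : ∀ x y, ‖fderiv ℝ (fderiv ℝ G) x - fderiv ℝ (fderiv ℝ G) y‖ ≤ M * ‖x - y‖
  zero : G 0 = 0
  fderiv_zero : fderiv ℝ G 0 = 0
  fderiv_fderiv_zero : fderiv ℝ (fderiv ℝ G) 0 = 0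

namespace IsCubicFlat

lemma of_norm_iteratedFDeriv_le (hG : ContDiff ℝ 3 G)
    (hM : ∀ x, ‖iteratedFDeriv ℝ 3 G x‖ ≤ M) (h0 : G 0 = 0) (h1 : fderiv ℝ G 0 = 0)
    (h2 : fderiv ℝ (fderiv ℝ G) 0 = 0) : IsCubicFlat G M where
  contDiff := hG.of_le (by norm_num)
  nonneg := (norm_nonneg _).trans (hM 0)
  lipschitz x y := by
    have hdiff : ContDiff ℝ 1 (fderiv ℝ (fderiv ℝ G)) :=
      (hG.fderiv_right (m := 2) (by norm_num)).fderiv_right (by norm_num)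
    refine convex_univ.norm_image_sub_le_of_norm_fderiv_le
      (fun z _ => hdiff.differentiable (by norm_num) z) (fun z _ => ?_) (mem_univ y) (mem_univ x)
    rw [← norm_iteratedFDeriv_one, norm_iteratedFDeriv_fderiv, norm_iteratedFDeriv_fderiv]
    exact hM z
  zero := h0
  fderiv_zero := h1
  fderiv_fderiv_zero := h2

lemma hasFDerivAt (h : IsCubicFlat G M) (x : X) : HasFDerivAt G (fderiv ℝ G x) x :=
  (h.contDiff.differentiable (by norm_num) x).hasFDerivAt

lemma hasFDerivAt_fderiv (h : IsCubicFlat G M) (x : X) :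
    HasFDerivAt (fderiv ℝ G) (fderiv ℝ (fderiv ℝ G) x) x :=
  ((h.contDiff.fderiv_right (m := 1) (by norm_num)).differentiable (by norm_num) x).hasFDerivAt

lemma norm_fderiv_fderiv_le (h : IsCubicFlat G M) (hx : ‖x‖ ≤ R) :
    ‖fderiv ℝ (fderiv ℝ G) x‖ ≤ M * R := by
  have hlip := h.lipschitz x 0
  rw [h.fderiv_fderiv_zero, sub_zero, sub_zero] at hlip
  exact hlip.trans (mul_le_mul_of_nonneg_left hx h.nonneg)

lemma norm_fderiv_sub_le (h : IsCubicFlat G M) (hx : ‖x‖ ≤ R) (hy : ‖y‖ ≤ R) :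
    ‖fderiv ℝ G x - fderiv ℝ G y‖ ≤ M * R * ‖x - y‖ :=
  (convex_closedBall (0 : X) R).norm_image_sub_le_of_norm_hasFDerivWithin_le
    (fun z _ => (h.hasFDerivAt_fderiv z).hasFDerivWithinAt)
    (fun _ hz => h.norm_fderiv_fderiv_le (mem_closedBall_zero_iff.1 hz))
    (mem_closedBall_zero_iff.2 hy) (mem_closedBall_zero_iff.2 hx)

lemma norm_fderiv_le (h : IsCubicFlat G M) (hx : ‖x‖ ≤ R) : ‖fderiv ℝ G x‖ ≤ M * R ^ 2 := by
  have hM := h.nonneg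
  have hR : 0 ≤ R := (norm_nonneg _).trans hx
  have hlip := h.norm_fderiv_sub_le hx (y := 0) (by rwa [norm_zero])
  rw [h.fderiv_zero, sub_zero, sub_zero] at hlip
  calc ‖fderiv ℝ G x‖ ≤ M * R * ‖x‖ := hlip
    _ ≤ M * R * R := mul_le_mul_of_nonneg_left hx (by positivity)
    _ = M * R ^ 2 := by ring

lemma norm_sub_le (h : IsCubicFlat G M) (hx : ‖x‖ ≤ R) (hy : ‖y‖ ≤ R) :
    ‖G x - G y‖ ≤ M * R ^ 2 * ‖x - y‖ :=
  (convex_closedBall (0 : X) R).norm_image_sub_le_of_norm_hasFDerivWithin_le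
    (fun z _ => (h.hasFDerivAt z).hasFDerivWithinAt)
    (fun _ hz => h.norm_fderiv_le (mem_closedBall_zero_iff.1 hz))
    (mem_closedBall_zero_iff.2 hy) (mem_closedBall_zero_iff.2 hx)

lemma norm_fderiv_segment_increment_sub_le (h : IsCubicFlat G M) (hx' : ‖x'‖ ≤ R)
    (hy' : ‖y'‖ ≤ R) (hxx : ‖x - x'‖ ≤ Δ) (hyy : ‖y - y'‖ ≤ Δ) {θ : ℝ}
    (hθ : θ ∈ Icc (0 : ℝ) 1) :
    ‖fderiv ℝ G (x + θ • (y - x)) - fderiv ℝ G x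
        - (fderiv ℝ G (x' + θ • (y' - x')) - fderiv ℝ G x')‖
      ≤ M * Δ * ‖y - x‖ + M * R * ‖(y - x) - (y' - x')‖ :=
  norm_segment_increment_sub_le h.hasFDerivAt_fderiv h.nonneg h.lipschitz
    (fun _ => h.norm_fderiv_fderiv_le) hx' hy' hxx hyy hθ

lemma norm_fderiv_increment_sub_le (h : IsCubicFlat G M) (hx' : ‖x'‖ ≤ R)
    (hy' : ‖y'‖ ≤ R) (hxx : ‖x - x'‖ ≤ Δ) (hyy : ‖y - y'‖ ≤ Δ) :
    ‖fderiv ℝ G y - fderiv ℝ G x - (fderiv ℝ G y' - fderiv ℝ G x')‖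
      ≤ M * Δ * ‖y - x‖ + M * R * ‖(y - x) - (y' - x')‖ := by
  simpa using h.norm_fderiv_segment_increment_sub_le hx' hy' hxx hyy
    (right_mem_Icc.2 zero_le_one)

lemma norm_taylor_sub_le (h : IsCubicFlat G M) (hx' : ‖x'‖ ≤ R) (hy' : ‖y'‖ ≤ R)
    (hxx : ‖x - x'‖ ≤ Δ) (hyy : ‖y - y'‖ ≤ Δ) :
    ‖G y - G x - fderiv ℝ G x (y - x) - (G y' - G x' - fderiv ℝ G x' (y' - x'))‖
      ≤ (M * Δ * ‖y - x‖ + M * R * ‖(y - x) - (y' - x')‖) * ‖y - x‖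
        + M * R * ‖y' - x'‖ * ‖(y - x) - (y' - x')‖ := by
  have hM := h.nonneg
  have hR : 0 ≤ R := (norm_nonneg _).trans hx'
  have hrem (z w : X) (τ : ℝ) :
      HasDerivAt (fun τ : ℝ => G (z + τ • (w - z)) - τ • fderiv ℝ G z (w - z))
        ((fderiv ℝ G (z + τ • (w - z)) - fderiv ℝ G z) (w - z)) τ := by
    simpa only [one_smul, sub_apply] using!
      ((h.hasFDerivAt _).comp_hasDerivAt τ (hasDerivAt_segment z w τ)).sub
        ((hasDerivAt_id τ).smul_const (fderiv ℝ G z (w - z)))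
  have hbound (τ : ℝ) (hτ : τ ∈ Icc (0 : ℝ) 1) :
      ‖(fderiv ℝ G (x + τ • (y - x)) - fderiv ℝ G x) (y - x)
          - (fderiv ℝ G (x' + τ • (y' - x')) - fderiv ℝ G x') (y' - x')‖
        ≤ (M * Δ * ‖y - x‖ + M * R * ‖(y - x) - (y' - x')‖) * ‖y - x‖
          + M * R * ‖y' - x'‖ * ‖(y - x) - (y' - x')‖ := by
    refine norm_apply_sub_apply_le (h.norm_fderiv_segment_increment_sub_le hx' hy' hxx hyy hτ)
      ((h.norm_fderiv_sub_le (norm_segment_le hx' hy' hτ) hx').trans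
        (mul_le_mul_of_nonneg_left ?_ (by positivity))) _ _
    rw [add_sub_cancel_left, norm_smul, Real.norm_of_nonneg hτ.1]
    exact mul_le_of_le_one_left (norm_nonneg _) hτ.2
  have hmean := (convex_Icc (0 : ℝ) 1).norm_image_sub_le_of_norm_hasDerivWithin_le
    (fun τ _ => ((hrem x y τ).sub (hrem x' y' τ)).hasDerivWithinAt) hbound
    (left_mem_Icc.2 zero_le_one) (right_mem_Icc.2 zero_le_one)
  simp only [Pi.sub_apply, zero_smul, add_zero, one_smul, add_sub_cancel, sub_zero, norm_one,
    mul_one] at hmean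
  refine (le_of_eq (congrArg norm ?_)).trans hmean
  abel

end IsCubicFlat

variable {V : Type*} [NormedAddCommGroup V] [InnerProductSpace ℝ V] {α : ℝ} {𝓦 : RoughPath V α}
variable {Y Y' : PathPair V X}

/-- The composition `G(Y)`, with Gubinelli derivative `DG(Y) Y'`. -/
def compose (G : X → E) (Y : PathPair V X) : PathPair V E :=
  (fun t => G (Y.1 t), fun t => (fderiv ℝ G (Y.1 t)).comp (Y.2 t))

lemma compose_zero (h : G 0 = 0) : compose G (0 : PathPair V X) = 0 := by
  ext <;> simp [compose, h]

lemma norm_comp_sub_comp_le {A A' : X →L[ℝ] E} {T T' : V →L[ℝ] X} {a a' b b' : ℝ}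
    (hA : ‖A - A'‖ ≤ a) (hT : ‖T‖ ≤ b) (hA' : ‖A'‖ ≤ a') (hT' : ‖T - T'‖ ≤ b') :
    ‖A.comp T - A'.comp T'‖ ≤ a * b + a' * b' := by
  have hsplit : A.comp T - A'.comp T' = (A - A').comp T + A'.comp (T - T') := by
    rw [ContinuousLinearMap.sub_comp, ContinuousLinearMap.comp_sub]
    abel
  rw [hsplit]
  exact norm_add_le_of_le
    ((ContinuousLinearMap.opNorm_comp_le _ _).trans
      (mul_le_mul hA hT (norm_nonneg _) ((norm_nonneg _).trans hA)))
    ((ContinuousLinearMap.opNorm_comp_le _ _).trans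
      (mul_le_mul hA' hT' (norm_nonneg _) ((norm_nonneg _).trans hA')))

lemma ControlledBy.norm_incr_sub_incr_le (hα : 0 < α) (hΔ : ControlledBy 𝓦 (Y - Y') Δ)
    {s t : I} (hst : s ≤ t) : ‖(Y.1 t - Y.1 s) - (Y'.1 t - Y'.1 s)‖
      ≤ Δ * (1 + 𝓦.pathSeminorm) * ((t : ℝ) - s) ^ α := by
  rw [sub_sub_sub_comm]
  exact hΔ.norm_incr_le hα hst

namespace IsCubicFlat

lemma norm_compose_deriv_incr_sub_le (h : IsCubicFlat G M) (hα : 0 < α)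
    (hY : ControlledBy 𝓦 Y R) (hY' : ControlledBy 𝓦 Y' R) (hΔ : ControlledBy 𝓦 (Y - Y') Δ)
    {s t : I} (hst : s ≤ t) :
    ‖(compose G Y - compose G Y').2 t - (compose G Y - compose G Y').2 s‖
      ≤ M * R ^ 2 * Δ * (3 * (1 + 𝓦.pathSeminorm) + 2) * ((t : ℝ) - s) ^ α := by
  have hM := h.nonneg
  have hR := hY.nonneg
  have hΔ0 := hΔ.nonneg
  have hincr := hY.norm_incr_le hα hst
  have hincr' := hY'.norm_incr_le hα hst
  have hincrΔ := hΔ.norm_incr_sub_incr_le hα hst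
  have hderivΔ : ‖(Y.2 t - Y.2 s) - (Y'.2 t - Y'.2 s)‖ ≤ Δ * ((t : ℝ) - s) ^ α := by
    rw [sub_sub_sub_comm]
    exact hΔ.deriv_incr s t hst
  set τ := ((t : ℝ) - s) ^ α
  set b := 1 + 𝓦.pathSeminorm
  have hsplit : (compose G Y - compose G Y').2 t - (compose G Y - compose G Y').2 s
      = ((fderiv ℝ G (Y.1 t) - fderiv ℝ G (Y.1 s)).comp (Y.2 t)
          - (fderiv ℝ G (Y'.1 t) - fderiv ℝ G (Y'.1 s)).comp (Y'.2 t))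
        + ((fderiv ℝ G (Y.1 s)).comp (Y.2 t - Y.2 s)
          - (fderiv ℝ G (Y'.1 s)).comp (Y'.2 t - Y'.2 s)) := by
    ext v
    simp [compose]
    abel
  have hcoef := (h.norm_fderiv_increment_sub_le (hY'.sup s) (hY'.sup t) (hΔ.sup s)
    (hΔ.sup t)).trans (add_le_add (mul_le_mul_of_nonneg_left hincr (by positivity))
      (mul_le_mul_of_nonneg_left hincrΔ (by positivity)))
  have hfirst := norm_comp_sub_comp_le hcoef (hY.deriv_sup t)
    ((h.norm_fderiv_sub_le (hY'.sup t) (hY'.sup s)).trans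
      (mul_le_mul_of_nonneg_left hincr' (by positivity))) (hΔ.deriv_sup t)
  have hsecond := norm_comp_sub_comp_le
    ((h.norm_fderiv_sub_le (hY.sup s) (hY'.sup s)).trans
      (mul_le_mul_of_nonneg_left (hΔ.sup s) (by positivity))) (hY.deriv_incr s t hst)
    (h.norm_fderiv_le (hY'.sup s)) hderivΔ
  rw [hsplit]
  exact (norm_add_le_of_le hfirst hsecond).trans (le_of_eq (by ring))

lemma norm_remainder_compose_sub_le (h : IsCubicFlat G M) (hα : 0 < α)
    (hY : ControlledBy 𝓦 Y R) (hY' : ControlledBy 𝓦 Y' R) (hΔ : ControlledBy 𝓦 (Y - Y') Δ)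
    {s t : I} (hst : s ≤ t) :
    ‖remainder 𝓦 (compose G Y - compose G Y') s t‖
      ≤ M * R ^ 2 * Δ * (3 * (1 + 𝓦.pathSeminorm) ^ 2 + 2) * ((t : ℝ) - s) ^ (2 * α) := by
  have hM := h.nonneg
  have hR := hY.nonneg
  have hΔ0 := hΔ.nonneg
  have ha := 𝓦.pathSeminorm_nonneg
  have hτ := sub_rpow_nonneg hst α
  have hpow : ((t : ℝ) - s) ^ (2 * α) = ((t : ℝ) - s) ^ α * ((t : ℝ) - s) ^ α := by
    rw [two_mul, Real.rpow_add_of_nonneg (sub_nonneg.2 (show (s : ℝ) ≤ t from hst)) hα.le hα.le]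
  have hincr := hY.norm_incr_le hα hst
  have hincr' := hY'.norm_incr_le hα hst
  have hincrΔ := hΔ.norm_incr_sub_incr_le hα hst
  have hsplit : remainder 𝓦 (compose G Y - compose G Y') s t
      = (G (Y.1 t) - G (Y.1 s) - fderiv ℝ G (Y.1 s) (Y.1 t - Y.1 s)
          - (G (Y'.1 t) - G (Y'.1 s) - fderiv ℝ G (Y'.1 s) (Y'.1 t - Y'.1 s)))
        + ((fderiv ℝ G (Y.1 s) - fderiv ℝ G (Y'.1 s)) (remainder 𝓦 Y s t)
          + fderiv ℝ G (Y'.1 s) (remainder 𝓦 (Y - Y') s t)) := by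
    simp only [remainder, compose, Prod.fst_sub, Prod.snd_sub, Pi.sub_apply, map_sub,
      sub_apply, ContinuousLinearMap.comp_apply]
    abel
  have htaylor := h.norm_taylor_sub_le (hY'.sup s) (hY'.sup t) (hΔ.sup s) (hΔ.sup t)
  have hfirst := (fderiv ℝ G (Y.1 s) - fderiv ℝ G (Y'.1 s)).le_of_opNorm_le_of_le
    ((h.norm_fderiv_sub_le (hY.sup s) (hY'.sup s)).trans
      (mul_le_mul_of_nonneg_left (hΔ.sup s) (by positivity))) (hY.remainder s t hst)
  have hsecond := (fderiv ℝ G (Y'.1 s)).le_of_opNorm_le_of_le (h.norm_fderiv_le (hY'.sup s))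
    (hΔ.remainder s t hst)
  rw [hpow] at hfirst hsecond ⊢
  set τ := ((t : ℝ) - s) ^ α
  set b := 1 + 𝓦.pathSeminorm
  have htaylor' := htaylor.trans (show _ ≤ (M * Δ * (R * b * τ) + M * R * (Δ * b * τ)) * (R * b * τ)
    + M * R * (R * b * τ) * (Δ * b * τ) by gcongr)
  rw [hsplit]
  exact (norm_add_le_of_le htaylor' (norm_add_le_of_le hfirst hsecond)).trans
    (le_of_eq (by ring))

theorem controlledBy_compose_sub (h : IsCubicFlat G M) (hα : 0 < α)
    (hY : ControlledBy 𝓦 Y R) (hY' : ControlledBy 𝓦 Y' R) (hΔ : ControlledBy 𝓦 (Y - Y') Δ) :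
    ControlledBy 𝓦 (compose G Y - compose G Y')
      (5 * M * R ^ 2 * (1 + 𝓦.pathSeminorm) ^ 2 * Δ) := by
  have hM := h.nonneg
  have hR := hY.nonneg
  have hΔ0 := hΔ.nonneg
  have hb : 1 ≤ 1 + 𝓦.pathSeminorm := le_add_of_nonneg_right 𝓦.pathSeminorm_nonneg
  have hb2 : 1 + 𝓦.pathSeminorm ≤ (1 + 𝓦.pathSeminorm) ^ 2 := le_self_pow₀ hb two_ne_zero
  have hscale (k : ℝ) (hk : k ≤ 5 * (1 + 𝓦.pathSeminorm) ^ 2) :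
      M * R ^ 2 * Δ * k ≤ 5 * M * R ^ 2 * (1 + 𝓦.pathSeminorm) ^ 2 * Δ :=
    (mul_le_mul_of_nonneg_left hk (by positivity)).trans (le_of_eq (by ring))
  refine ⟨fun t => ?_, fun t => ?_,
    fun s t hst => (h.norm_compose_deriv_incr_sub_le hα hY hY' hΔ hst).trans
      (mul_le_mul_of_nonneg_right (hscale _ (by linarith)) (sub_rpow_nonneg hst _)),
    fun s t hst => (h.norm_remainder_compose_sub_le hα hY hY' hΔ hst).trans
      (mul_le_mul_of_nonneg_right (hscale _ (by linarith)) (sub_rpow_nonneg hst _))⟩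
  · calc ‖G (Y.1 t) - G (Y'.1 t)‖ ≤ M * R ^ 2 * Δ :=
          (h.norm_sub_le (hY.sup t) (hY'.sup t)).trans
            (mul_le_mul_of_nonneg_left (hΔ.sup t) (by positivity))
      _ = M * R ^ 2 * Δ * 1 := (mul_one _).symm
      _ ≤ _ := hscale 1 (by linarith)
  · calc ‖(compose G Y - compose G Y').2 t‖ ≤ M * R * Δ * R + M * R ^ 2 * Δ :=
          norm_comp_sub_comp_le ((h.norm_fderiv_sub_le (hY.sup t) (hY'.sup t)).trans
              (mul_le_mul_of_nonneg_left (hΔ.sup t) (by positivity))) (hY.deriv_sup t)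
            (h.norm_fderiv_le (hY'.sup t)) (hΔ.deriv_sup t)
      _ = M * R ^ 2 * Δ * 2 := by ring
      _ ≤ _ := hscale 2 (by linarith)

end IsCubicFlat

end Composition

/-! ### The cut-off -/

/-- A cut-off function with values in `[0,1]` that vanishes on `[1,∞)`, of Lipschitz constant `L`;
only its restriction to `[0,∞)` matters. -/
structure IsLipschitzCutoff (f : ℝ → ℝ) (L : NNReal) : Prop where
  lipschitz : LipschitzOnWith L f (Ici 0)
  mem_Icc : ∀ x, 0 ≤ x → f x ∈ Icc (0 : ℝ) 1
  eq_zero : ∀ x, 1 ≤ x → f x = 0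

lemma IsCutoff.exists_isLipschitzCutoff {f : ℝ → ℝ} (hf : IsCutoff f) :
    ∃ L, IsLipschitzCutoff f L := by
  obtain ⟨L, hL⟩ := (hf.smooth.mono Icc_subset_Ici_self).exists_lipschitzOnWith (by norm_num)
    (convex_Icc 0 1) isCompact_Icc
  have hmin (x : ℝ) : f (min x 1) = f x := by
    rcases le_total x 1 with hx | hx
    · rw [min_eq_left hx]
    · rw [min_eq_right hx, hf.eq_zero 1 le_rfl, hf.eq_zero x hx]
  refine ⟨L, ⟨LipschitzOnWith.of_dist_le_mul fun x hx y hy => ?_, hf.mem_Icc, hf.eq_zero⟩⟩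
  rw [← hmin x, ← hmin y]
  refine (hL.dist_le_mul _ ⟨le_min hx zero_le_one, min_le_right _ _⟩ _
    ⟨le_min hy zero_le_one, min_le_right _ _⟩).trans (mul_le_mul_of_nonneg_left ?_ L.2)
  simpa only [NNReal.coe_one, one_mul, id_eq] using (LipschitzWith.id.min_const 1).dist_le_mul x y

namespace IsLipschitzCutoff

variable {f : ℝ → ℝ} {L : NNReal} {r a b : ℝ}

lemma apply_div_mul_le (hf : IsLipschitzCutoff f L) (hr : 0 < r) (ha : 0 ≤ a) :
    f (a / r) * a ≤ f (a / r) * r := by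
  rcases le_total a r with h | h
  · exact mul_le_mul_of_nonneg_left h (hf.mem_Icc _ (by positivity)).1
  · rw [hf.eq_zero _ ((one_le_div hr).2 h), zero_mul, zero_mul]

lemma abs_apply_div_sub_mul_le (hf : IsLipschitzCutoff f L) (hr : 0 < r) (ha : 0 ≤ a)
    (hb : 0 ≤ b) : |f (a / r) - f (b / r)| * r ≤ L * |a - b| := by
  have h := hf.lipschitz.dist_le_mul (a / r) (div_nonneg ha hr.le) (b / r) (div_nonneg hb hr.le)
  rw [Real.dist_eq, Real.dist_eq, ← sub_div, abs_div, abs_of_pos hr] at h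
  refine (mul_le_mul_of_nonneg_right h hr.le).trans_eq ?_
  field_simp

variable {V : Type*} [NormedAddCommGroup V] [InnerProductSpace ℝ V] {α : ℝ} {𝓦 : RoughPath V α}
variable {X : Type*} [NormedAddCommGroup X] [NormedSpace ℝ X] {Y Y' : PathPair V X}

lemma controlledBy_truncate (hf : IsLipschitzCutoff f L) (hr : 0 < r) (hα : 0 < α)
    (hY : IsControlled 𝓦 Y) : ControlledBy 𝓦 (truncate f r 𝓦 Y) r := by
  have hN := controlledNorm_nonneg 𝓦 Y
  have hm := hf.mem_Icc _ (div_nonneg hN hr.le)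
  refine ((hY.controlledBy hα).smul (f (controlledNorm 𝓦 Y / r))).mono ?_
  rw [abs_of_nonneg hm.1]
  exact (hf.apply_div_mul_le hr hN).trans (mul_le_of_le_one_left hr.le hm.2)

-- The Lipschitz constant of the truncation does not depend on the radius: the factor `r⁻¹` in the
-- derivative of `x ↦ f (x / r)` is compensated by the size `r` of the truncated path.
lemma controlledBy_truncate_sub (hf : IsLipschitzCutoff f L) (hr : 0 < r) (hα : 0 < α)
    (hY : IsControlled 𝓦 Y) (hY' : IsControlled 𝓦 Y') :
    ControlledBy 𝓦 (truncate f r 𝓦 Y - truncate f r 𝓦 Y')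
      ((1 + L) * controlledNorm 𝓦 (Y - Y')) := by
  have hN := controlledNorm_nonneg 𝓦 Y
  have hN' := controlledNorm_nonneg 𝓦 Y'
  have hΔ := controlledNorm_nonneg 𝓦 (Y - Y')
  have hm := hf.mem_Icc _ (div_nonneg hN hr.le)
  have hlip := (hf.abs_apply_div_sub_mul_le hr hN hN').trans
    (mul_le_mul_of_nonneg_left (hY.abs_controlledNorm_sub_le hY' hα) L.2)
  have hcut := hf.apply_div_mul_le hr hN
  change ControlledBy 𝓦 (f (controlledNorm 𝓦 Y / r) • Y - f (controlledNorm 𝓦 Y' / r) • Y') _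
  set p := f (controlledNorm 𝓦 Y / r)
  set q := f (controlledNorm 𝓦 Y' / r)
  rcases le_total (controlledNorm 𝓦 Y') r with hle | hge
  · have hsplit : p • Y - q • Y' = p • (Y - Y') + (p - q) • Y' := by module
    rw [hsplit]
    refine ((((hY.sub hY' hα).controlledBy hα).smul p).add
      ((hY'.controlledBy hα).smul (p - q))).mono ?_
    rw [abs_of_nonneg hm.1, add_mul, one_mul]
    exact add_le_add (mul_le_of_le_one_left hΔ hm.2)
      ((mul_le_mul_of_nonneg_left hle (abs_nonneg _)).trans hlip)
  · have hq : q = 0 := hf.eq_zero _ ((one_le_div hr).2 hge)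
    rw [hq, zero_smul, sub_zero]
    rw [hq, sub_zero, abs_of_nonneg hm.1] at hlip
    refine ((hY.controlledBy hα).smul p).mono ?_
    rw [abs_of_nonneg hm.1]
    linarith

end IsLipschitzCutoff

/-! ### The cut-off radius -/

section Radius

variable {V : Type*} [NormedAddCommGroup V] [InnerProductSpace ℝ V] {α : ℝ}
variable {K C₀ C₁ C₂ : ℝ}

lemma cutoffRadius_pos (hK : 0 < K) (h1 : 0 < C₁) (h2 : 0 ≤ C₂) (𝓦 : RoughPath V α) :
    0 < cutoffRadius C₁ C₂ K 𝓦 := by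
  have ha := 𝓦.pathSeminorm_nonneg
  have hb := 𝓦.areaSeminorm_nonneg
  unfold cutoffRadius
  positivity

lemma cutoffRadius_mul_le (hK : 0 ≤ K) (h0 : 0 < C₀) (h1 : C₀ ≤ C₁) (h2 : C₀ ≤ C₂)
    (𝓦 : RoughPath V α) : cutoffRadius C₁ C₂ K 𝓦
      * (1 + (1 + 𝓦.pathSeminorm) * (𝓦.pathSeminorm + 𝓦.areaSeminorm)) ≤ K / C₀ := by
  have ha := 𝓦.pathSeminorm_nonneg
  have hb := 𝓦.areaSeminorm_nonneg
  have hx : 0 ≤ (1 + 𝓦.pathSeminorm) * (𝓦.pathSeminorm + 𝓦.areaSeminorm) := by positivity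
  unfold cutoffRadius
  set x := (1 + 𝓦.pathSeminorm) * (𝓦.pathSeminorm + 𝓦.areaSeminorm)
  have hden : C₀ * (1 + x) ≤ C₁ + C₂ * x := by
    linarith [mul_le_mul_of_nonneg_right h2 hx]
  calc min (K / (C₁ + C₂ * x)) 1 * (1 + x) ≤ K / (C₀ * (1 + x)) * (1 + x) := by
        gcongr
        exact (min_le_left _ _).trans (div_le_div_of_nonneg_left hK (by positivity) hden)
    _ = K / C₀ := by field_simp

lemma cutoffRadius_le (hK : 0 < K) (h0 : 0 < C₀) (h1 : C₀ ≤ C₁) (h2 : C₀ ≤ C₂)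
    (𝓦 : RoughPath V α) : cutoffRadius C₁ C₂ K 𝓦 ≤ K / C₀ := by
  have ha := 𝓦.pathSeminorm_nonneg
  have hb := 𝓦.areaSeminorm_nonneg
  have hr := cutoffRadius_pos hK (h0.trans_le h1) (h0.le.trans h2) 𝓦
  refine (le_mul_of_one_le_right hr.le ?_).trans (cutoffRadius_mul_le hK.le h0 h1 h2 𝓦)
  exact le_add_of_nonneg_right (by positivity)

lemma cutoffRadius_sq_mul_le (hK : 0 < K) (h0 : 0 < C₀) (hK0 : K ≤ C₀) (h1 : C₀ ≤ C₁)
    (h2 : C₀ ≤ C₂) (𝓦 : RoughPath V α) :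
    (1 + 𝓦.pathSeminorm + 𝓦.areaSeminorm)
      * (cutoffRadius C₁ C₂ K 𝓦 ^ 2 * (1 + 𝓦.pathSeminorm) ^ 2) ≤ 2 * (K / C₀) := by
  have ha := 𝓦.pathSeminorm_nonneg
  have hb := 𝓦.areaSeminorm_nonneg
  have hr := (cutoffRadius_pos hK (h0.trans_le h1) (h0.le.trans h2) 𝓦).le
  have h := cutoffRadius_mul_le hK.le h0 h1 h2 𝓦
  set r := cutoffRadius C₁ C₂ K 𝓦
  set a := 𝓦.pathSeminorm
  set b := 𝓦.areaSeminorm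
  have hab : 0 ≤ a * b := by positivity
  have hpath : r * (1 + a) ≤ 1 := by
    refine (mul_le_mul_of_nonneg_left ?_ hr).trans (h.trans ((div_le_one h0).2 hK0))
    nlinarith
  have harea : r * (1 + a) * (1 + a + b) ≤ 2 * (K / C₀) := by
    have hsum : (1 + a) * (1 + a + b) ≤ 2 * (1 + (1 + a) * (a + b)) := by nlinarith
    linarith [mul_le_mul_of_nonneg_left hsum hr]
  calc (1 + a + b) * (r ^ 2 * (1 + a) ^ 2) = (r * (1 + a)) * (r * (1 + a) * (1 + a + b)) := by ring
    _ ≤ r * (1 + a) * (1 + a + b) := mul_le_of_le_one_left (by positivity) hpath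
    _ ≤ _ := harea

end Radius

/-! ### The drift near the origin -/

section Drift

variable {X : Type*} [NormedAddCommGroup X] [NormedSpace ℝ X]
variable {E : Type*} [NormedAddCommGroup E] [NormedSpace ℝ E] {F : X → E}

lemma exists_scale_of_lipschitz_fderiv {L : NNReal} (hL : LipschitzWith L (fderiv ℝ F))
    (h0 : fderiv ℝ F 0 = 0) {ν b : ℝ} (hν : 0 < ν) (hb : 0 < b) :
    ∃ C, b ≤ C ∧ ∀ K x, ‖x‖ ≤ K / C → ‖fderiv ℝ F x‖ ≤ ν * K := by
  have hpos : 0 < max b (L / ν) := lt_max_of_lt_left hb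
  refine ⟨max b (L / ν), le_max_left _ _, fun K x hx => ?_⟩
  have hLν : (L : ℝ) ≤ ν * max b (L / ν) := (div_le_iff₀' hν).1 (le_max_right _ _)
  calc ‖fderiv ℝ F x‖ ≤ L * ‖x‖ := by simpa [h0] using hL.norm_sub_le x 0
    _ ≤ ν * max b (L / ν) * (K / max b (L / ν)) :=
        mul_le_mul hLν hx (norm_nonneg _) (mul_nonneg hν.le hpos.le)
    _ = ν * K := by rw [mul_assoc, mul_div_cancel₀ _ hpos.ne']

lemma exists_scale_of_continuous_fderiv (hF : Continuous (fderiv ℝ F)) (h0 : fderiv ℝ F 0 = 0)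
    {ν K : ℝ} (hν : 0 < ν) (hK : 0 < K) (b : ℝ) :
    ∃ C, b ≤ C ∧ ∀ x, ‖x‖ ≤ K / C → ‖fderiv ℝ F x‖ ≤ ν * K := by
  obtain ⟨δ, hδ, h⟩ := Metric.continuousAt_iff.1 hF.continuousAt (ν * K) (by positivity)
  have hpos : 0 < max b (2 * K / δ) := lt_max_of_lt_right (by positivity)
  refine ⟨max b (2 * K / δ), le_max_left _ _, fun x hx => ?_⟩
  have hC : K / max b (2 * K / δ) ≤ δ / 2 := by
    rw [div_le_iff₀ hpos]
    linarith [(div_le_iff₀' hδ).1 (le_max_right b (2 * K / δ))]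
  have := h (x := x) (by rw [dist_zero_right]; linarith)
  rw [h0, dist_zero_right] at this
  exact this.le

lemma lipschitzOnWith_closedBall_of_norm_fderiv_le (hF : Differentiable ℝ F) {ρ ω : ℝ}
    (h : ∀ x, ‖x‖ ≤ ρ → ‖fderiv ℝ F x‖ ≤ ω) :
    LipschitzOnWith ω.toNNReal F (Metric.closedBall 0 ρ) :=
  (convex_closedBall (0 : X) ρ).lipschitzOnWith_of_nnnorm_fderiv_le (fun x _ => hF x)
    fun x hx => NNReal.le_toNNReal_of_coe_le (h x (mem_closedBall_zero_iff.1 hx))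

lemma exists_lipschitz_scale (hF : ContDiff ℝ 1 F) (h0 : fderiv ℝ F 0 = 0) {ν b : ℝ}
    (hν : 0 < ν) (hb : 0 < b) :
    ∃ C₀ : ℝ → ℝ, (∀ K, b ≤ C₀ K) ∧
      ((∃ L, LipschitzWith L (fderiv ℝ F)) → ∀ K K', C₀ K = C₀ K') ∧
      ∀ K, 0 < K → LipschitzOnWith (ν * K).toNNReal F (Metric.closedBall 0 (K / C₀ K)) := by
  have hd : Differentiable ℝ F := hF.differentiable one_ne_zero
  by_cases hL : ∃ L, LipschitzWith L (fderiv ℝ F)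
  · obtain ⟨L, hL⟩ := hL
    obtain ⟨C, hbC, hC⟩ := exists_scale_of_lipschitz_fderiv hL h0 hν hb
    exact ⟨fun _ => C, fun _ => hbC, fun _ _ _ => rfl,
      fun K _ => lipschitzOnWith_closedBall_of_norm_fderiv_le hd (hC K)⟩
  · have hex (K : ℝ) :
        ∃ C, b ≤ C ∧ (0 < K → ∀ x, ‖x‖ ≤ K / C → ‖fderiv ℝ F x‖ ≤ ν * K) := by
      rcases le_or_gt K 0 with hK | hK
      · exact ⟨b, le_rfl, fun h => absurd h hK.not_gt⟩
      · obtain ⟨C, hbC, hC⟩ := exists_scale_of_continuous_fderiv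
          (hF.continuous_fderiv one_ne_zero) h0 hν hK b
        exact ⟨C, hbC, fun _ => hC⟩
    choose C₀ hbC hC using hex
    exact ⟨C₀, hbC, fun h => absurd h hL,
      fun K hK => lipschitzOnWith_closedBall_of_norm_fderiv_le hd (hC K hK)⟩

end Drift

/-! ### The local convolution operators -/

section Local

variable {V : Type*} [NormedAddCommGroup V] [InnerProductSpace ℝ V] {α : ℝ}
variable {X : Type*} [NormedAddCommGroup X] [NormedSpace ℝ X]
variable {S : ℝ → X →L[ℝ] X} {m : ℝ} {P : X →L[ℝ] X} {𝓦 : RoughPath V α}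
variable {F : X → X} {G : X → V →L[ℝ] X}
variable {f : ℝ → ℝ} {r M : ℝ} {L ω : NNReal} {Y Y' : PathPair V X}

/-- The convolution `∫_0^t S(-r) P F_R(Y)(r) dr + ∫_0^t S(-r) P G_R(Y)(r) d𝓦_r` of the truncated
coefficients along `Y`, as a controlled rough path. -/
def localPair (S : ℝ → X →L[ℝ] X) (F : X → X) (G : X → V →L[ℝ] X) (f : ℝ → ℝ) (r : ℝ)
    (P : X →L[ℝ] X) (𝓦 : RoughPath V α) (Y : PathPair V X) : PathPair V X :=
  convolutionPair S P 𝓦 (truncDrift F f r 𝓦 Y) (truncDiffusion G f r 𝓦 Y)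

lemma truncate_zero : truncate f r 𝓦 (0 : PathPair V X) = 0 := by
  ext <;> simp [truncate]

lemma truncDiffusion_zero (hG : G 0 = 0) : truncDiffusion G f r 𝓦 (0 : PathPair V X) = 0 := by
  change compose G (truncate f r 𝓦 0) = 0
  rw [truncate_zero, compose_zero hG]

lemma isControlled_zero : IsControlled 𝓦 (0 : PathPair V X) :=
  ⟨⟨0, by simp [incr]⟩, ⟨0, by simp [incr]⟩, ⟨0, by simp [remainder]⟩⟩

lemma continuous_truncDrift (hF : LipschitzOnWith ω F (Metric.closedBall 0 r))
    (hf : IsLipschitzCutoff f L) (hr : 0 < r) (hα : 0 < α) (hY : IsControlled 𝓦 Y) :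
    Continuous (truncDrift F f r 𝓦 Y) := by
  have h := hf.controlledBy_truncate hr hα hY
  exact hF.continuousOn.comp_continuous ((h.isControlled hα).holder.continuous hα)
    fun t => mem_closedBall_zero_iff.2 (h.sup t)

lemma controlledBy_truncDiffusion_sub (hG : IsCubicFlat G M) (hf : IsLipschitzCutoff f L)
    (hr : 0 < r) (hα : 0 < α) (hY : IsControlled 𝓦 Y) (hY' : IsControlled 𝓦 Y') :
    ControlledBy 𝓦 (truncDiffusion G f r 𝓦 Y - truncDiffusion G f r 𝓦 Y')
      (5 * M * r ^ 2 * (1 + 𝓦.pathSeminorm) ^ 2 * ((1 + L) * controlledNorm 𝓦 (Y - Y'))) :=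
  hG.controlledBy_compose_sub hα (hf.controlledBy_truncate hr hα hY)
    (hf.controlledBy_truncate hr hα hY') (hf.controlledBy_truncate_sub hr hα hY hY')

lemma isControlled_truncDiffusion (hG : IsCubicFlat G M) (hf : IsLipschitzCutoff f L)
    (hr : 0 < r) (hα : 0 < α) (hY : IsControlled 𝓦 Y) :
    IsControlled 𝓦 (truncDiffusion G f r 𝓦 Y) := by
  have h := controlledBy_truncDiffusion_sub hG hf hr hα hY isControlled_zero
  rw [truncDiffusion_zero hG.zero, sub_zero] at h
  exact h.isControlled hα

variable [FiniteDimensional ℝ V] [CompleteSpace X]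

theorem controlledBy_localPair_sub (hα : 1 / 3 < α) (hα2 : α ≤ 1 / 2) (hS : IsLipschitzGroup S m)
    (P : X →L[ℝ] X) (hF : LipschitzOnWith ω F (Metric.closedBall 0 r)) (hG : IsCubicFlat G M)
    (hf : IsLipschitzCutoff f L) (hr : 0 < r) (hY : IsControlled 𝓦 Y) (hY' : IsControlled 𝓦 Y') :
    ControlledBy 𝓦 (localPair S F G f r P 𝓦 Y - localPair S F G f r P 𝓦 Y')
      (m * ‖P‖ * (1 + L) * (ω + 10 * M * integralConst V α
          * ((1 + 𝓦.pathSeminorm + 𝓦.areaSeminorm) * (r ^ 2 * (1 + 𝓦.pathSeminorm) ^ 2)))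
        * controlledNorm 𝓦 (Y - Y')) := by
  have hα0 : 0 < α := by linarith
  have hy := continuous_truncDrift hF hf hr hα0 hY
  have hy' := continuous_truncDrift hF hf hr hα0 hY'
  have hd := hf.controlledBy_truncate_sub hr hα0 hY hY'
  have hdrift (t : I) : ‖(truncDrift F f r 𝓦 Y - truncDrift F f r 𝓦 Y') t‖
      ≤ ω * ((1 + L) * controlledNorm 𝓦 (Y - Y')) :=
    (hF.norm_sub_le (mem_closedBall_zero_iff.2 ((hf.controlledBy_truncate hr hα0 hY).sup t))
      (mem_closedBall_zero_iff.2 ((hf.controlledBy_truncate hr hα0 hY').sup t))).trans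
      (mul_le_mul_of_nonneg_left (hd.sup t) ω.2)
  rw [localPair, localPair, ← convolutionPair_sub hα hα2 hS P hy hy'
    (isControlled_truncDiffusion hG hf hr hα0 hY) (isControlled_truncDiffusion hG hf hr hα0 hY')]
  convert controlledBy_convolutionPair hα hα2 hS P (hy.sub hy') hdrift
    (controlledBy_truncDiffusion_sub hG hf hr hα0 hY hY') using 1
  ring

lemma localPair_zero_right (hα : 1 / 3 < α) (hα2 : α ≤ 1 / 2) (hS : IsLipschitzGroup S m)
    (P : X →L[ℝ] X) (hF0 : F 0 = 0) (hG0 : G 0 = 0) :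
    localPair S F G f r P 𝓦 (0 : PathPair V X) = 0 := by
  have hdrift : truncDrift F f r 𝓦 (0 : PathPair V X) = 0 := by
    ext t; simp [truncDrift, truncate_zero, hF0]
  rw [localPair, hdrift, truncDiffusion_zero hG0]
  simpa only [sub_self] using convolutionPair_sub (𝓦 := 𝓦) hα hα2 hS P continuous_zero
    continuous_zero isControlled_zero isControlled_zero

end Local

/-! ### The space of weighted sequences -/

section SequenceSpace

variable {V : Type*} [NormedAddCommGroup V] [InnerProductSpace ℝ V] {α : ℝ}
variable {X : Type*} [NormedAddCommGroup X] [NormedSpace ℝ X]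
variable {η : ℝ} {𝓦 : RoughPath V α} {U U' : Seq V X} {c c' : ℝ}

/-- The weight `e^{η(i-1)}` at `i = -m`. -/
def weight (η : ℝ) (m : ℕ) : ℝ := Real.exp (η * (-(m : ℝ) - 1))

lemma weight_pos (η : ℝ) (m : ℕ) : 0 < weight η m := Real.exp_pos _

lemma exp_neg_mul_weight (η : ℝ) (m : ℕ) : Real.exp (-η * (-(m : ℝ) - 1)) * weight η m = 1 := by
  rw [weight, ← Real.exp_add]
  simp

lemma exp_neg_mul_le_iff {x : ℝ} (m : ℕ) :
    Real.exp (-η * (-(m : ℝ) - 1)) * x ≤ c ↔ x ≤ c * weight η m := by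
  rw [eq_inv_of_mul_eq_one_left (exp_neg_mul_weight η m), inv_mul_le_iff₀ (weight_pos η m),
    mul_comm]

lemma nonneg_of_norm_le_mul_weight {E : Type*} [SeminormedAddCommGroup E] {u : ℕ → E}
    (hu : ∀ j, ‖u j‖ ≤ c * weight η j) : 0 ≤ c :=
  nonneg_of_mul_nonneg_left ((norm_nonneg _).trans (hu 0)) (weight_pos η 0)

/-- Every entry `U m` is controlled, with bound `c` relative to the weight. Up to a factor `4`, the
least such `c` is the norm of `U` in `BC^η`. -/
def SeqControlledBy (η : ℝ) (𝓦 : RoughPath V α) (U : Seq V X) (c : ℝ) : Prop :=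
  ∀ m, ControlledBy (fibre 𝓦 m) (U m) (c * weight η m)

lemma bcNorm_nonneg (η : ℝ) (𝓦 : RoughPath V α) (U : Seq V X) : 0 ≤ bcNorm η 𝓦 U :=
  Real.iSup_nonneg fun _ => mul_nonneg (Real.exp_pos _).le (controlledNorm_nonneg _ _)

lemma bcNorm_le (h : ∀ m, controlledNorm (fibre 𝓦 m) (U m) ≤ c * weight η m) :
    bcNorm η 𝓦 U ≤ c :=
  ciSup_le fun m => (exp_neg_mul_le_iff m).2 (h m)

lemma controlledNorm_le_bcNorm (hU : U ∈ bcSpace η 𝓦) (m : ℕ) :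
    controlledNorm (fibre 𝓦 m) (U m) ≤ bcNorm η 𝓦 U * weight η m :=
  (exp_neg_mul_le_iff m).1 (le_ciSup hU.2.2 m)

lemma seqControlledBy_bcNorm (hα : 0 < α) (hU : U ∈ bcSpace η 𝓦) :
    SeqControlledBy η 𝓦 U (bcNorm η 𝓦 U) := fun m =>
  ((hU.1 m).controlledBy hα).mono (controlledNorm_le_bcNorm hU m)

namespace SeqControlledBy

lemma controlledNorm_le (hU : SeqControlledBy η 𝓦 U c) (m : ℕ) :
    controlledNorm (fibre 𝓦 m) (U m) ≤ 4 * c * weight η m :=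
  (hU m).controlledNorm_le.trans_eq (mul_assoc _ _ _).symm

lemma bcNorm_le (hU : SeqControlledBy η 𝓦 U c) : bcNorm η 𝓦 U ≤ 4 * c :=
  RoughCenter.bcNorm_le hU.controlledNorm_le

lemma mem_bcSpace (hU : SeqControlledBy η 𝓦 U c) (hα : 0 < α)
    (h : ∀ m, (U m).1 0 = (U (m + 1)).1 1) : U ∈ bcSpace η 𝓦 :=
  ⟨fun m => (hU m).isControlled hα, h, ⟨4 * c,
    forall_mem_range.2 fun m => (exp_neg_mul_le_iff m).2 (hU.controlledNorm_le m)⟩⟩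

lemma add (hU : SeqControlledBy η 𝓦 U c) (hU' : SeqControlledBy η 𝓦 U' c') :
    SeqControlledBy η 𝓦 (U + U') (c + c') := fun m => by
  rw [add_mul]
  exact (hU m).add (hU' m)

lemma sub (hU : SeqControlledBy η 𝓦 U c) (hU' : SeqControlledBy η 𝓦 U' c') :
    SeqControlledBy η 𝓦 (U - U') (c + c') := fun m => by
  rw [add_mul]
  exact (hU m).sub (hU' m)

lemma mono (hU : SeqControlledBy η 𝓦 U c) (h : c ≤ c') : SeqControlledBy η 𝓦 U c' := fun m =>
  (hU m).mono (mul_le_mul_of_nonneg_right h (weight_pos η m).le)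

lemma eq_zero (hU : SeqControlledBy η 𝓦 U 0) : U = 0 := by
  funext m
  have h := hU m
  rw [zero_mul] at h
  exact Prod.ext (funext fun t => norm_le_zero_iff.1 (h.sup t))
    (funext fun t => norm_le_zero_iff.1 (h.deriv_sup t))

lemma of_tendsto {ι : Type*} {l : Filter ι} [l.NeBot] {u : ι → Seq V X}
    (h : ∀ᶠ k in l, SeqControlledBy η 𝓦 (u k) c)
    (h1 : ∀ m t, Tendsto (fun k => (u k m).1 t) l (𝓝 ((U m).1 t)))
    (h2 : ∀ m t, Tendsto (fun k => (u k m).2 t) l (𝓝 ((U m).2 t))) :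
    SeqControlledBy η 𝓦 U c := fun m =>
  .of_tendsto (h.mono fun _ hk => hk m) (h1 m) (h2 m)

end SeqControlledBy

lemma seqControlledBy_zero : SeqControlledBy η 𝓦 (0 : Seq V X) 0 := fun m => by
  rw [zero_mul]
  exact ⟨by simp, by simp, by simp, by simp [remainder]⟩

lemma zero_mem_bcSpace (hα : 0 < α) : (0 : Seq V X) ∈ bcSpace η 𝓦 :=
  seqControlledBy_zero.mem_bcSpace hα fun _ => rfl

lemma sub_mem_bcSpace (hα : 0 < α) (hU : U ∈ bcSpace η 𝓦) (hU' : U' ∈ bcSpace η 𝓦) :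
    U - U' ∈ bcSpace η 𝓦 :=
  ((seqControlledBy_bcNorm hα hU).sub (seqControlledBy_bcNorm hα hU')).mem_bcSpace hα
    fun m => by simp [hU.2.1 m, hU'.2.1 m]

lemma bcNorm_add_le (hα : 0 < α) (hU : U ∈ bcSpace η 𝓦) (hU' : U' ∈ bcSpace η 𝓦) :
    bcNorm η 𝓦 (U + U') ≤ bcNorm η 𝓦 U + bcNorm η 𝓦 U' :=
  bcNorm_le fun m => by
    rw [add_mul]
    exact ((hU.1 m).controlledNorm_add_le (hU'.1 m) hα).trans
      (add_le_add (controlledNorm_le_bcNorm hU m) (controlledNorm_le_bcNorm hU' m))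

lemma bcNorm_sub_comm (U U' : Seq V X) : bcNorm η 𝓦 (U - U') = bcNorm η 𝓦 (U' - U) := by
  simp only [bcNorm, Pi.sub_apply, controlledNorm_sub_comm]

/-- The space `BC^η(D^{2α}_W)` as a type. It is not the subtype of `bcSpace`, on which the product
uniformity of `Seq V X` would compete with the one of the norm. -/
def BCSeq (X : Type*) [NormedAddCommGroup X] [NormedSpace ℝ X] (η : ℝ) (𝓦 : RoughPath V α) :
    Type _ :=
  bcSpace (X := X) η 𝓦

/-- The distance `‖U - U'‖` on `BC^η(D^{2α}_W)`. It is not an instance because it is a metric only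
for `0 < α`. -/
abbrev bcMetricSpace (hα : 0 < α) : MetricSpace (BCSeq X η 𝓦) where
  dist U U' := bcNorm η 𝓦 (U.1 - U'.1)
  dist_self U := le_antisymm (by simpa using (seqControlledBy_zero (X := X)).bcNorm_le)
    (bcNorm_nonneg _ _ _)
  dist_comm U U' := bcNorm_sub_comm _ _
  dist_triangle U U' U'' := by
    simpa using bcNorm_add_le hα (sub_mem_bcSpace hα U.2 U'.2) (sub_mem_bcSpace hα U'.2 U''.2)
  eq_of_dist_eq_zero {U U'} h := by
    have h0 := seqControlledBy_bcNorm hα (sub_mem_bcSpace hα U.2 U'.2)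
    rw [h] at h0
    exact Subtype.ext (sub_eq_zero.1 h0.eq_zero)

variable [CompleteSpace X]

lemma exists_pointwise_limit (hα : 0 < α) {u : ℕ → BCSeq X η 𝓦}
    (hu : letI := bcMetricSpace (X := X) (η := η) (𝓦 := 𝓦) hα; CauchySeq u) :
    ∃ Γ : Seq V X, ∀ m t, Tendsto (fun k => ((u k).1 m).1 t) atTop (𝓝 ((Γ m).1 t)) ∧
      Tendsto (fun k => ((u k).1 m).2 t) atTop (𝓝 ((Γ m).2 t)) := by
  let _ := bcMetricSpace (X := X) (η := η) (𝓦 := 𝓦) hα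
  have hdist (U U' : BCSeq X η 𝓦) : SeqControlledBy η 𝓦 (U.1 - U'.1) (dist U U') :=
    seqControlledBy_bcNorm hα (sub_mem_bcSpace hα U.2 U'.2)
  have heval (m : ℕ) (t : I) :
      LipschitzWith (weight η m).toNNReal fun U : BCSeq X η 𝓦 => (U.1 m).1 t :=
    LipschitzWith.of_dist_le' fun U U' => by
      simpa [dist_eq_norm, mul_comm] using (hdist U U' m).sup t
  have heval_deriv (m : ℕ) (t : I) :
      LipschitzWith (weight η m).toNNReal fun U : BCSeq X η 𝓦 => (U.1 m).2 t :=
    LipschitzWith.of_dist_le' fun U U' => by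
      simpa [dist_eq_norm, mul_comm] using (hdist U U' m).deriv_sup t
  choose y hy using fun m t =>
    cauchySeq_tendsto_of_complete ((heval m t).uniformContinuous.comp_cauchySeq hu)
  choose y' hy' using fun m t =>
    cauchySeq_tendsto_of_complete ((heval_deriv m t).uniformContinuous.comp_cauchySeq hu)
  exact ⟨fun m => (y m, y' m), fun m t => ⟨hy m t, hy' m t⟩⟩

theorem completeSpace_bcSeq (hα : 0 < α) :
    letI := bcMetricSpace (X := X) (η := η) (𝓦 := 𝓦) hα
    CompleteSpace (BCSeq X η 𝓦) := by
  let _ := bcMetricSpace (X := X) (η := η) (𝓦 := 𝓦) hα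
  refine Metric.complete_of_cauchySeq_tendsto fun u hu => ?_
  obtain ⟨Γ, hΓ⟩ := exists_pointwise_limit hα hu
  have hclose (ε : ℝ) (hε : 0 < ε) :
      ∃ N, ∀ k ≥ N, SeqControlledBy η 𝓦 ((u k).1 - Γ) ε := by
    obtain ⟨N, hN⟩ := Metric.cauchySeq_iff.1 hu ε hε
    refine ⟨N, fun k hk => .of_tendsto (u := fun j => (u k).1 - (u j).1)
      ((eventually_ge_atTop N).mono fun j hj => ?_) (fun m t => tendsto_const_nhds.sub (hΓ m t).1)
      fun m t => tendsto_const_nhds.sub (hΓ m t).2⟩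
    exact (seqControlledBy_bcNorm hα (sub_mem_bcSpace hα (u k).2 (u j).2)).mono (hN k hk j hj).le
  have hmem : Γ ∈ bcSpace η 𝓦 := by
    obtain ⟨N, hN⟩ := hclose 1 one_pos
    have h := (seqControlledBy_bcNorm hα (u N).2).sub (hN N le_rfl)
    rw [sub_sub_cancel] at h
    exact h.mem_bcSpace hα fun m => tendsto_nhds_unique (hΓ m 0).1
      ((hΓ (m + 1) 1).1.congr fun k => ((u k).2.2.1 m).symm)
  refine ⟨⟨Γ, hmem⟩, Metric.tendsto_atTop.2 fun ε hε => ?_⟩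
  obtain ⟨N, hN⟩ := hclose (ε / 5) (by positivity)
  refine ⟨N, fun k hk => ?_⟩
  calc bcNorm η 𝓦 ((u k).1 - Γ) ≤ 4 * (ε / 5) := (hN k hk).bcNorm_le
    _ < ε := by linarith

theorem existsUnique_fixedPoint (hα : 0 < α) {κ : NNReal} (hκ : κ < 1) {T : Seq V X → Seq V X}
    (hT : MapsTo T (bcSpace η 𝓦) (bcSpace η 𝓦))
    (hc : ∀ U ∈ bcSpace η 𝓦, ∀ U' ∈ bcSpace η 𝓦,
      bcNorm η 𝓦 (T U - T U') ≤ κ * bcNorm η 𝓦 (U - U')) :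
    ∃! Γ : Seq V X, Γ ∈ bcSpace η 𝓦 ∧ T Γ = Γ := by
  let _ := bcMetricSpace (X := X) (η := η) (𝓦 := 𝓦) hα
  have := completeSpace_bcSeq (X := X) (η := η) (𝓦 := 𝓦) hα
  have : Nonempty (BCSeq X η 𝓦) := ⟨⟨0, zero_mem_bcSpace hα⟩⟩
  have hcontr : ContractingWith κ (fun U => hT.restrict T _ _ U : BCSeq X η 𝓦 → BCSeq X η 𝓦) :=
    ⟨hκ, LipschitzWith.of_dist_le_mul fun U U' => hc U.1 U.2 U'.1 U'.2⟩
  refine ⟨hcontr.fixedPoint.1, ⟨hcontr.fixedPoint.2,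
    congrArg Subtype.val hcontr.fixedPoint_isFixedPt⟩, fun Γ hΓ => ?_⟩
  exact congrArg Subtype.val (hcontr.fixedPoint_unique (x := ⟨Γ, hΓ.1⟩) (Subtype.ext hΓ.2))

end SequenceSpace

/-! ### The dichotomy and the sums over the unit intervals -/

/-- The group `S` splits along the projections `Pc` and `Ps` and obeys the bounds of the exponential
dichotomy on their ranges. -/
structure IsDichotomy {X : Type*} [NormedAddCommGroup X] [NormedSpace ℝ X] (S : ℝ → X →L[ℝ] X)
    (Pc Ps : X →L[ℝ] X) (β γ Mc Ms : ℝ) : Prop where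
  center : IsInvariantProjection S Pc
  stable : IsInvariantProjection S Ps
  add_eq : ∀ x, Pc x + Ps x = x
  center_nonneg : 0 ≤ Mc
  stable_nonneg : 0 ≤ Ms
  center_bound : ∀ t ≤ 0, ∀ x, Pc x = x → ‖S t x‖ ≤ Mc * Real.exp (γ * t) * ‖x‖
  stable_bound : ∀ t, 0 ≤ t → ∀ x, Ps x = x → ‖S t x‖ ≤ Ms * Real.exp (-β * t) * ‖x‖

section Sums

variable {X : Type*} [NormedAddCommGroup X] [NormedSpace ℝ X]
variable {S : ℝ → X →L[ℝ] X} {m₀ β γ Mc Ms η c : ℝ} {Pc Ps : X →L[ℝ] X} {u u' v v' : ℕ → X}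

/-- The sum over `k = 0, -1, …, i` of the contributions `u` of the center part, transported to time
`i - 1`, where `i = -m` and `k = -j`. -/
def centerSum (S : ℝ → X →L[ℝ] X) (u : ℕ → X) (m : ℕ) : X :=
  ∑ j ∈ Finset.range (m + 1), S (-((m : ℝ) - j)) (u j)

/-- The sum over `k ≤ i - 1` of the contributions `v` of the stable part, transported to time
`i - 1`, where `i = -m` and `k = i - 1 - l`. -/
def stableSum (S : ℝ → X →L[ℝ] X) (v : ℕ → X) (m : ℕ) : X :=
  ∑' l : ℕ, S ((l : ℝ) + 1) (v (m + 1 + l))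

/-- The constant in the bound of the Lyapunov-Perron map: two geometric series, from the sums over
the unit intervals, and the two convolutions over the current interval. -/
def dichotomyConst (β γ Mc Ms η : ℝ) : ℝ :=
  Mc / (1 - Real.exp (-(γ - η))) + Ms / (1 - Real.exp (-(β + η))) + 2

lemma centerSum_sub (u u' : ℕ → X) (m : ℕ) :
    centerSum S (u - u') m = centerSum S u m - centerSum S u' m := by
  simp [centerSum, Finset.sum_sub_distrib]

lemma stableSum_sub {m : ℕ} (hv : Summable fun l : ℕ => S ((l : ℝ) + 1) (v (m + 1 + l)))
    (hv' : Summable fun l : ℕ => S ((l : ℝ) + 1) (v' (m + 1 + l))) :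
    stableSum S (v - v') m = stableSum S v m - stableSum S v' m := by
  simp [stableSum, hv.tsum_sub hv']

namespace IsDichotomy

lemma norm_center_term_le (h : IsDichotomy S Pc Ps β γ Mc Ms) (hPu : ∀ j, Pc (u j) = u j)
    (hu : ∀ j, ‖u j‖ ≤ c * weight η j) {j m : ℕ} (hjm : j ≤ m) :
    ‖S (-((m : ℝ) - j)) (u j)‖ ≤ c * Mc * weight η m * Real.exp (-(γ - η)) ^ (m - j) := by
  have hMc := h.center_nonneg
  have hjm' : (j : ℝ) ≤ m := by exact_mod_cast hjm
  have hexp : Real.exp (γ * -((m : ℝ) - j)) * weight η j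
      = weight η m * Real.exp (-(γ - η)) ^ (m - j) := by
    rw [← Real.exp_nat_mul, weight, weight, ← Real.exp_add, ← Real.exp_add, Nat.cast_sub hjm]
    ring_nf
  calc ‖S (-((m : ℝ) - j)) (u j)‖
      ≤ Mc * Real.exp (γ * -((m : ℝ) - j)) * ‖u j‖ :=
        h.center_bound _ (by linarith) _ (hPu j)
    _ ≤ Mc * Real.exp (γ * -((m : ℝ) - j)) * (c * weight η j) :=
        mul_le_mul_of_nonneg_left (hu j) (mul_nonneg hMc (Real.exp_pos _).le)
    _ = c * Mc * weight η m * Real.exp (-(γ - η)) ^ (m - j) := by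
        linear_combination c * Mc * hexp

lemma norm_centerSum_le (h : IsDichotomy S Pc Ps β γ Mc Ms) (hηγ : η < γ)
    (hPu : ∀ j, Pc (u j) = u j) (hu : ∀ j, ‖u j‖ ≤ c * weight η j) (m : ℕ) :
    ‖centerSum S u m‖ ≤ c * (Mc / (1 - Real.exp (-(γ - η)))) * weight η m := by
  set q := Real.exp (-(γ - η))
  have hq0 : 0 ≤ q := (Real.exp_pos _).le
  have hq1 : q < 1 := Real.exp_lt_one_iff.2 (by linarith)
  have hgeom : ∑ i ∈ Finset.range (m + 1), q ^ i ≤ (1 - q)⁻¹ :=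
    (tsum_geometric_of_lt_one hq0 hq1).symm ▸
      (summable_geometric_of_lt_one hq0 hq1).sum_le_tsum _ fun i _ => pow_nonneg hq0 i
  calc ‖centerSum S u m‖
      ≤ ∑ j ∈ Finset.range (m + 1), c * Mc * weight η m * q ^ (m + 1 - 1 - j) :=
        norm_sum_le_of_le _ fun j hj =>
          h.norm_center_term_le hPu hu (Nat.lt_succ_iff.1 (Finset.mem_range.1 hj))
    _ = c * Mc * weight η m * ∑ i ∈ Finset.range (m + 1), q ^ i := by
        rw [← Finset.mul_sum, Finset.sum_range_reflect (fun i => q ^ i)]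
    _ ≤ c * Mc * weight η m * (1 - q)⁻¹ :=
        mul_le_mul_of_nonneg_left hgeom (mul_nonneg (mul_nonneg
          (nonneg_of_norm_le_mul_weight hu) h.center_nonneg) (weight_pos η m).le)
    _ = c * (Mc / (1 - q)) * weight η m := by ring

lemma norm_stable_term_le (h : IsDichotomy S Pc Ps β γ Mc Ms) (hβη : -β < η)
    (hPv : ∀ j, Ps (v j) = v j) (hv : ∀ j, ‖v j‖ ≤ c * weight η j) (m l : ℕ) :
    ‖S ((l : ℝ) + 1) (v (m + 1 + l))‖ ≤ c * Ms * weight η m * Real.exp (-(β + η)) ^ l := by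
  have hMs := h.stable_nonneg
  have hexp : Real.exp (-β * ((l : ℝ) + 1)) * weight η (m + 1 + l)
      ≤ weight η m * Real.exp (-(β + η)) ^ l := by
    rw [← Real.exp_nat_mul, weight, weight, ← Real.exp_add, ← Real.exp_add]
    refine Real.exp_le_exp.2 ?_
    push_cast
    linarith
  calc ‖S ((l : ℝ) + 1) (v (m + 1 + l))‖
      ≤ Ms * Real.exp (-β * ((l : ℝ) + 1)) * ‖v (m + 1 + l)‖ :=
        h.stable_bound _ (by positivity) _ (hPv _)
    _ ≤ Ms * Real.exp (-β * ((l : ℝ) + 1)) * (c * weight η (m + 1 + l)) :=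
        mul_le_mul_of_nonneg_left (hv _) (mul_nonneg hMs (Real.exp_pos _).le)
    _ = c * Ms * (Real.exp (-β * ((l : ℝ) + 1)) * weight η (m + 1 + l)) := by ring
    _ ≤ c * Ms * (weight η m * Real.exp (-(β + η)) ^ l) :=
        mul_le_mul_of_nonneg_left hexp (mul_nonneg (nonneg_of_norm_le_mul_weight hv) hMs)
    _ = c * Ms * weight η m * Real.exp (-(β + η)) ^ l := by ring

lemma summable_stable [CompleteSpace X] (h : IsDichotomy S Pc Ps β γ Mc Ms) (hβη : -β < η)
    (hPv : ∀ j, Ps (v j) = v j) (hv : ∀ j, ‖v j‖ ≤ c * weight η j) (m : ℕ) :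
    Summable fun l : ℕ => S ((l : ℝ) + 1) (v (m + 1 + l)) :=
  .of_norm_bounded ((summable_geometric_of_lt_one (Real.exp_pos _).le
    (Real.exp_lt_one_iff.2 (by linarith))).mul_left _) (h.norm_stable_term_le hβη hPv hv m)

lemma norm_stableSum_le (h : IsDichotomy S Pc Ps β γ Mc Ms) (hβη : -β < η)
    (hPv : ∀ j, Ps (v j) = v j) (hv : ∀ j, ‖v j‖ ≤ c * weight η j) (m : ℕ) :
    ‖stableSum S v m‖ ≤ c * (Ms / (1 - Real.exp (-(β + η)))) * weight η m := by
  have hs := (hasSum_geometric_of_lt_one (Real.exp_pos _).le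
    (Real.exp_lt_one_iff.2 (by linarith : -(β + η) < 0))).mul_left (c * Ms * weight η m)
  refine (tsum_of_norm_bounded hs (h.norm_stable_term_le hβη hPv hv m)).trans_eq ?_
  ring

lemma norm_center_orbit_le (h : IsDichotomy S Pc Ps β γ Mc Ms) (hηγ : η < γ) (ξ : X) (m : ℕ) :
    ‖S (-(m : ℝ) - 1) (Pc ξ)‖ ≤ Mc * ‖Pc ξ‖ * weight η m := by
  have hm : -(m : ℝ) - 1 ≤ 0 := by linarith [m.cast_nonneg (α := ℝ)]
  calc ‖S (-(m : ℝ) - 1) (Pc ξ)‖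
      ≤ Mc * Real.exp (γ * (-(m : ℝ) - 1)) * ‖Pc ξ‖ := h.center_bound _ hm _ (h.center.idem ξ)
    _ ≤ Mc * weight η m * ‖Pc ξ‖ :=
        mul_le_mul_of_nonneg_right (mul_le_mul_of_nonneg_left
          (Real.exp_le_exp.2 (mul_le_mul_of_nonpos_right hηγ.le hm)) h.center_nonneg)
          (norm_nonneg _)
    _ = Mc * ‖Pc ξ‖ * weight η m := by ring

end IsDichotomy

lemma IsLipschitzGroup.apply_centerSum_succ (hS : IsLipschitzGroup S m₀) (m : ℕ) :
    S 1 (centerSum S u (m + 1)) = centerSum S u m + S 1 (u (m + 1)) := by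
  rw [centerSum, Finset.sum_range_succ, map_add, map_sum, centerSum, sub_self, neg_zero, hS.zero]
  congr 1
  refine Finset.sum_congr rfl fun j _ => ?_
  rw [← hS.apply_add]
  congr 2
  push_cast
  ring

lemma IsLipschitzGroup.stableSum_eq_apply_succ (hS : IsLipschitzGroup S m₀)
    (hv : ∀ m : ℕ, Summable fun l : ℕ => S ((l : ℝ) + 1) (v (m + 1 + l))) (m : ℕ) :
    stableSum S v m = S 1 (v (m + 1)) + S 1 (stableSum S v (m + 1)) := by
  rw [stableSum, (hv m).tsum_eq_zero_add, stableSum, ContinuousLinearMap.map_tsum _ (hv (m + 1))]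
  congr 1
  · simp
  · refine tsum_congr fun l => ?_
    rw [← hS.apply_add]
    congr 2
    · push_cast
      ring
    · ring

end Sums

/-! ### The Lyapunov-Perron map -/

section Glue

variable {V : Type*} [NormedAddCommGroup V] [InnerProductSpace ℝ V] {α : ℝ}
variable {X : Type*} [NormedAddCommGroup X] [NormedSpace ℝ X]
variable {S : ℝ → X →L[ℝ] X} {m₀ β γ Mc Ms η c : ℝ} {P Pc Ps : X →L[ℝ] X}
variable {𝓦 : RoughPath V α} {ξ ξ' : X} {Y : PathPair V X} {Z Zc Zs Zc' Zs' : Seq V X}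

lemma controlledBy_const (hα : 0 < α) (hα2 : α ≤ 1 / 2) (x : X) :
    ControlledBy 𝓦 ((fun _ => x, 0) : PathPair V X) ‖x‖ :=
  controlledBy_of_lipschitz hα hα2 (fun _ => le_rfl) fun s t hst => by
    simpa using mul_nonneg (norm_nonneg x) (sub_nonneg.2 hst)

lemma IsLipschitzGroup.controlledBy_opMul (hS : IsLipschitzGroup S m₀) (hα : 0 < α)
    (hα2 : α ≤ 1 / 2) (hY : ControlledBy 𝓦 Y c) :
    ControlledBy 𝓦 (opMul (fun t : I => S t) Y) (2 * m₀ * c) := by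
  have hmem (t : I) : (t : ℝ) ∈ Icc (-1 : ℝ) 1 := ⟨by linarith [t.2.1], t.2.2⟩
  refine hY.opMul hα hα2 (fun t => hS.norm_le _ (hmem t)) fun s t hst => ?_
  simpa only [abs_of_nonneg (sub_nonneg.2 (Subtype.coe_le_coe.2 hst))] using
    hS.norm_sub_le _ (hmem s) _ (hmem t)

/-- The values at time `1` of the entries of a sequence. -/
def endpoints (Z : Seq V X) (m : ℕ) : X := (Z m).1 1

lemma endpoints_sub (Z Z' : Seq V X) : endpoints (Z - Z') = endpoints Z - endpoints Z' := rfl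

/-- A sequence of controlled rough paths which start at `0` and end in the range of `P`: the
convolutions `∫_0^t S(-r) P …` over the unit intervals are of this kind. -/
structure IsForcing (η : ℝ) (𝓦 : RoughPath V α) (P : X →L[ℝ] X) (Z : Seq V X) (c : ℝ) : Prop where
  bound : SeqControlledBy η 𝓦 Z c
  start : ∀ m, (Z m).1 0 = 0
  proj_endpoints : ∀ m, P (endpoints Z m) = endpoints Z m

lemma IsForcing.norm_endpoints_le (hZ : IsForcing η 𝓦 P Z c) (m : ℕ) :
    ‖endpoints Z m‖ ≤ c * weight η m :=
  (hZ.bound m).sup 1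

/-- The value at time `0` of the `m`-th entry of the Lyapunov-Perron map, with the contributions
`u` and `v` of the unit intervals to the center and to the stable part. -/
def entryPoint (S : ℝ → X →L[ℝ] X) (Pc : X →L[ℝ] X) (ξ : X) (u v : ℕ → X) (m : ℕ) : X :=
  S (-(m : ℝ) - 1) (Pc ξ) - centerSum S u m + stableSum S v m

/-- The Lyapunov-Perron map as a function of the center and stable convolutions `Zc` and `Zs` over
the unit intervals. It depends linearly on `(ξ, Zc, Zs)`. -/
def glue (S : ℝ → X →L[ℝ] X) (Pc : X →L[ℝ] X) (ξ : X) (Zc Zs : Seq V X) : Seq V X := fun m =>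
  opMul (fun t : I => S t)
    ((fun _ => entryPoint S Pc ξ (endpoints Zc) (endpoints Zs) m, 0) + (Zc m + Zs m))

lemma glue_sub (hs : ∀ m : ℕ, Summable fun l : ℕ => S ((l : ℝ) + 1) (endpoints Zs (m + 1 + l)))
    (hs' : ∀ m : ℕ, Summable fun l : ℕ => S ((l : ℝ) + 1) (endpoints Zs' (m + 1 + l))) :
    glue S Pc ξ Zc Zs - glue S Pc ξ' Zc' Zs' = glue S Pc (ξ - ξ') (Zc - Zc') (Zs - Zs') := by
  funext m
  have hentry : entryPoint S Pc (ξ - ξ') (endpoints (Zc - Zc')) (endpoints (Zs - Zs')) m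
      = entryPoint S Pc ξ (endpoints Zc) (endpoints Zs) m
        - entryPoint S Pc ξ' (endpoints Zc') (endpoints Zs') m := by
    rw [entryPoint, endpoints_sub, endpoints_sub, centerSum_sub, stableSum_sub (hs m) (hs' m)]
    simp only [entryPoint, map_sub]
    abel
  rw [Pi.sub_apply, glue, glue, ← opMul_sub, glue, hentry]
  congr 1
  ext <;> simp <;> abel

lemma glue_start_eq_end [CompleteSpace X] (h : IsDichotomy S Pc Ps β γ Mc Ms)
    (hS : IsLipschitzGroup S m₀) (hβη : -β < η) (hZc : IsForcing η 𝓦 Pc Zc c)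
    (hZs : IsForcing η 𝓦 Ps Zs c) (m : ℕ) :
    (glue S Pc ξ Zc Zs m).1 0 = (glue S Pc ξ Zc Zs (m + 1)).1 1 := by
  have hsucc : S (-(m : ℝ) - 1) (Pc ξ) = S 1 (S (-((m + 1 : ℕ) : ℝ) - 1) (Pc ξ)) := by
    rw [← hS.apply_add]
    congr 2
    push_cast
    ring
  have hstable := hS.stableSum_eq_apply_succ
    (h.summable_stable hβη hZs.proj_endpoints hZs.norm_endpoints_le) m
  simp only [glue, opMul, Prod.fst_add, Pi.add_apply, hZc.start, hZs.start, add_zero]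
  simp only [entryPoint, Icc.coe_zero, Icc.coe_one, hS.zero,
    ContinuousLinearMap.id_apply, map_add, map_sub, hsucc, hS.apply_centerSum_succ, hstable,
    endpoints]
  abel

theorem IsDichotomy.seqControlledBy_glue (h : IsDichotomy S Pc Ps β γ Mc Ms)
    (hS : IsLipschitzGroup S m₀) (hα : 0 < α) (hα2 : α ≤ 1 / 2) (hβη : -β < η) (hηγ : η < γ)
    (hZc : IsForcing η 𝓦 Pc Zc c) (hZs : IsForcing η 𝓦 Ps Zs c) (ξ : X) :
    SeqControlledBy η 𝓦 (glue S Pc ξ Zc Zs) (2 * m₀ * (Mc * ‖Pc ξ‖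
      + c * dichotomyConst β γ Mc Ms η)) := fun m => by
  have hentry : ‖entryPoint S Pc ξ (endpoints Zc) (endpoints Zs) m‖
      ≤ Mc * ‖Pc ξ‖ * weight η m + c * (Mc / (1 - Real.exp (-(γ - η)))) * weight η m
        + c * (Ms / (1 - Real.exp (-(β + η)))) * weight η m :=
    (norm_add_le _ _).trans (add_le_add ((norm_sub_le _ _).trans (add_le_add
      (h.norm_center_orbit_le hηγ ξ m)
      (h.norm_centerSum_le hηγ hZc.proj_endpoints hZc.norm_endpoints_le m)))
      (h.norm_stableSum_le hβη hZs.proj_endpoints hZs.norm_endpoints_le m))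
  refine (hS.controlledBy_opMul hα hα2 (((controlledBy_const hα hα2 _).mono hentry).add
    ((hZc.bound m).add (hZs.bound m)))).mono (le_of_eq ?_)
  rw [dichotomyConst]
  ring

end Glue

section LyapunovPerron

variable {V : Type*} [NormedAddCommGroup V] [InnerProductSpace ℝ V] {α : ℝ}
variable {X : Type*} [NormedAddCommGroup X] [NormedSpace ℝ X]

/-- Regularity of the coefficients and smallness of the cut-off radius `R` along `𝓦`: the constants
`ω` and `ρ` bound the size of the drift and of the diffusion after the cut-off. -/
structure IsAdmissible (F : X → X) (G : X → V →L[ℝ] X) (f : ℝ → ℝ) (R : RoughPath V α → ℝ)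
    (𝓦 : RoughPath V α) (ω L : NNReal) (M ρ : ℝ) : Prop where
  radius_pos : ∀ m, 0 < R (fibre 𝓦 m)
  radius_le : ∀ m, (1 + (fibre 𝓦 m).pathSeminorm + (fibre 𝓦 m).areaSeminorm)
    * (R (fibre 𝓦 m) ^ 2 * (1 + (fibre 𝓦 m).pathSeminorm) ^ 2) ≤ ρ
  drift_lipschitz : ∀ m, LipschitzOnWith ω F (Metric.closedBall 0 (R (fibre 𝓦 m)))
  drift_zero : F 0 = 0
  diffusion : IsCubicFlat G M
  cutoff : IsLipschitzCutoff f L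

/-- The convolutions `∫_0^t S(-r) P F_R(U^{i-1})(r) dr + ∫_0^t S(-r) P G_R(U^{i-1})(r) dΘ_{i-1}𝓦_r`
over all the unit intervals. -/
def localSeq (S : ℝ → X →L[ℝ] X) (F : X → X) (G : X → V →L[ℝ] X) (f : ℝ → ℝ)
    (R : RoughPath V α → ℝ) (P : X →L[ℝ] X) (𝓦 : RoughPath V α) (U : Seq V X) : Seq V X :=
  fun m => localPair S F G f (R (fibre 𝓦 m)) P (fibre 𝓦 m) (U m)

variable {S : ℝ → X →L[ℝ] X} {m₀ β γ Mc Ms η M ρ p : ℝ} {Pc Ps P : X →L[ℝ] X} {ω L : NNReal}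
variable {F : X → X} {G : X → V →L[ℝ] X} {f : ℝ → ℝ} {R : RoughPath V α → ℝ}
variable {𝓦 : RoughPath V α} {ξ : X} {U U' : Seq V X}

lemma localSeq_zero [FiniteDimensional ℝ V] [CompleteSpace X] (hα : 1 / 3 < α)
    (hα2 : α ≤ 1 / 2) (hS : IsLipschitzGroup S m₀) (P : X →L[ℝ] X) (hF0 : F 0 = 0)
    (hG0 : G 0 = 0) :
    localSeq S F G f R P 𝓦 (0 : Seq V X) = 0 :=
  funext fun _ => localPair_zero_right hα hα2 hS P hF0 hG0

namespace IsAdmissible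

lemma bound_nonneg (h : IsAdmissible F G f R 𝓦 ω L M ρ) : 0 ≤ ρ := by
  have hpath := (fibre 𝓦 0).pathSeminorm_nonneg
  have harea := (fibre 𝓦 0).areaSeminorm_nonneg
  exact le_trans (by positivity) (h.radius_le 0)

lemma isControlled_truncDiffusion (h : IsAdmissible F G f R 𝓦 ω L M ρ) (hα : 0 < α)
    (hU : U ∈ bcSpace η 𝓦) (m : ℕ) :
    IsControlled (fibre 𝓦 m) (truncDiffusion G f (R (fibre 𝓦 m)) (fibre 𝓦 m) (U m)) :=
  RoughCenter.isControlled_truncDiffusion h.diffusion h.cutoff (h.radius_pos m) hα (hU.1 m)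

lemma continuous_truncDrift (h : IsAdmissible F G f R 𝓦 ω L M ρ) (hα : 0 < α)
    (hU : U ∈ bcSpace η 𝓦) (m : ℕ) :
    Continuous (truncDrift F f (R (fibre 𝓦 m)) (fibre 𝓦 m) (U m)) :=
  RoughCenter.continuous_truncDrift (h.drift_lipschitz m) h.cutoff (h.radius_pos m) hα (hU.1 m)

variable [FiniteDimensional ℝ V] [CompleteSpace X]

lemma localSeq_start (h : IsAdmissible F G f R 𝓦 ω L M ρ) (hα : 1 / 3 < α) (hα2 : α ≤ 1 / 2)
    (hS : IsLipschitzGroup S m₀) (P : X →L[ℝ] X) (hU : U ∈ bcSpace η 𝓦) (m : ℕ) :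
    (localSeq S F G f R P 𝓦 U m).1 0 = 0 :=
  convolutionPair_apply_zero hα hα2 hS P (h.isControlled_truncDiffusion (by linarith) hU m)

lemma proj_localSeq (h : IsAdmissible F G f R 𝓦 ω L M ρ) (hα : 1 / 3 < α) (hα2 : α ≤ 1 / 2)
    (hS : IsLipschitzGroup S m₀) (hP : IsInvariantProjection S P) (hU : U ∈ bcSpace η 𝓦) (m : ℕ)
    (t : I) : P ((localSeq S F G f R P 𝓦 U m).1 t) = (localSeq S F G f R P 𝓦 U m).1 t :=
  hP.convolutionPair_apply hα hα2 hS (h.continuous_truncDrift (by linarith) hU m)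
    (h.isControlled_truncDiffusion (by linarith) hU m) t

lemma convolution_eq (h : IsAdmissible F G f R 𝓦 ω L M ρ) (hα : 1 / 3 < α) (hα2 : α ≤ 1 / 2)
    (hS : IsLipschitzGroup S m₀) (P : X →L[ℝ] X) (hU : U ∈ bcSpace η 𝓦) (m : ℕ) {a b : I}
    (hab : a ≤ b) (c : ℝ) :
    convolution S F G f (R (fibre 𝓦 m)) P (fibre 𝓦 m) (U m) a b c
      = S c ((localSeq S F G f R P 𝓦 U m).1 b - (localSeq S F G f R P 𝓦 U m).1 a) :=
  pathConvolution_eq hα hα2 hS P (h.continuous_truncDrift (by linarith) hU m)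
    (h.isControlled_truncDiffusion (by linarith) hU m) hab c

lemma apply_convolution_unit (h : IsAdmissible F G f R 𝓦 ω L M ρ) (hα : 1 / 3 < α)
    (hα2 : α ≤ 1 / 2) (hS : IsLipschitzGroup S m₀) (P : X →L[ℝ] X) (hU : U ∈ bcSpace η 𝓦) (m : ℕ)
    (s : ℝ) :
    S s (convolution S F G f (R (fibre 𝓦 m)) P (fibre 𝓦 m) (U m) 0 1 1)
      = S (s + 1) (endpoints (localSeq S F G f R P 𝓦 U) m) := by
  rw [h.convolution_eq hα hα2 hS P hU m zero_le_one, h.localSeq_start hα hα2 hS P hU, sub_zero,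
    hS.apply_add, endpoints]

lemma isForcing_localSeq_sub (h : IsAdmissible F G f R 𝓦 ω L M ρ) (hα : 1 / 3 < α)
    (hα2 : α ≤ 1 / 2) (hS : IsLipschitzGroup S m₀) (hP : IsInvariantProjection S P)
    (hp : ‖P‖ ≤ p) (hU : U ∈ bcSpace η 𝓦) (hU' : U' ∈ bcSpace η 𝓦) :
    IsForcing η 𝓦 P (localSeq S F G f R P 𝓦 U - localSeq S F G f R P 𝓦 U')
      (m₀ * p * (1 + L) * (ω + 10 * M * integralConst V α * ρ) * bcNorm η 𝓦 (U - U')) := by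
  have hα0 : 0 < α := by linarith
  have hm₀ := hS.nonneg
  have hp0 := (norm_nonneg P).trans hp
  have hM := h.diffusion.nonneg
  have hI := zero_le_one.trans (one_le_integralConst (V := V) hα)
  have hρ := h.bound_nonneg
  refine ⟨fun m => ?_, fun m => ?_, fun m => ?_⟩
  · refine (controlledBy_localPair_sub hα hα2 hS P (h.drift_lipschitz m) h.diffusion h.cutoff
      (h.radius_pos m) (hU.1 m) (hU'.1 m)).mono ?_
    rw [mul_assoc _ (bcNorm _ _ _)]
    refine mul_le_mul ?_ (controlledNorm_le_bcNorm (sub_mem_bcSpace hα0 hU hU') m)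
      (controlledNorm_nonneg _ _) (by positivity)
    have hpath := (fibre 𝓦 m).pathSeminorm_nonneg
    have harea := (fibre 𝓦 m).areaSeminorm_nonneg
    gcongr
    exact h.radius_le m
  · rw [Pi.sub_apply, Prod.fst_sub, Pi.sub_apply, h.localSeq_start hα hα2 hS P hU,
      h.localSeq_start hα hα2 hS P hU', sub_zero]
  · rw [endpoints_sub, Pi.sub_apply, map_sub, endpoints, endpoints,
      h.proj_localSeq hα hα2 hS hP hU, h.proj_localSeq hα hα2 hS hP hU']

lemma isForcing_localSeq (h : IsAdmissible F G f R 𝓦 ω L M ρ) (hα : 1 / 3 < α)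
    (hα2 : α ≤ 1 / 2) (hS : IsLipschitzGroup S m₀) (hP : IsInvariantProjection S P)
    (hp : ‖P‖ ≤ p) (hU : U ∈ bcSpace η 𝓦) :
    IsForcing η 𝓦 P (localSeq S F G f R P 𝓦 U)
      (m₀ * p * (1 + L) * (ω + 10 * M * integralConst V α * ρ) * bcNorm η 𝓦 U) := by
  simpa only [localSeq_zero hα hα2 hS P h.drift_zero h.diffusion.zero, sub_zero] using
    h.isForcing_localSeq_sub hα hα2 hS hP hp hU (zero_mem_bcSpace (by linarith))

lemma summable_localSeq (h : IsAdmissible F G f R 𝓦 ω L M ρ)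
    (hdich : IsDichotomy S Pc Ps β γ Mc Ms) (hα : 1 / 3 < α) (hα2 : α ≤ 1 / 2)
    (hS : IsLipschitzGroup S m₀) (hβη : -β < η) (hU : U ∈ bcSpace η 𝓦) (m : ℕ) :
    Summable fun l : ℕ => S ((l : ℝ) + 1) (endpoints (localSeq S F G f R Ps 𝓦 U) (m + 1 + l)) :=
  have hZs := h.isForcing_localSeq hα hα2 hS hdich.stable le_rfl hU
  hdich.summable_stable hβη hZs.proj_endpoints hZs.norm_endpoints_le m

theorem isWellDefined (h : IsAdmissible F G f R 𝓦 ω L M ρ)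
    (hdich : IsDichotomy S Pc Ps β γ Mc Ms) (hα : 1 / 3 < α) (hα2 : α ≤ 1 / 2)
    (hS : IsLipschitzGroup S m₀) (hβη : -β < η) (hU : U ∈ bcSpace η 𝓦) :
    IsWellDefined S Pc Ps F G f R 𝓦 U := by
  refine ⟨fun P _ m a b c hab => ⟨_, (h.isControlled_truncDiffusion (by linarith) hU m)
    |>.isRoughIntegral_convolved hα hα2 hS P hab c⟩, fun m t => ?_⟩
  refine ((h.summable_localSeq hdich hα hα2 hS hβη hU m).mapL (S t)).congr fun l => ?_
  rw [h.apply_convolution_unit hα hα2 hS Ps hU, ← hS.apply_add, add_assoc (t : ℝ)]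

lemma sum_center_convolution_eq (h : IsAdmissible F G f R 𝓦 ω L M ρ) (hα : 1 / 3 < α)
    (hα2 : α ≤ 1 / 2) (hS : IsLipschitzGroup S m₀) (P : X →L[ℝ] X) (hU : U ∈ bcSpace η 𝓦) (m : ℕ)
    (t : ℝ) :
    ∑ j ∈ Finset.range m, S (t - m - 1 + j)
        (convolution S F G f (R (fibre 𝓦 j)) P (fibre 𝓦 j) (U j) 0 1 1)
      = S t (centerSum S (endpoints (localSeq S F G f R P 𝓦 U)) m)
        - S t (endpoints (localSeq S F G f R P 𝓦 U) m) := by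
  rw [centerSum, Finset.sum_range_succ, map_add, sub_self, neg_zero, hS.zero, map_sum,
    ContinuousLinearMap.id_apply, add_sub_cancel_right]
  refine Finset.sum_congr rfl fun j _ => ?_
  rw [h.apply_convolution_unit hα hα2 hS P hU, ← hS.apply_add]
  congr 2
  ring

lemma tsum_stable_convolution_eq (h : IsAdmissible F G f R 𝓦 ω L M ρ)
    (hdich : IsDichotomy S Pc Ps β γ Mc Ms) (hα : 1 / 3 < α) (hα2 : α ≤ 1 / 2)
    (hS : IsLipschitzGroup S m₀) (hβη : -β < η) (hU : U ∈ bcSpace η 𝓦) (m : ℕ) (t : ℝ) :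
    ∑' l : ℕ, S (t + l) (convolution S F G f (R (fibre 𝓦 (m + 1 + l))) Ps (fibre 𝓦 (m + 1 + l))
        (U (m + 1 + l)) 0 1 1)
      = S t (stableSum S (endpoints (localSeq S F G f R Ps 𝓦 U)) m) := by
  rw [stableSum, ContinuousLinearMap.map_tsum _ (h.summable_localSeq hdich hα hα2 hS hβη hU m)]
  refine tsum_congr fun l => ?_
  rw [h.apply_convolution_unit hα hα2 hS Ps hU, ← hS.apply_add, add_assoc (t : ℝ)]

theorem lyapunovPerron_eq_glue (h : IsAdmissible F G f R 𝓦 ω L M ρ)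
    (hdich : IsDichotomy S Pc Ps β γ Mc Ms) (hα : 1 / 3 < α) (hα2 : α ≤ 1 / 2)
    (hS : IsLipschitzGroup S m₀) (hβη : -β < η) (hU : U ∈ bcSpace η 𝓦) :
    lyapunovPerron S Pc Ps F G f R 𝓦 ξ U
      = glue S Pc ξ (localSeq S F G f R Pc 𝓦 U) (localSeq S F G f R Ps 𝓦 U) := by
  refine funext fun m => Prod.ext (funext fun t => ?_) (funext fun t => ?_)
  · have horbit : S ((t : ℝ) - m - 1) (Pc ξ) = S t (S (-(m : ℝ) - 1) (Pc ξ)) := by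
      rw [← hS.apply_add]
      congr 2
      ring
    simp only [lyapunovPerron, glue, opMul, Prod.fst_add, Pi.add_apply]
    rw [horbit, h.sum_center_convolution_eq hα hα2 hS Pc hU,
      h.convolution_eq hα hα2 hS Pc hU m t.2.2,
      h.tsum_stable_convolution_eq hdich hα hα2 hS hβη hU,
      h.convolution_eq hα hα2 hS Ps hU m t.2.1, h.localSeq_start hα hα2 hS Ps hU]
    simp only [entryPoint, endpoints, map_add, map_sub, sub_zero]
    abel
  · ext v
    simp [lyapunovPerron, glue, opMul, localSeq, localPair, convolutionPair, convolved,
      hS.apply_neg_apply, hdich.add_eq]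

theorem lyapunovPerron_mem_bcSpace (h : IsAdmissible F G f R 𝓦 ω L M ρ)
    (hdich : IsDichotomy S Pc Ps β γ Mc Ms) (hα : 1 / 3 < α) (hα2 : α ≤ 1 / 2)
    (hS : IsLipschitzGroup S m₀) (hβη : -β < η) (hηγ : η < γ) (hU : U ∈ bcSpace η 𝓦) :
    lyapunovPerron S Pc Ps F G f R 𝓦 ξ U ∈ bcSpace η 𝓦 := by
  have hZc := h.isForcing_localSeq hα hα2 hS hdich.center (le_max_left ‖Pc‖ ‖Ps‖) hU
  have hZs := h.isForcing_localSeq hα hα2 hS hdich.stable (le_max_right ‖Pc‖ ‖Ps‖) hU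
  rw [h.lyapunovPerron_eq_glue hdich hα hα2 hS hβη hU]
  exact (hdich.seqControlledBy_glue hS (by linarith) hα2 hβη hηγ hZc hZs ξ).mem_bcSpace
    (by linarith) (glue_start_eq_end hdich hS hβη hZc hZs)

theorem bcNorm_lyapunovPerron_sub_le (h : IsAdmissible F G f R 𝓦 ω L M ρ)
    (hdich : IsDichotomy S Pc Ps β γ Mc Ms) (hα : 1 / 3 < α) (hα2 : α ≤ 1 / 2)
    (hS : IsLipschitzGroup S m₀) (hβη : -β < η) (hηγ : η < γ)
    (hU : U ∈ bcSpace η 𝓦) (hU' : U' ∈ bcSpace η 𝓦) :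
    bcNorm η 𝓦 (lyapunovPerron S Pc Ps F G f R 𝓦 ξ U - lyapunovPerron S Pc Ps F G f R 𝓦 ξ U')
      ≤ 8 * m₀ * (m₀ * max ‖Pc‖ ‖Ps‖ * (1 + L) * (ω + 10 * M * integralConst V α * ρ))
        * dichotomyConst β γ Mc Ms η        * bcNorm η 𝓦 (U - U') := by
  have hcontrolled := hdich.seqControlledBy_glue hS (by linarith) hα2 hβη hηγ
    (h.isForcing_localSeq_sub hα hα2 hS hdich.center (le_max_left ‖Pc‖ ‖Ps‖) hU hU')
    (h.isForcing_localSeq_sub hα hα2 hS hdich.stable (le_max_right ‖Pc‖ ‖Ps‖) hU hU') (ξ - ξ)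
  rw [← glue_sub (h.summable_localSeq hdich hα hα2 hS hβη hU)
      (h.summable_localSeq hdich hα hα2 hS hβη hU'),
    ← h.lyapunovPerron_eq_glue hdich hα hα2 hS hβη hU,
    ← h.lyapunovPerron_eq_glue hdich hα hα2 hS hβη hU'] at hcontrolled
  refine hcontrolled.bcNorm_le.trans_eq ?_
  rw [sub_self, map_zero, norm_zero]
  ring

end IsAdmissible

end LyapunovPerron

section GapCondition

variable {β γ Mc Ms η K : ℝ}

lemma div_add_one_le_gap_term {x y : ℝ} (hη : η < 0) (hx : 0 < x) (hy : 0 ≤ y) :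
    y / (1 - Real.exp (-x)) + 1
      ≤ Real.exp x * (1 * y * Real.exp (-η) + 1) / (1 - Real.exp (-x)) := by
  have hq : 0 < 1 - Real.exp (-x) := sub_pos.2 (Real.exp_lt_one_iff.2 (by linarith))
  have hy' : y ≤ y * Real.exp (-η) := le_mul_of_one_le_right hy (Real.one_le_exp (by linarith))
  rw [le_div_iff₀ hq, add_mul, div_mul_cancel₀ _ hq.ne', one_mul, one_mul]
  calc y + (1 - Real.exp (-x)) ≤ y * Real.exp (-η) + 1 := by linarith [Real.exp_pos (-x)]
    _ ≤ Real.exp x * (y * Real.exp (-η) + 1) :=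
        le_mul_of_one_le_left (by linarith) (Real.one_le_exp hx.le)

lemma two_le_dichotomyConst (hβη : -β < η) (hηγ : η < γ) (hMc : 0 ≤ Mc) (hMs : 0 ≤ Ms) :
    2 ≤ dichotomyConst β γ Mc Ms η :=
  le_add_of_nonneg_left (add_nonneg
    (div_nonneg hMc (sub_nonneg.2 (Real.exp_le_one_iff.2 (by linarith))))
    (div_nonneg hMs (sub_nonneg.2 (Real.exp_le_one_iff.2 (by linarith)))))

lemma GapCondition.mul_dichotomyConst_lt (h : GapCondition 1 β γ Mc Ms η K) (hK : 0 < K)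
    (hβη : -β < η) (hη : η < 0) (hηγ : η < γ) (hMc : 0 ≤ Mc) (hMs : 0 ≤ Ms) :
    K * dichotomyConst β γ Mc Ms η < 1 / 4 := by
  refine (mul_le_mul_of_nonneg_left ?_ hK.le).trans_lt h
  rw [dichotomyConst]
  linarith [div_add_one_le_gap_term hη (by linarith : 0 < β + η) hMs,
    div_add_one_le_gap_term hη (sub_pos.2 hηγ) hMc]

lemma GapCondition.lt_one (h : GapCondition 1 β γ Mc Ms η K) (hK : 0 < K) (hβη : -β < η)
    (hη : η < 0) (hηγ : η < γ) (hMc : 0 ≤ Mc) (hMs : 0 ≤ Ms) : K < 1 := by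
  have hsum := le_mul_of_one_le_right hK.le
    (one_le_two.trans (two_le_dichotomyConst hβη hηγ hMc hMs))
  linarith [h.mul_dichotomyConst_lt hK hβη hη hηγ hMc hMs]

end GapCondition

section Main

variable {V : Type*} [NormedAddCommGroup V] [InnerProductSpace ℝ V] {α : ℝ}
variable {X : Type*} [NormedAddCommGroup X] [NormedSpace ℝ X]
variable {F : X → X} {G : X → V →L[ℝ] X} {f : ℝ → ℝ} {M : ℝ} {ω L : NNReal}

lemma exists_cutoff_scale (hF : ContDiff ℝ 1 F) (h0 : fderiv ℝ F 0 = 0) {Q : ℝ} (hQ : 0 ≤ Q)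
    (T : ℝ) :
    ∃ C₀ : ℝ → ℝ, (∀ K, 1 ≤ C₀ K) ∧
      ((∃ L, LipschitzWith L (fderiv ℝ F)) → ∀ K K', C₀ K = C₀ K') ∧
      ∀ K, 0 < K → ∃ ω : NNReal, LipschitzOnWith ω F (Metric.closedBall 0 (K / C₀ K)) ∧
        Q * (ω + T * (2 * (K / C₀ K))) ≤ K := by
  have hν : 0 < 1 / (2 * (Q + 1)) := by positivity
  obtain ⟨C₀, hC₀, hindep, hlip⟩ :=
    exists_lipschitz_scale hF h0 hν (b := max 1 (4 * Q * T)) (by positivity)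
  refine ⟨C₀, fun K => (le_max_left _ _).trans (hC₀ K), hindep, fun K hK => ⟨_, hlip K hK, ?_⟩⟩
  have hpos : 0 < C₀ K := zero_lt_one.trans_le ((le_max_left _ _).trans (hC₀ K))
  have hdrift : Q * (1 / (2 * (Q + 1)) * K) ≤ K / 2 := by
    rw [show Q * (1 / (2 * (Q + 1)) * K) = Q / (Q + 1) * (K / 2) by field_simp]
    exact mul_le_of_le_one_left (by positivity) ((div_le_one (by positivity)).2 (by linarith))
  have hdiffusion : Q * (T * (2 * (K / C₀ K))) ≤ K / 2 := by
    rw [show Q * (T * (2 * (K / C₀ K))) = 4 * Q * T / C₀ K * (K / 2) by ring]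
    exact mul_le_of_le_one_left (by positivity)
      ((div_le_one hpos).2 ((le_max_right _ _).trans (hC₀ K)))
  rw [Real.coe_toNNReal _ (by positivity), mul_add]
  linarith

lemma isAdmissible_cutoffRadius {C₀ C₁ C₂ K : ℝ} (hF0 : F 0 = 0) (hG : IsCubicFlat G M)
    (hf : IsLipschitzCutoff f L) (hK : 0 < K) (hC₀ : 0 < C₀) (hKC₀ : K ≤ C₀) (h1 : C₀ ≤ C₁)
    (h2 : C₀ ≤ C₂) (hF : LipschitzOnWith ω F (Metric.closedBall 0 (K / C₀))) (𝓦 : RoughPath V α) :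
    IsAdmissible F G f (cutoffRadius C₁ C₂ K) 𝓦 ω L M (2 * (K / C₀)) where
  radius_pos _ := cutoffRadius_pos hK (hC₀.trans_le h1) (hC₀.le.trans h2) _
  radius_le _ := cutoffRadius_sq_mul_le hK hC₀ hKC₀ h1 h2 _
  drift_lipschitz _ :=
    hF.mono (Metric.closedBall_subset_closedBall (cutoffRadius_le hK hC₀ h1 h2 _))
  drift_zero := hF0
  diffusion := hG
  cutoff := hf

theorem IsAdmissible.bcNorm_lyapunovPerron_sub_le_of_gapCondition [FiniteDimensional ℝ V]
    [CompleteSpace X] {S : ℝ → X →L[ℝ] X} {m₀ β γ Mc Ms η ρ K : ℝ} {Pc Ps : X →L[ℝ] X}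
    {R : RoughPath V α → ℝ} {𝓦 : RoughPath V α} {ξ : X} {U U' : Seq V X}
    (h : IsAdmissible F G f R 𝓦 ω L M ρ) (hdich : IsDichotomy S Pc Ps β γ Mc Ms) (hα : 1 / 3 < α)
    (hα2 : α ≤ 1 / 2) (hS : IsLipschitzGroup S m₀) (hβη : -β < η) (hη : η < 0) (hηγ : η < γ)
    (hK : 0 < K) (hgap : GapCondition 1 β γ Mc Ms η K)
    (hκ : 8 * m₀ * (m₀ * max ‖Pc‖ ‖Ps‖ * (1 + L) * (ω + 10 * M * integralConst V α * ρ)) ≤ K)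
    (hU : U ∈ bcSpace η 𝓦) (hU' : U' ∈ bcSpace η 𝓦) :
    bcNorm η 𝓦 (lyapunovPerron S Pc Ps F G f R 𝓦 ξ U - lyapunovPerron S Pc Ps F G f R 𝓦 ξ U')
      ≤ 1 / 4 * bcNorm η 𝓦 (U - U') := by
  refine (h.bcNorm_lyapunovPerron_sub_le hdich hα hα2 hS hβη hηγ hU hU').trans ?_
  have hsum := zero_le_two.trans
    (two_le_dichotomyConst hβη hηγ hdich.center_nonneg hdich.stable_nonneg)
  exact mul_le_mul_of_nonneg_right ((mul_le_mul_of_nonneg_right hκ hsum).trans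
    (hgap.mul_dichotomyConst_lt hK hβη hη hηγ hdich.center_nonneg hdich.stable_nonneg).le)
    (bcNorm_nonneg _ _ _)

theorem mainTheorem1_general [FiniteDimensional ℝ V] [CompleteSpace X] (B : X →L[ℝ] X)
    (hα : 1 / 3 < α) (hα2 : α ≤ 1 / 2) (Pc Ps : X →L[ℝ] X) (hF : ContDiff ℝ 1 F) (hF0 : F 0 = 0)
    (hF1 : fderiv ℝ F 0 = 0) (hG : IsCubicFlat G M) (hf : IsLipschitzCutoff f L) :
    ∃ C₀ : ℝ → ℝ, (∀ K, 0 < C₀ K) ∧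
      ((∃ L, LipschitzWith L (fderiv ℝ F)) → ∀ K K', C₀ K = C₀ K') ∧
    ∀ β γ Mc Ms : ℝ, IsDichotomy (expGroup B) Pc Ps β γ Mc Ms →
    ∀ η : ℝ, -β < η → η < 0 → η < γ →
    ∀ K : ℝ, 0 < K → GapCondition 1 β γ Mc Ms η K →
    ∀ C₁ C₂ : ℝ, C₀ K ≤ C₁ → C₀ K ≤ C₂ →
    ∀ 𝓦 : RoughPath V α,
      (∀ U ∈ bcSpace η 𝓦, IsWellDefined (expGroup B) Pc Ps F G f (cutoffRadius C₁ C₂ K) 𝓦 U) ∧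
      ∀ ξ : X,
        (∀ U ∈ bcSpace η 𝓦,
          lyapunovPerron (expGroup B) Pc Ps F G f (cutoffRadius C₁ C₂ K) 𝓦 ξ U ∈ bcSpace η 𝓦) ∧
        (∀ U ∈ bcSpace η 𝓦, ∀ U' ∈ bcSpace η 𝓦,
          bcNorm η 𝓦 (lyapunovPerron (expGroup B) Pc Ps F G f (cutoffRadius C₁ C₂ K) 𝓦 ξ U
              - lyapunovPerron (expGroup B) Pc Ps F G f (cutoffRadius C₁ C₂ K) 𝓦 ξ U')
            ≤ 1 / 4 * bcNorm η 𝓦 (U - U')) ∧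
        ∃! Γ : Seq V X, Γ ∈ bcSpace η 𝓦 ∧
          lyapunovPerron (expGroup B) Pc Ps F G f (cutoffRadius C₁ C₂ K) 𝓦 ξ Γ = Γ := by
  obtain ⟨m₀, hS⟩ := exists_isLipschitzGroup_expGroup B
  have hm₀ := hS.nonneg
  obtain ⟨C₀, hC₀, hindep, hscale⟩ := exists_cutoff_scale hF hF1
    (Q := 8 * m₀ * (m₀ * max ‖Pc‖ ‖Ps‖ * (1 + L))) (by positivity) (10 * M * integralConst V α)
  have hpos (K : ℝ) : 0 < C₀ K := zero_lt_one.trans_le (hC₀ K)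
  refine ⟨C₀, hpos, hindep, fun β γ Mc Ms hdich η hβη hη hηγ K hK hgap C₁ C₂ h1 h2 𝓦 => ?_⟩
  have hKC₀ : K ≤ C₀ K :=
    (hgap.lt_one hK hβη hη hηγ hdich.center_nonneg hdich.stable_nonneg).le.trans (hC₀ K)
  obtain ⟨ω, hω, hωK⟩ := hscale K hK
  have hadm := isAdmissible_cutoffRadius hF0 hG hf hK (hpos K) hKC₀ h1 h2 hω 𝓦
  refine ⟨fun U hU => hadm.isWellDefined hdich hα hα2 hS hβη hU, fun ξ => ?_⟩
  have hmem (U : Seq V X) (hU : U ∈ bcSpace η 𝓦) :=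
    hadm.lyapunovPerron_mem_bcSpace (ξ := ξ) hdich hα hα2 hS hβη hηγ hU
  have hcontr (U : Seq V X) (hU : U ∈ bcSpace η 𝓦) (U' : Seq V X) (hU' : U' ∈ bcSpace η 𝓦) :=
    hadm.bcNorm_lyapunovPerron_sub_le_of_gapCondition (ξ := ξ) hdich hα hα2 hS hβη hη hηγ hK hgap
      (by rwa [← mul_assoc]) hU hU'
  exact ⟨hmem, hcontr, existsUnique_fixedPoint (by linarith) (κ := 1 / 4) (by norm_num) hmem
    (by simpa using hcontr)⟩

end Main

lemma CenterStableSplitting.isDichotomy {n : ℕ} {A : Matrix (Fin n) (Fin n) ℝ}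
    {Pc Ps : Sp n →L[ℝ] Sp n} (h : CenterStableSplitting A Pc Ps) {β γ Mc Ms : ℝ}
    (hd : ExponentialDichotomy A β γ Mc Ms) : IsDichotomy (grp A) Pc Ps β γ Mc Ms := by
  obtain ⟨m₀, hS⟩ := exists_isLipschitzGroup_expGroup (Matrix.toEuclideanCLM (𝕜 := ℝ) A)
  exact
    { center := ⟨fun x => congrArg (fun T => T x) h.center_idem, hS.comm_of_nonneg h.center_comm⟩
      stable := ⟨fun x => congrArg (fun T => T x) h.stable_idem, hS.comm_of_nonneg h.stable_comm⟩
      add_eq := fun x => (add_comm _ _).trans (congrArg (fun T => T x) h.sum_eq)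
      center_nonneg := zero_le_one.trans hd.one_le_center
      stable_nonneg := zero_le_one.trans hd.one_le_stable
      center_bound := fun t ht x hx => hd.center_bound t ht x (h.center_range ▸ ⟨x, hx⟩)
      stable_bound := fun t ht x hx => hd.stable_bound t ht x (h.stable_range ▸ ⟨x, hx⟩) }

end

end RoughCenter

theorem mainTheorem1 {n : ℕ} (A : Matrix (Fin n) (Fin n) ℝ) :
    ∃ CS : ℝ, 0 < CS ∧
    ∀ (d : ℕ) (α : ℝ), 1 / 3 < α → α ≤ 1 / 2 →
    ∀ (Pc Ps : Sp n →L[ℝ] Sp n), CenterStableSplitting A Pc Ps →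
    ∀ F : Sp n → Sp n, DriftHypothesis F →
    ∀ G : Sp n → Sp d →L[ℝ] Sp n, DiffusionHypothesis G →
    ∀ f : ℝ → ℝ, IsCutoff f →
    ∃ C₀ : ℝ → ℝ, (∀ K, 0 < C₀ K) ∧
      ((∃ L, LipschitzWith L (fderiv ℝ F)) → ∀ K K', C₀ K = C₀ K') ∧
    ∀ β γ Mc Ms : ℝ, ExponentialDichotomy A β γ Mc Ms →
    ∀ η : ℝ, -β < η → η < 0 →
    ∀ K : ℝ, 0 < K → GapCondition CS β γ Mc Ms η K →
    ∀ C₁ C₂ : ℝ, C₀ K ≤ C₁ → C₀ K ≤ C₂ →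
    ∀ 𝓦 : RoughPath (Sp d) α,
      (∀ U ∈ bcSpace η 𝓦, IsWellDefined (grp A) Pc Ps F G f (cutoffRadius C₁ C₂ K) 𝓦 U) ∧
      ∀ ξ : Sp n,
        (∀ U ∈ bcSpace η 𝓦,
          lyapunovPerron (grp A) Pc Ps F G f (cutoffRadius C₁ C₂ K) 𝓦 ξ U ∈ bcSpace η 𝓦) ∧
        (∀ U ∈ bcSpace η 𝓦, ∀ U' ∈ bcSpace η 𝓦,
          bcNorm η 𝓦 (lyapunovPerron (grp A) Pc Ps F G f (cutoffRadius C₁ C₂ K) 𝓦 ξ U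
              - lyapunovPerron (grp A) Pc Ps F G f (cutoffRadius C₁ C₂ K) 𝓦 ξ U')
            ≤ 1 / 4 * bcNorm η 𝓦 (U - U')) ∧
        ∃! Γ : Seq (Sp d) (Sp n), Γ ∈ bcSpace η 𝓦 ∧
          lyapunovPerron (grp A) Pc Ps F G f (cutoffRadius C₁ C₂ K) 𝓦 ξ Γ = Γ := by
  refine ⟨1, one_pos, fun d α hα hα2 Pc Ps hsplit F hF G hG f hf => ?_⟩
  obtain ⟨M, hM⟩ := hG.smooth.2 3 (by norm_num) le_rfl
  obtain ⟨L, hL⟩ := hf.exists_isLipschitzCutoff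
  have hflat : IsCubicFlat G M :=
    .of_norm_iteratedFDeriv_le hG.smooth.1 hM hG.zero hG.fderiv_zero hG.fderiv_fderiv_zero
  obtain ⟨C₀, hpos, hindep, h⟩ :=
    mainTheorem1_general (Matrix.toEuclideanCLM (n := Fin n) (𝕜 := ℝ) A) hα hα2 Pc Ps
      hF.smooth.1 hF.zero hF.fderiv_zero hflat hL
  exact ⟨C₀, hpos, hindep, fun β γ Mc Ms hd η hβη hη =>
    h β γ Mc Ms (hsplit.isDichotomy hd) η hβη hη (hη.trans_le hd.gamma_nonneg)⟩
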